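/- Let $n\ge 3$, $k=\lfloor n/2\rfloor$. For $q=e^h$, $h\in\mathbb C$, with $q$ not a root of unity, put $q^{b}=e^{hb}$ and $[b]=\dfrac{q^{b/2}-q^{-b/2}}{q^{1/2}-q^{-1/2}}$. Let $U_q(\mathrm{so}(n,\mathbb C))$ be the complex associative unital algebra generated by $I_{i,i-1}$, $i=2,\dots,n$, with the relations (1) $[I_{i,i-1},I_{j,j-1}]=0$ if $|i-j|>1$; (2) $I_{i+1,i}^2I_{i,i-1}-(q^{1/2}+q^{-1/2})I_{i+1,i}I_{i,i-1}I_{i+1,i}+I_{i,i-1}I_{i+1,i}^2=-I_{i,i-1}$; (3) $I_{i+1,i}I_{i,i-1}^2-(q^{1/2}+q^{-1/2})I_{i,i-1}I_{i+1,i}I_{i,i-1}+I_{i,i-1}^2I_{i+1,i}=-I_{i+1,i}$. If $q>0$ (i.e. $h$ real, $h\neq 0$), $U_q(\mathrm{so}_n)$ denotes this algebra with the antilinear antiautomorphism $*$ determined by (4a) $I_{i,i-1}^*=-I_{i,i-1}$. Let $\mathbf m=(m_{1n},\dots,m_{kn})$ be numbers that are all integers or all half-integers (elements of $\mathbb Z+\tfrac12$),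 with $m_{1n}\ge\dots\ge m_{kn}\ge 0$ if $n=2k+1$, and $m_{1n}\ge\dots\ge m_{k-1,n}\ge|m_{kn}|$ if $n=2k$. A Gel'fand–Tsetlin pattern $\alpha$ with top row $\mathbf m$ is an array $(m_{ji})$, $2\le i\le n$, $1\le j\le\lfloor i/2\rfloor$, whose $n$-th row is $\mathbf m$, whose entries all differ from $m_{1n}$ by integers, and for which $$m_{1,2p+1}\ge m_{1,2p}\ge m_{2,2p+1}\ge\dots\ge m_{p,2p+1}\ge m_{p,2p}\ge -m_{p,2p+1}\quad(p\ge 1,\ 2p+1\le n),$$ $$m_{1,2p+2}\ge m_{1,2p+1}\ge m_{2,2p+2}\ge\dots\ge m_{p,2p+2}\ge m_{p,2p+1}\ge|m_{p+1,2p+2}|\quad(p\ge 1,\ 2p+2\le n).$$ Let $V_{\mathbf m}$ be the finite-dimensional complex inner product space with these patterns as an orthonormal basis. Let $\alpha^i_j$ and $\bar\alpha^i_j$ be obtained from $\alpha$ by replacing $m_{ji}$ by $m_{ji}+1$ and $m_{ji}-1$, and put $l_{j,2p}=m_{j,2p}+p-j$, $l_{j,2p+1}=m_{j,2p+1}+p-j+1$.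 Define operators on $V_{\mathbf m}$ by $$T_{\mathbf m}(I_{2p+1,2p})\alpha=\sum_{j=1}^pA^j_{2p}(\alpha)\,\alpha^{2p}_j-\sum_{j=1}^pA^j_{2p}(\bar\alpha^{2p}_j)\,\bar\alpha^{2p}_j,\tag{5}$$ $$T_{\mathbf m}(I_{2p+2,2p+1})\alpha=\sum_{j=1}^pB^j_{2p}(\alpha)\,\alpha^{2p+1}_j-\sum_{j=1}^pB^j_{2p}(\bar\alpha^{2p+1}_j)\,\bar\alpha^{2p+1}_j+\mathrm i\,\frac{\prod_{r=1}^{p+1}[l_{r,2p+2}]\prod_{r=1}^p[l_{r,2p}]}{\prod_{r=1}^p[l_{r,2p+1}][l_{r,2p+1}-1]}\,\alpha,\tag{6}$$ where, with $l_r=l_{r,2p+1}$, $l'_r=l_{r,2p}$, $l''_r=l_{r,2p-1}$, $$A^j_{2p}(\alpha)=\Bigl(\tfrac{[l'_j][l'_j+1]}{[2l'_j][2l'_j+2]}\,\tfrac{\prod_{r=1}^p[l_r+l'_j][|l_r-l'_j-1|]\prod_{r=1}^{p-1}[l''_r+l'_j][|l''_r-l'_j-1|]}{\prod_{r\ne j}[l'_r+l'_j][|l'_r-l'_j|][l'_r+l'_j+1][|l'_r-l'_j-1|]}\Bigr)^{1/2}\tag{7}$$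 and, with $l_r=l_{r,2p+2}$, $l'_r=l_{r,2p+1}$, $l''_r=l_{r,2p}$, $$B^j_{2p}(\alpha)=\Bigl(\tfrac{\prod_{r=1}^{p+1}[l_r+l'_j][|l_r-l'_j|]\prod_{r=1}^{p}[l''_r+l'_j][|l''_r-l'_j|]}{\prod_{r\ne j}[l'_r+l'_j][|l'_r-l'_j|][l'_r+l'_j-1][|l'_r-l'_j-1|]}\cdot\tfrac1{[l'_j]^2[2l'_j+1][2l'_j-1]}\Bigr)^{1/2}.\tag{8}$$ Here terms whose array is not a pattern are omitted, $[b]/[2b]$ is read as $1/(q^{b/2}+q^{-b/2})$ (also for $b=0$), and the last coefficient in (6) is read as $0$ if its denominator vanishes. (a) Let $q$ be any complex number, not $0$ and not a root of unity, with any choice of $h$ such that $q=e^h$. Take the square roots in (7), (8) factorwise: fix arbitrarily, for each argument $b$, one square root of $[b]$ and one of $1/(q^{b/2}+q^{-b/2})$, and replace each factor by its chosen root. Then the operators (5), (6) satisfy (1)–(3), and hence there is a unique algebra homomorphism from $U_q(\mathrm{so}(n,\mathbb C))$ to the linear operators on $V_{\mathbf m}$ that sends each $I_{i,i-1}$ to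 $T_{\mathbf m}(I_{i,i-1})$. (b) Let $q=e^h$ with $h$ real and nonzero. Then the expressions under the square roots in (7), (8) are positive whenever $\alpha$ and the raised array ($\alpha^{2p}_j$, respectively $\alpha^{2p+1}_j$) are patterns. With the positive square roots, the operators (5), (6) satisfy (1)–(3) and $T_{\mathbf m}(I_{i,i-1})^*=-T_{\mathbf m}(I_{i,i-1})$, and there is a unique algebra homomorphism $T_{\mathbf m}$ from $U_q(\mathrm{so}_n)$ to the linear operators on $V_{\mathbf m}$ taking these values on the generators and satisfying $T_{\mathbf m}(a^*)=T_{\mathbf m}(a)^*$ for all $a$. -/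

import Mathlib

open scoped ComplexConjugate

noncomputable section

/-! ## The algebra and its compact star structure -/

/-- `q^{1/2} + q^{-1/2}` for `q = e^h`. -/
def qTwo (h : ℂ) : ℂ := Complex.exp (h / 2) + Complex.exp (-(h / 2))

/-- The labels `i = 2, …, n` of the generators `I_{i,i-1}`. -/
abbrev SoIndex (n : ℕ) : Type := {i : ℕ // 2 ≤ i ∧ i ≤ n}

/-- The defining relations imposed on a family `X i`, standing for `I_{i,i-1}`, `i = 2, …, n`,
in a complex algebra: elements with `|i - j| > 1` commute, and neighbours satisfy the two
`q`-deformed cubic relations. -/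
def SatisfiesSoRelations {R : Type*} [Ring R] [Algebra ℂ R] (h : ℂ) (n : ℕ)
    (X : SoIndex n → R) : Prop :=
  (∀ i j : SoIndex n, i.1 + 1 < j.1 ∨ j.1 + 1 < i.1 → X i * X j - X j * X i = 0) ∧
  (∀ i j : SoIndex n, j.1 = i.1 + 1 →
    X j ^ 2 * X i - qTwo h • (X j * X i * X j) + X i * X j ^ 2 = -X i) ∧
  (∀ i j : SoIndex n, j.1 = i.1 + 1 →
    X j * X i ^ 2 - qTwo h • (X i * X j * X i) + X i ^ 2 * X j = -X j)

/-- The same relations, as a relation on the free algebra on the generators. -/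
inductive SoRel (h : ℂ) (n : ℕ) :
    FreeAlgebra ℂ (SoIndex n) → FreeAlgebra ℂ (SoIndex n) → Prop
  | comm (i j : SoIndex n) (hij : i.1 + 1 < j.1 ∨ j.1 + 1 < i.1) :
      SoRel h n
        (FreeAlgebra.ι ℂ i * FreeAlgebra.ι ℂ j - FreeAlgebra.ι ℂ j * FreeAlgebra.ι ℂ i) 0
  | cubic (i j : SoIndex n) (hij : j.1 = i.1 + 1) :
      SoRel h n
        (FreeAlgebra.ι ℂ j ^ 2 * FreeAlgebra.ι ℂ i
          - qTwo h • (FreeAlgebra.ι ℂ j * FreeAlgebra.ι ℂ i * FreeAlgebra.ι ℂ j)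
          + FreeAlgebra.ι ℂ i * FreeAlgebra.ι ℂ j ^ 2)
        (-FreeAlgebra.ι ℂ i)
  | cubic' (i j : SoIndex n) (hij : j.1 = i.1 + 1) :
      SoRel h n
        (FreeAlgebra.ι ℂ j * FreeAlgebra.ι ℂ i ^ 2
          - qTwo h • (FreeAlgebra.ι ℂ i * FreeAlgebra.ι ℂ j * FreeAlgebra.ι ℂ i)
          + FreeAlgebra.ι ℂ i ^ 2 * FreeAlgebra.ι ℂ j)
        (-FreeAlgebra.ι ℂ j)

/-- The algebra `U_q(so(n, ℂ))`, `q = e^h`: generators `I_{i,i-1}`, `i = 2, …, n`, subject to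
the defining relations. -/
def UqSo (h : ℂ) (n : ℕ) : Type := RingQuot (SoRel h n)

instance (h : ℂ) (n : ℕ) : Ring (UqSo h n) := inferInstanceAs (Ring (RingQuot (SoRel h n)))

instance (h : ℂ) (n : ℕ) : Algebra ℂ (UqSo h n) :=
  inferInstanceAs (Algebra ℂ (RingQuot (SoRel h n)))

namespace UqSo

/-- The generator `I_{i,i-1}`. -/
def gen (h : ℂ) (n : ℕ) (i : SoIndex n) : UqSo h n :=
  RingQuot.mkAlgHom ℂ (SoRel h n) (FreeAlgebra.ι ℂ i)

theorem gen_relations (h : ℂ) (n : ℕ) : SatisfiesSoRelations h n (gen h n) := by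
  refine ⟨fun i j hij => ?_, fun i j hij => ?_, fun i j hij => ?_⟩
  · simpa [gen] using! RingQuot.mkAlgHom_rel ℂ (SoRel.comm (h := h) i j hij)
  · simpa [gen] using! RingQuot.mkAlgHom_rel ℂ (SoRel.cubic (h := h) i j hij)
  · simpa [gen] using! RingQuot.mkAlgHom_rel ℂ (SoRel.cubic' (h := h) i j hij)

/-- Universal property: a family satisfying the relations defines an algebra homomorphism. -/
def lift {R : Type*} [Ring R] [Algebra ℂ R] {h : ℂ} {n : ℕ} (X : SoIndex n → R)
    (hX : SatisfiesSoRelations h n X) : UqSo h n →ₐ[ℂ] R :=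
  RingQuot.liftAlgHom ℂ ⟨FreeAlgebra.lift ℂ X, by
    intro a b hab
    cases hab with
    | comm i j hij => simpa using hX.1 i j hij
    | cubic i j hij => simpa using hX.2.1 i j hij
    | cubic' i j hij => simpa using hX.2.2 i j hij⟩

theorem lift_gen {R : Type*} [Ring R] [Algebra ℂ R] {h : ℂ} {n : ℕ} (X : SoIndex n → R)
    (hX : SatisfiesSoRelations h n X) (i : SoIndex n) : lift X hX (gen h n i) = X i := by
  unfold lift gen
  erw [RingQuot.liftAlgHom_mkAlgHom_apply]
  simp

theorem algHom_ext {R : Type*} [Ring R] [Algebra ℂ R] {h : ℂ} {n : ℕ}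
    {f g : UqSo h n →ₐ[ℂ] R} (hfg : ∀ i, f (gen h n i) = g (gen h n i)) : f = g := by
  refine RingQuot.ringQuot_ext' (S := ℂ) (s := SoRel h n) f g ?_
  refine FreeAlgebra.hom_ext ?_
  funext i
  exact hfg i

end UqSo

/-- The opposite algebra with conjugated scalars: an algebra homomorphism `A → ConjOp A` is an
antilinear antihomomorphism `A → A`. -/
def ConjOp (A : Type*) : Type _ := Aᵐᵒᵖ

instance (A : Type*) [Ring A] : Ring (ConjOp A) := inferInstanceAs (Ring Aᵐᵒᵖ)

instance (A : Type*) [Ring A] [Algebra ℂ A] : Algebra ℂ (ConjOp A) :=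
  Algebra.compHom Aᵐᵒᵖ (starRingEnd ℂ)

namespace UqSo

def toConjOp {A : Type*} (a : A) : ConjOp A := MulOpposite.op a

def ofConjOp {A : Type*} (a : ConjOp A) : A := MulOpposite.unop a

theorem conj_qTwo (h : ℝ) : conj (qTwo (h : ℂ)) = qTwo (h : ℂ) := by
  have h2 : conj (2 : ℂ) = 2 := Complex.conj_ofNat 2
  simp [qTwo, ← Complex.exp_conj, map_div₀, h2]

theorem conjOp_smul {A : Type*} [Ring A] [Algebra ℂ A] (z : ℂ) (a : A) :
    z • toConjOp a = toConjOp (conj z • a) := rfl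

theorem neg_gen_relations (h : ℝ) (n : ℕ) :
    SatisfiesSoRelations (h : ℂ) n (fun i => toConjOp (-gen (h : ℂ) n i)) := by
  have hm : ∀ a b : UqSo (h : ℂ) n, toConjOp a * toConjOp b = toConjOp (b * a) := fun _ _ => rfl
  have hs : ∀ a b : UqSo (h : ℂ) n, toConjOp a - toConjOp b = toConjOp (a - b) := fun _ _ => rfl
  have ha : ∀ a b : UqSo (h : ℂ) n, toConjOp a + toConjOp b = toConjOp (a + b) := fun _ _ => rfl
  have hn : ∀ a : UqSo (h : ℂ) n, -toConjOp a = toConjOp (-a) := fun _ => rfl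
  have hz : (0 : ConjOp (UqSo (h : ℂ) n)) = toConjOp 0 := rfl
  obtain ⟨h1, h2, h3⟩ := gen_relations (h : ℂ) n
  refine ⟨fun i j hij => ?_, fun i j hij => ?_, fun i j hij => ?_⟩
  · have := h1 j i hij.symm
    simp only [hm, hs, hz]
    congr 1
    simpa using this
  · have := congrArg Neg.neg (h2 i j hij)
    simp only [pow_two, hm, hs, ha, hn, conjOp_smul, conj_qTwo]
    congr 1
    rw [← this]
    simp only [mul_neg, neg_mul, neg_neg, smul_neg, pow_two, mul_assoc]
    abel
  · have := congrArg Neg.neg (h3 i j hij)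
    simp only [pow_two, hm, hs, ha, hn, conjOp_smul, conj_qTwo]
    congr 1
    rw [← this]
    simp only [mul_neg, neg_mul, neg_neg, smul_neg, pow_two, mul_assoc]
    abel

/-- The compact star operation, as a homomorphism to the conjugate opposite algebra. -/
def starHom (h : ℝ) (n : ℕ) : UqSo (h : ℂ) n →ₐ[ℂ] ConjOp (UqSo (h : ℂ) n) :=
  lift (fun i => toConjOp (-gen (h : ℂ) n i)) (neg_gen_relations h n)

/-- For real `h`, the antilinear antiautomorphism of `U_q(so(n, ℂ))` with
`I_{i,i-1}^* = -I_{i,i-1}`; the algebra with this star is the compact algebra `U_q(so_n)`. -/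
instance (h : ℝ) (n : ℕ) : Star (UqSo (h : ℂ) n) := ⟨fun a => ofConjOp (starHom h n a)⟩

theorem star_gen (h : ℝ) (n : ℕ) (i : SoIndex n) :
    star (gen (h : ℂ) n i) = -gen (h : ℂ) n i :=
  congrArg ofConjOp (lift_gen _ (neg_gen_relations h n) i)

theorem star_mul' (h : ℝ) (n : ℕ) (a b : UqSo (h : ℂ) n) : star (a * b) = star b * star a :=
  congrArg ofConjOp (map_mul (starHom h n) a b)

theorem star_add' (h : ℝ) (n : ℕ) (a b : UqSo (h : ℂ) n) : star (a + b) = star a + star b :=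
  congrArg ofConjOp (map_add (starHom h n) a b)

theorem star_algebraMap' (h : ℝ) (n : ℕ) (z : ℂ) :
    star (algebraMap ℂ (UqSo (h : ℂ) n) z) = algebraMap ℂ (UqSo (h : ℂ) n) (conj z) :=
  congrArg ofConjOp ((starHom h n).commutes z)

theorem star_star' (h : ℝ) (n : ℕ) (a : UqSo (h : ℂ) n) : star (star a) = a := by
  let f : UqSo (h : ℂ) n →ₐ[ℂ] UqSo (h : ℂ) n :=
    { toFun := fun a => star (star a)
      map_one' := by
        have := star_algebraMap' h n 1
        simp only [map_one] at this
        simp [this]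
      map_mul' := fun a b => by simp [star_mul']
      map_zero' := by
        have := star_algebraMap' h n 0
        simp only [map_zero] at this
        simp [this]
      map_add' := fun a b => by simp [star_add']
      commutes' := fun z => by simp [star_algebraMap'] }
  have hneg : ∀ b : UqSo (h : ℂ) n, star (-b) = -star b :=
    fun b => congrArg ofConjOp (map_neg (starHom h n) b)
  have hf : f = AlgHom.id ℂ _ := algHom_ext fun i => by
    change star (star (gen (h : ℂ) n i)) = gen (h : ℂ) n i
    rw [star_gen, hneg, star_gen, neg_neg]
  exact congrArg (fun g : UqSo (h : ℂ) n →ₐ[ℂ] UqSo (h : ℂ) n => g a) hf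

instance (h : ℝ) (n : ℕ) : StarRing (UqSo (h : ℂ) n) where
  star_involutive := star_star' h n
  star_mul := star_mul' h n
  star_add := star_add' h n

instance (h : ℝ) (n : ℕ) : StarModule ℂ (UqSo (h : ℂ) n) where
  star_smul z a := by
    rw [Algebra.smul_def, star_mul', star_algebraMap', ← Algebra.commutes, ← Algebra.smul_def]
    rfl

end UqSo

/-! ## Highest weights and Gel'fand–Tsetlin patterns

The entries `m_{jk}` of a pattern are written `α k j`, with these indices: rows
`k = 2, …, n`, and `1 ≤ j ≤ ⌊k/2⌋` in row `k`. -/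

/-- Highest weights `m 1, …, m ⌊n/2⌋` for `so_n`; the other values of `m` play no role. -/
def IsHighestWeight (n : ℕ) (m : ℕ → ℚ) : Prop :=
  ((∀ j, 1 ≤ j → j ≤ n / 2 → ∃ z : ℤ, m j = z) ∨
    (∀ j, 1 ≤ j → j ≤ n / 2 → ∃ z : ℤ, m j = z + 1 / 2)) ∧
  (Odd n → (∀ j, 1 ≤ j → j < n / 2 → m (j + 1) ≤ m j) ∧ 0 ≤ m (n / 2)) ∧
  (Even n → (∀ j, 1 ≤ j → j + 1 < n / 2 → m (j + 1) ≤ m j) ∧ |m (n / 2)| ≤ m (n / 2 - 1))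

/-- `α` is a Gel'fand–Tsetlin pattern for `so_n` with top row `m`. -/
structure IsGTPattern (n : ℕ) (m : ℕ → ℚ) (α : ℕ → ℕ → ℚ) : Prop where
  /-- there are no entries outside the triangle (the junk entries are `0`) -/
  support : ∀ k j, ¬(2 ≤ k ∧ k ≤ n ∧ 1 ≤ j ∧ j ≤ k / 2) → α k j = 0
  /-- the top row is the highest weight -/
  top : ∀ j, 1 ≤ j → j ≤ n / 2 → α n j = m j
  /-- all entries are integers, or all are half-integers, together with the highest weight -/
  integral : ∀ k j, 2 ≤ k → k ≤ n → 1 ≤ j → j ≤ k / 2 → ∃ z : ℤ, α k j - m 1 = z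
  /-- betweenness of the rows `2p + 1` and `2p` -/
  odd_row : ∀ p, 1 ≤ p → 2 * p + 1 ≤ n →
    (∀ j, 1 ≤ j → j ≤ p → α (2 * p) j ≤ α (2 * p + 1) j) ∧
    (∀ j, 1 ≤ j → j < p → α (2 * p + 1) (j + 1) ≤ α (2 * p) j) ∧
    -α (2 * p + 1) p ≤ α (2 * p) p
  /-- betweenness of the rows `2p + 2` and `2p + 1` -/
  even_row : ∀ p, 1 ≤ p → 2 * p + 2 ≤ n →
    (∀ j, 1 ≤ j → j ≤ p → α (2 * p + 1) j ≤ α (2 * p + 2) j) ∧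
    (∀ j, 1 ≤ j → j < p → α (2 * p + 2) (j + 1) ≤ α (2 * p + 1) j) ∧
    |α (2 * p + 2) (p + 1)| ≤ α (2 * p + 1) p

/-- The finite set of Gel'fand–Tsetlin patterns with top row `m`. -/
def GTPattern (n : ℕ) (m : ℕ → ℚ) : Type := {α : ℕ → ℕ → ℚ // IsGTPattern n m α}

theorem IsGTPattern.abs_entry_le {n : ℕ} {m : ℕ → ℚ} {α : ℕ → ℕ → ℚ} (hα : IsGTPattern n m α)
    (d : ℕ) : ∀ k j, k + d = n → 2 ≤ k → 1 ≤ j → j ≤ k / 2 →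
      |α k j| ≤ ∑ i ∈ Finset.range (n / 2 + 1), |m i| := by
  induction d with
  | zero =>
    intro k j hk h2 h1 hj
    obtain rfl : k = n := by omega
    rw [hα.top j h1 hj]
    exact Finset.single_le_sum (f := fun i => |m i|) (fun _ _ => abs_nonneg _)
      (Finset.mem_range.2 (by omega))
  | succ d ih =>
    intro k j hk h2 h1 hj
    have up : ∀ j, 1 ≤ j → j ≤ (k + 1) / 2 →
      -(∑ i ∈ Finset.range (n / 2 + 1), |m i|) ≤ α (k + 1) j ∧
        α (k + 1) j ≤ ∑ i ∈ Finset.range (n / 2 + 1), |m i| :=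
      fun j a b => abs_le.1 (ih (k + 1) j (by omega) (by omega) a b)
    rw [abs_le]
    rcases Nat.even_or_odd' k with ⟨p, rfl | rfl⟩
    · obtain ⟨a, b, c⟩ := hα.odd_row p (by omega) (by omega)
      have hjp : j ≤ p := by omega
      refine ⟨?_, (a j h1 hjp).trans (up j h1 (by omega)).2⟩
      rcases lt_or_eq_of_le hjp with hlt | rfl
      · exact (up (j + 1) (by omega) (by omega)).1.trans (b j h1 hlt)
      · have := (up j h1 (by omega)).2
        linarith
    · obtain ⟨a, b, c⟩ := hα.even_row p (by omega) (by omega)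
      have hjp : j ≤ p := by omega
      refine ⟨?_, (a j h1 hjp).trans (up j h1 (by omega)).2⟩
      rcases lt_or_eq_of_le hjp with hlt | rfl
      · exact (up (j + 1) (by omega) (by omega)).1.trans (b j h1 hlt)
      · exact (up (j + 1) (by omega) (by omega)).1.trans ((le_abs_self _).trans c)

instance (n : ℕ) (m : ℕ → ℚ) : Finite (GTPattern n m) := by
  classical
  set M : ℚ := ∑ i ∈ Finset.range (n / 2 + 1), |m i| with hM
  let S : Set ℚ := (fun z : ℤ => m 1 + z) '' Set.Icc ⌊-M - m 1⌋ ⌈M - m 1⌉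
  have hS : S.Finite := (Set.finite_Icc _ _).image _
  have : Finite S := hS
  have key : ∀ (α : GTPattern n m) (k j : ℕ), 2 ≤ k → k ≤ n → 1 ≤ j → j ≤ k / 2 →
      α.1 k j ∈ S := by
    intro α k j h2 hn h1 hj
    obtain ⟨z, hz⟩ := α.2.integral k j h2 hn h1 hj
    have hb := abs_le.1 (α.2.abs_entry_le (n - k) k j (by omega) h2 h1 hj)
    refine ⟨z, ⟨?_, ?_⟩, by simp only; linarith⟩
    · refine Int.floor_le_iff.2 ?_
      rw [← hz]; rw [← hM] at hb; linarith [hb.1]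
    · refine Int.le_ceil_iff.2 ?_
      rw [← hz]; rw [← hM] at hb; linarith [hb.2]
  let T : Type :=
    {x : Fin (n + 1) × Fin (n + 1) // 2 ≤ x.1.1 ∧ 1 ≤ x.2.1 ∧ x.2.1 ≤ x.1.1 / 2}
  let f : GTPattern n m → (T → S) := fun α x =>
    ⟨α.1 x.1.1 x.1.2, key α _ _ x.2.1 (by have := x.1.1.2; omega) x.2.2.1 x.2.2.2⟩
  refine Finite.of_injective f ?_
  intro α β hab
  refine Subtype.ext ?_
  funext k j
  by_cases h : 2 ≤ k ∧ k ≤ n ∧ 1 ≤ j ∧ j ≤ k / 2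
  · have := congrFun hab ⟨(⟨k, by omega⟩, ⟨j, by omega⟩), h.1, h.2.2.1, h.2.2.2⟩
    exact congrArg Subtype.val this
  · rw [α.2.support k j h, β.2.support k j h]

instance (n : ℕ) (m : ℕ → ℚ) : Fintype (GTPattern n m) := Fintype.ofFinite _

/-- The carrier space: the patterns `|α⟩` form an orthonormal basis. -/
abbrev GTSpace (n : ℕ) (m : ℕ → ℚ) : Type := EuclideanSpace ℂ (GTPattern n m)

open Classical in
/-- The vector `|α⟩` of an array `α`; arrays that are not patterns contribute `0`. -/
def ket (n : ℕ) (m : ℕ → ℚ) (α : ℕ → ℕ → ℚ) : GTSpace n m :=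
  if hα : IsGTPattern n m α then EuclideanSpace.single (⟨α, hα⟩ : GTPattern n m) 1 else 0

/-- Replace the entry `m_{jk}` by `m_{jk} + x`. -/
def shiftEntry (α : ℕ → ℕ → ℚ) (k j : ℕ) (x : ℚ) : ℕ → ℕ → ℚ :=
  Function.update α k (Function.update (α k) j (α k j + x))

/-! ## The operators -/

/-- The `q`-number `[b] = (q^{b/2} - q^{-b/2}) / (q^{1/2} - q^{-1/2})`, `q = e^h`. -/
def qNum (h : ℂ) (b : ℚ) : ℂ :=
  (Complex.exp (h * b / 2) - Complex.exp (-(h * b / 2))) /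
    (Complex.exp (h / 2) - Complex.exp (-(h / 2)))

/-- The quotient `[b] / [2b]` in the cancelled form `1 / (q^{b/2} + q^{-b/2})`, which also makes
sense at `b = 0`. -/
def qHalf (h : ℂ) (b : ℚ) : ℂ := 1 / (Complex.exp (h * b / 2) + Complex.exp (-(h * b / 2)))

theorem qHalf_eq (h : ℂ) (b : ℚ) (hb : qNum h b ≠ 0) : qHalf h b = qNum h b / qNum h (2 * b) := by
  have h2 : qNum h (2 * b) =
      qNum h b * (Complex.exp (h * b / 2) + Complex.exp (-(h * b / 2))) := by
    have e1 : Complex.exp (h * ((2 * b : ℚ) : ℂ) / 2) = Complex.exp (h * b / 2) ^ 2 := by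
      rw [← Complex.exp_nat_mul]; congr 1; push_cast; ring
    have e2 : Complex.exp (-(h * ((2 * b : ℚ) : ℂ) / 2)) = Complex.exp (-(h * b / 2)) ^ 2 := by
      rw [← Complex.exp_nat_mul]; congr 1; push_cast; ring
    rw [qNum, qNum, e1, e2]; ring
  rw [h2, div_mul_cancel_left₀ hb, qHalf, one_div]

/-- `l_{j,2p} = m_{j,2p} + p - j` and `l_{j,2p+1} = m_{j,2p+1} + p - j + 1`. -/
def ell (α : ℕ → ℕ → ℚ) (k j : ℕ) : ℚ :=
  if Even k then α k j + (k / 2 : ℕ) - j else α k j + (k / 2 : ℕ) - j + 1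

/-- The expression under the square root in `A^j_{2p}(α)`, with `[b]` written `s b` and
`[b] / [2b]` written `t b`. -/
def gtA (s t : ℚ → ℂ) (p j : ℕ) (α : ℕ → ℕ → ℚ) : ℂ :=
  let l' := ell α (2 * p)
  let l := ell α (2 * p + 1)
  let l'' := ell α (2 * p - 1)
  t (l' j) * t (l' j + 1) *
    (((∏ r ∈ Finset.Icc 1 p, s (l r + l' j) * s |l r - l' j - 1|) *
        ∏ r ∈ Finset.Icc 1 (p - 1), s (l'' r + l' j) * s |l'' r - l' j - 1|) /
      ∏ r ∈ (Finset.Icc 1 p).erase j,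
        s (l' r + l' j) * s |l' r - l' j| * s (l' r + l' j + 1) * s |l' r - l' j - 1|)

/-- The expression under the square root in `B^j_{2p}(α)`, with `[b]` written `s b`. -/
def gtB (s : ℚ → ℂ) (p j : ℕ) (α : ℕ → ℕ → ℚ) : ℂ :=
  let l := ell α (2 * p + 2)
  let l' := ell α (2 * p + 1)
  let l'' := ell α (2 * p)
  (((∏ r ∈ Finset.Icc 1 (p + 1), s (l r + l' j) * s |l r - l' j|) *
      ∏ r ∈ Finset.Icc 1 p, s (l'' r + l' j) * s |l'' r - l' j|) /
    ∏ r ∈ (Finset.Icc 1 p).erase j,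
      s (l' r + l' j) * s |l' r - l' j| * s (l' r + l' j - 1) * s |l' r - l' j - 1|) *
    (1 / (s (l' j) ^ 2 * s (2 * l' j + 1) * s (2 * l' j - 1)))

/-- The real factor of the diagonal coefficient of `T(I_{2p+2,2p+1})`. -/
def gtDiag (h : ℂ) (p : ℕ) (α : ℕ → ℕ → ℚ) : ℂ :=
  (∏ r ∈ Finset.Icc 1 (p + 1), qNum h (ell α (2 * p + 2) r)) *
    (∏ r ∈ Finset.Icc 1 p, qNum h (ell α (2 * p) r)) *
    (∏ r ∈ Finset.Icc 1 p,
      qNum h (ell α (2 * p + 1) r) * qNum h (ell α (2 * p + 1) r - 1))⁻¹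

/-- The part of the action common to both formulas: raise and lower the entries of row `k` of
`α`, with coefficients `C j`. -/
def gtMove (n : ℕ) (m : ℕ → ℚ) (C : ℕ → (ℕ → ℕ → ℚ) → ℂ) (k : ℕ) (α : ℕ → ℕ → ℚ) :
    GTSpace n m :=
  ∑ j ∈ Finset.Icc 1 (k / 2), C j α • ket n m (shiftEntry α k j 1) -
    ∑ j ∈ Finset.Icc 1 (k / 2), C j (shiftEntry α k j (-1)) • ket n m (shiftEntry α k j (-1))

/-- The operator `T(I_{i,i-1})` on the span of the patterns, with coefficients `A p j α` for
`A^j_{2p}(α)` and `B p j α` for `B^j_{2p}(α)`, given by its values on the patterns: the first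
case is `i = 2p + 1` and the second is `i = 2p + 2`. -/
def gtOp (h : ℂ) (n : ℕ) (m : ℕ → ℚ) (A B : ℕ → ℕ → (ℕ → ℕ → ℚ) → ℂ) (i : ℕ) :
    GTSpace n m →L[ℂ] GTSpace n m :=
  LinearMap.toContinuousLinearMap <|
    (EuclideanSpace.basisFun (GTPattern n m) ℂ).toBasis.constr ℂ fun α =>
      if Odd i then gtMove n m (A (i / 2)) (i - 1) α.1
      else gtMove n m (B (i / 2 - 1)) (i - 1) α.1 +
        (Complex.I * gtDiag h (i / 2 - 1) α.1) • ket n m α.1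

/-- `A^j_{2p}(α)` as the principal square root of the whole expression. -/
def gtCoeffA (h : ℂ) (p j : ℕ) (α : ℕ → ℕ → ℚ) : ℂ :=
  gtA (qNum h) (qHalf h) p j α ^ (1 / 2 : ℂ)

/-- `B^j_{2p}(α)` as the principal square root of the whole expression. -/
def gtCoeffB (h : ℂ) (p j : ℕ) (α : ℕ → ℕ → ℚ) : ℂ :=
  gtB (qNum h) p j α ^ (1 / 2 : ℂ)

/-- Replacing every factor by a square root of it gives a square root of the whole. -/
theorem gtA_sq {s t S T : ℚ → ℂ} (hs : ∀ b, s b ^ 2 = S b) (ht : ∀ b, t b ^ 2 = T b)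
    (p j : ℕ) (α : ℕ → ℕ → ℚ) : gtA s t p j α ^ 2 = gtA S T p j α := by
  simp only [gtA, mul_pow, div_pow, ← Finset.prod_pow, hs, ht]

theorem gtB_sq {s S : ℚ → ℂ} (hs : ∀ b, s b ^ 2 = S b)
    (p j : ℕ) (α : ℕ → ℕ → ℚ) : gtB s p j α ^ 2 = gtB S p j α := by
  simp only [gtB, mul_pow, div_pow, ← Finset.prod_pow, hs, one_pow]

end

/-! Each generator acts on a basis vector by moves that raise or lower one entry of one row; for the
generators with a diagonal term, that term counts as a trivial move. A relation can therefore be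
checked one matrix entry at a time, as an identity between sums over paths of moves. A move in one
row does not affect the coefficients of a generator that is not adjacent, which gives commutation
(`commute_of_moves`). The cubic relations are the real content.

In the coordinates `ell`, the reflection x ↦ -x of an even row and y ↦ 1 - y of an odd row turn
lowering into raising, so one formula in the reflected entries `evenBar` and `oddBar` serves every
move; the diagonal term behaves like a move with reflected entry 0. This requires the chosen square
roots s(b) to be even in b. On patterns the arguments outside absolute values are nonnegative, so
s(b) may be replaced by s(|b|) (`gtA_abs`, `gtB_abs`).

Consider UUV - [2]UVU + VUU = -V (`cubic_relation_of_moves`). Fix a move of V and two moves of U. If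
the U-moves are not inverse to each other, their two orders must cancel. Interchanging a U-move with
the V-move changes the weight in a ratio [θ - 1] : [θ] (`exists_exchange`), so the three positions
of V add up to a single q-number by `cubic_identity`. Interchanging the two U-moves gives a ratio [d
+ 1] : [d - 1] (`PartsExchange`), and the two contributions are opposite. If the same move is made
twice, the three-term recurrence of [b] gives zero.

If the U-moves are inverse to each other, the path ends where V alone ends. Moving back has the
negative coefficient of moving forth (`evenCoeff_back`, `oddCoeff_back`), so only squares of
coefficients of U remain, and one must show that a sum of rational functions over all U-moves is 1.
Write c for `qCosh`. In this variable it is Lagrange interpolation: the nodes are c(2x ± 1) for an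
even row x, or c(2y), c(2y - 2) and c(0) for an odd row y; the roots come from the two neighbouring
rows; and the sum is the leading coefficient of a monic polynomial of degree one less than the
number of nodes. The signs that appear on squaring are governed by interlacing and multiply to a
constant (`prod_sign_even`, `prod_sign_odd`). Nodes collide only when interlacing pinches an entry
of each neighbouring row, which makes the common node a double root; the corresponding terms are 0 /
0 = 0 and may be dropped (`sum_prod_sub_div`).

A move that leaves the set of patterns has a vanishing factor (`exists_phi_eq_zero`,
`exists_psi_eq_zero`), so paths through other arrays contribute nothing. For real h ≠ 0, every
expression under a root is positive on an admissible raising move, so the principal root of the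
whole is the product of positive roots of the factors and the relations follow from the factorwise
case. Skew-adjointness holds because the raising and lowering coefficients are real and opposite and
the diagonal term is imaginary. The homomorphisms then come from the universal property. -/

noncomputable section

/-! ### Divided differences with colliding nodes -/

/-- The divided difference of a monic polynomial of degree one less than the number of nodes. -/
theorem sum_prod_sub_div_of_injOn {ι κ : Type*} [DecidableEq ι] {F : Type*} [Field F]
    (S : Finset ι) (R : Finset κ) (ν : ι → F) (ρ : κ → F) (hcard : R.card + 1 = S.card)
    (hν : Set.InjOn ν S) :
    ∑ s ∈ S, (∏ k ∈ R, (ν s - ρ k)) / ∏ t ∈ S.erase s, (ν s - ν t) = 1 := by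
  have hd := Polynomial.natDegree_prod_of_monic R (fun k => Polynomial.X - Polynomial.C (ρ k))
    (fun k _ => Polynomial.monic_X_sub_C _)
  have hm := Polynomial.monic_prod_of_monic R (fun k => Polynomial.X - Polynomial.C (ρ k))
    (fun k _ => Polynomial.monic_X_sub_C _)
  simp only [Polynomial.natDegree_X_sub_C, Finset.sum_const, smul_eq_mul, mul_one] at hd
  have := Lagrange.leadingCoeff_eq_sum hν
    (P := ∏ k ∈ R, (Polynomial.X - Polynomial.C (ρ k)))
    (by rw [Polynomial.degree_eq_natDegree hm.ne_zero, hd, ← hcard]; rfl)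
  rw [hm.leadingCoeff] at this
  rw [this]
  refine Finset.sum_congr rfl fun s _ => ?_
  simp [Polynomial.eval_prod]

/-- The same with repeated nodes, provided that a repeated node is a root at least as often; the
corresponding terms are `0 / 0 = 0`. -/
theorem sum_prod_sub_div {ι κ : Type*} [DecidableEq ι] [DecidableEq κ] {F : Type*} [Field F]
    [DecidableEq F] (ν : ι → F) (ρ : κ → F) (n : ℕ) : ∀ (S : Finset ι) (R : Finset κ),
    S.card = n → R.card + 1 = S.card →
    (∀ v, 2 ≤ (S.filter (ν · = v)).card → (S.filter (ν · = v)).card ≤ (R.filter (ρ · = v)).card) →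
    ∑ s ∈ S, (∏ k ∈ R, (ν s - ρ k)) / ∏ t ∈ S.erase s, (ν s - ν t) = 1 := by
  induction n with
  | zero => intro S R h1 h2; omega
  | succ n ih =>
    intro S R h1 h2 hm
    by_cases hν : Set.InjOn ν S
    · exact sum_prod_sub_div_of_injOn S R ν ρ h2 hν
    obtain ⟨s, hs, t, ht, hst, hne⟩ : ∃ s ∈ S, ∃ t ∈ S, ν s = ν t ∧ s ≠ t := by
      simpa [Set.InjOn] using hν
    have h2s : 2 ≤ (S.filter (ν · = ν s)).card := by
      have : ({s, t} : Finset ι) ⊆ S.filter (ν · = ν s) := by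
        intro u hu
        simp only [Finset.mem_insert, Finset.mem_singleton] at hu
        rcases hu with rfl | rfl <;> simp [hs, ht, hst]
      simpa [Finset.card_pair hne] using Finset.card_le_card this
    have h2r := h2s.trans (hm _ h2s)
    obtain ⟨k, hk, l, hl, hkl⟩ := Finset.one_lt_card.1 h2r
    simp only [Finset.mem_filter] at hk hl
    -- Delete one copy of the repeated node and one of its roots: both multiplicities drop by one,
    -- so the hypothesis survives.
    have key := ih (S.erase s) (R.erase k) (by rw [Finset.card_erase_of_mem hs]; omega)
      (by rw [Finset.card_erase_of_mem hs, Finset.card_erase_of_mem hk.1]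
          have := Finset.card_pos.2 ⟨k, hk.1⟩; omega) (by
        intro v hv
        rw [Finset.filter_erase] at hv ⊢
        rw [Finset.filter_erase]
        by_cases hvs : ν s = v
        · subst hvs
          have := hm _ h2s
          rw [Finset.card_erase_of_mem (by simp [hs]), Finset.card_erase_of_mem (by simp [hk])]
          omega
        · rw [Finset.erase_eq_of_notMem (by simp [hvs])] at hv ⊢
          rw [Finset.erase_eq_of_notMem (by simp [hk.2, hvs])]
          exact hm v hv)
    -- The deleted term has denominator zero. At a further copy of the same node both numerators
    -- vanish, by the root `k` before and the root `l` after the deletion; at the other nodes the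
    -- factors of `s` and `k` cancel.
    rw [← key, ← Finset.add_sum_erase _ _ hs,
      Finset.prod_eq_zero (Finset.mem_erase.2 ⟨hne.symm, ht⟩) (sub_eq_zero.2 hst), div_zero,
      zero_add]
    refine Finset.sum_congr rfl fun u hu => ?_
    obtain ⟨hus, huS⟩ := Finset.mem_erase.1 hu
    by_cases huv : ν u = ν s
    · rw [Finset.prod_eq_zero hk.1 (by rw [huv, hk.2, sub_self]),
        Finset.prod_eq_zero (Finset.mem_erase.2 ⟨Ne.symm hkl, hl.1⟩)
          (by rw [huv, hl.2, sub_self]), zero_div, zero_div]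
    · rw [← Finset.mul_prod_erase R _ hk.1, hk.2,
        ← Finset.mul_prod_erase (S.erase u) _ (Finset.mem_erase.2 ⟨hus.symm, hs⟩),
        Finset.erase_right_comm, mul_div_mul_left _ _ (sub_ne_zero.2 huv)]

/-- Two families of nodes, each without repetition, such that every coincidence between the two
families is a double root. -/
theorem sum_prod_sub_div_two {ι ι' κ : Type*} [DecidableEq ι] [DecidableEq ι'] [DecidableEq κ]
    {F : Type*} [Field F] (A : Finset ι) (B : Finset ι') (R : Finset κ) (a : ι → F) (b : ι' → F)
    (ρ : κ → F)
    (hcard : R.card + 1 = A.card + B.card) (ha : Set.InjOn a A) (hb : Set.InjOn b B)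
    (hab : ∀ i ∈ A, ∀ j ∈ B, a i = b j → ∃ k ∈ R, ∃ l ∈ R, k ≠ l ∧ ρ k = a i ∧ ρ l = a i) :
    ∑ i ∈ A, (∏ k ∈ R, (a i - ρ k)) / ((∏ t ∈ A.erase i, (a i - a t)) * ∏ t ∈ B, (a i - b t)) +
    ∑ i ∈ B, (∏ k ∈ R, (b i - ρ k)) / ((∏ t ∈ A, (b i - a t)) * ∏ t ∈ B.erase i, (b i - b t))
      = 1 := by
  classical
  have hS := sum_prod_sub_div (Sum.elim a b) ρ _ (A.disjSum B) R rfl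
    (by rw [Finset.card_disjSum, hcard]) (by
      intro v hv
      -- Each family takes the value v at most once, so multiplicity at least two means exactly one
      -- node from each family, and two roots suffice.
      have hA : (A.filter (a · = v)).card ≤ 1 := Finset.card_le_one.2 fun i hi j hj => by
        simp only [Finset.mem_filter] at hi hj
        exact ha hi.1 hj.1 (hi.2.trans hj.2.symm)
      have hB : (B.filter (b · = v)).card ≤ 1 := Finset.card_le_one.2 fun i hi j hj => by
        simp only [Finset.mem_filter] at hi hj
        exact hb hi.1 hj.1 (hi.2.trans hj.2.symm)
      have hf : ((A.disjSum B).filter (Sum.elim a b · = v)) =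
          (A.filter (a · = v)).disjSum (B.filter (b · = v)) := by
        ext (i | i) <;> simp
      rw [hf, Finset.card_disjSum] at hv ⊢
      obtain ⟨i, hi⟩ := Finset.card_pos.1 (by omega : 0 < (A.filter (a · = v)).card)
      obtain ⟨j, hj⟩ := Finset.card_pos.1 (by omega : 0 < (B.filter (b · = v)).card)
      simp only [Finset.mem_filter] at hi hj
      obtain ⟨k, hk, l, hl, hkl, h1, h2⟩ := hab i hi.1 j hj.1 (hi.2.trans hj.2.symm)
      have : ({k, l} : Finset κ) ⊆ R.filter (ρ · = v) := by
        intro u hu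
        simp only [Finset.mem_insert, Finset.mem_singleton] at hu
        rcases hu with rfl | rfl <;> simp [*]
      have := Finset.card_le_card this
      rw [Finset.card_pair hkl] at this
      omega)
  rw [Finset.sum_disjSum] at hS
  rw [← hS]
  have e1 : ∀ i, (A.disjSum B).erase (Sum.inl i) = (A.erase i).disjSum B := fun i => by
    ext (j | j) <;> simp
  have e2 : ∀ i, (A.disjSum B).erase (Sum.inr i) = A.disjSum (B.erase i) := fun i => by
    ext (j | j) <;> simp
  simp [e1, e2, Finset.prod_disjSum]

/-! ### Identities and nonvanishing of q-numbers -/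

/-- `q^{b/2} + q^{-b/2}` for `q = e^h`. -/
def qCosh (h : ℂ) (b : ℚ) : ℂ := Complex.exp (h * b / 2) + Complex.exp (-(h * b / 2))

/-- The square of the denominator of the `q`-numbers. -/
def qDen (h : ℂ) : ℂ := (Complex.exp (h / 2) - Complex.exp (-(h / 2))) ^ 2

/-- `q = e^h` is not a root of unity. -/
def NotRootOfUnity (h : ℂ) : Prop := ∀ k : ℕ, 0 < k → Complex.exp h ^ k ≠ 1

theorem NotRootOfUnity.exp_int_ne {h : ℂ} (hh : NotRootOfUnity h) (z : ℤ) (hz : z ≠ 0) :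
    Complex.exp (h * z) ≠ 1 := by
  rw [mul_comm, Complex.exp_int_mul]
  rcases Int.natAbs_eq z with hk | hk <;> rw [hk]
  · rw [zpow_natCast]; exact hh _ (Int.natAbs_pos.2 hz)
  · rw [zpow_neg, zpow_natCast, Ne, inv_eq_one]; exact hh _ (Int.natAbs_pos.2 hz)

/-- A zero forces e^{hb} = 1, hence (e^h)^{2b} = 1. Squaring once more is what admits half-integral
b, which occur for half-integral patterns. -/
theorem NotRootOfUnity.exp_sub_ne {h : ℂ} (hh : NotRootOfUnity h) {b : ℚ}
    (hb : ∃ z : ℤ, 2 * b = z) (hb0 : b ≠ 0) :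
    Complex.exp (h * b / 2) - Complex.exp (-(h * b / 2)) ≠ 0 := by
  obtain ⟨z, hz⟩ := hb
  intro h0
  have hz0 : z ≠ 0 := by rintro rfl; apply hb0; simpa using hz
  apply hh.exp_int_ne z hz0
  have e : Complex.exp (h * b / 2) ^ 2 = 1 := by
    rw [pow_two]; nth_rw 2 [sub_eq_zero.1 h0]; rw [← Complex.exp_add]; simp
  have : h * (z : ℂ) = ((2 : ℕ) : ℂ) * (((2 : ℕ) : ℂ) * (h * b / 2)) := by
    have : (z : ℂ) = 2 * (b : ℂ) := by rw [← Rat.cast_intCast, ← hz]; push_cast; ring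
    rw [this]; push_cast; ring
  rw [this, Complex.exp_nat_mul, Complex.exp_nat_mul, e, one_pow]

theorem NotRootOfUnity.qDen_ne {h : ℂ} (hh : NotRootOfUnity h) : qDen h ≠ 0 := by
  have := hh.exp_sub_ne (b := 1) ⟨2, by norm_num⟩ one_ne_zero
  simp only [Rat.cast_one, mul_one] at this
  exact pow_ne_zero 2 this

theorem NotRootOfUnity.qNum_ne {h : ℂ} (hh : NotRootOfUnity h) {b : ℚ}
    (hb : ∃ z : ℤ, 2 * b = z) (hb0 : b ≠ 0) : qNum h b ≠ 0 := by
  have := hh.exp_sub_ne (b := 1) ⟨2, by norm_num⟩ one_ne_zero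
  simp only [Rat.cast_one, mul_one] at this
  exact div_ne_zero (hh.exp_sub_ne hb hb0) this

theorem qNum_zero (h : ℂ) : qNum h 0 = 0 := by simp [qNum]

theorem NotRootOfUnity.qNum_one {h : ℂ} (hh : NotRootOfUnity h) : qNum h 1 = 1 := by
  have := hh.exp_sub_ne (b := 1) ⟨2, by norm_num⟩ one_ne_zero
  simp only [Rat.cast_one, mul_one] at this
  simp [qNum, div_self this]

theorem qNum_neg (h : ℂ) (b : ℚ) : qNum h (-b) = -qNum h b := by
  simp only [qNum, Rat.cast_neg, mul_neg, neg_div, neg_neg]; ring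

theorem qCosh_neg (h : ℂ) (b : ℚ) : qCosh h (-b) = qCosh h b := by
  simp only [qCosh, Rat.cast_neg, mul_neg, neg_div, neg_neg]; ring

theorem qTwo_eq (h : ℂ) : qTwo h = qCosh h 1 := by simp [qTwo, qCosh]

theorem qHalf_def (h : ℂ) (b : ℚ) : qHalf h b = (qCosh h b)⁻¹ := by simp [qHalf, qCosh]

theorem qNum_two_mul (h : ℂ) (b : ℚ) : qNum h (2 * b) = qNum h b * qCosh h b := by
  have e1 : Complex.exp (h * ((2 * b : ℚ) : ℂ) / 2) = Complex.exp (h * b / 2) ^ 2 := by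
    rw [← Complex.exp_nat_mul]; congr 1; push_cast; ring
  have e2 : Complex.exp (-(h * ((2 * b : ℚ) : ℂ) / 2)) = Complex.exp (-(h * b / 2)) ^ 2 := by
    rw [← Complex.exp_nat_mul]; congr 1; push_cast; ring
  rw [qNum, qNum, e1, e2, qCosh]; ring

/-- For b ≠ 0 it is a factor of [2b], which is nonzero; at b = 0 the value is 2. -/
theorem NotRootOfUnity.qCosh_ne {h : ℂ} (hh : NotRootOfUnity h) {b : ℚ}
    (hb : ∃ z : ℤ, 2 * b = z) : qCosh h b ≠ 0 := by
  by_cases hb0 : b = 0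
  · simp [qCosh, hb0]
  · have := hh.qNum_ne (b := 2 * b) (by obtain ⟨z, hz⟩ := hb; exact ⟨2 * z, by push_cast; rw [hz]⟩)
      (by simpa using hb0)
    rw [qNum_two_mul] at this
    exact right_ne_zero_of_mul this

/-- The product formula for the hyperbolic sine. -/
theorem qNum_mul_qNum (h : ℂ) (a b : ℚ) :
    qNum h a * qNum h b = (qCosh h (a + b) - qCosh h (a - b)) / qDen h := by
  have e1 : Complex.exp (h * ((a + b : ℚ) : ℂ) / 2) =
      Complex.exp (h * a / 2) * Complex.exp (h * b / 2) := by
    rw [← Complex.exp_add]; congr 1; push_cast; ring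
  have e2 : Complex.exp (-(h * ((a + b : ℚ) : ℂ) / 2)) =
      Complex.exp (-(h * a / 2)) * Complex.exp (-(h * b / 2)) := by
    rw [← Complex.exp_add]; congr 1; push_cast; ring
  have e3 : Complex.exp (h * ((a - b : ℚ) : ℂ) / 2) =
      Complex.exp (h * a / 2) * Complex.exp (-(h * b / 2)) := by
    rw [← Complex.exp_add]; congr 1; push_cast; ring
  have e4 : Complex.exp (-(h * ((a - b : ℚ) : ℂ) / 2)) =
      Complex.exp (-(h * a / 2)) * Complex.exp (h * b / 2) := by
    rw [← Complex.exp_add]; congr 1; push_cast; ring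
  rw [qNum, qNum, qCosh, qCosh, e1, e2, e3, e4, qDen, div_mul_div_comm]
  congr 1 <;> ring

theorem qNum_mul_eq {h : ℂ} {a b u v : ℚ} (hu : a + b = u) (hv : a - b = v) :
    qNum h a * qNum h b = (qCosh h u - qCosh h v) / qDen h := by
  rw [qNum_mul_qNum, hu, hv]

theorem NotRootOfUnity.qCosh_sub {h : ℂ} (hh : NotRootOfUnity h) (u v : ℚ) :
    qCosh h u - qCosh h v = qDen h * (qNum h ((u + v) / 2) * qNum h ((u - v) / 2)) := by
  rw [qNum_mul_eq (u := u) (v := v) (by ring) (by ring), mul_div_cancel₀ _ hh.qDen_ne]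

/-- The difference of the two values factors as a multiple of [(u + v)/2][(u - v)/2]. This decides
which interpolation nodes can collide. -/
theorem NotRootOfUnity.qCosh_inj {h : ℂ} (hh : NotRootOfUnity h) {u v : ℚ}
    (hu : ∃ z : ℤ, u = z) (hv : ∃ z : ℤ, v = z) (huv : qCosh h u = qCosh h v) :
    u = v ∨ u = -v := by
  have := hh.qCosh_sub u v
  rw [huv, sub_self, eq_comm, mul_eq_zero, or_iff_right hh.qDen_ne, mul_eq_zero] at this
  obtain ⟨a, rfl⟩ := hu
  obtain ⟨b, rfl⟩ := hv
  by_contra hc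
  push Not at hc
  rcases this with h1 | h1
  · exact hh.qNum_ne ⟨a + b, by push_cast; ring⟩ (fun h0 => hc.2 (by linarith)) h1
  · exact hh.qNum_ne ⟨a - b, by push_cast; ring⟩ (fun h0 => hc.1 (by linarith)) h1

/-- In the product formula both products on the left have the same argument sum a + b, so only the
difference terms survive. -/
theorem NotRootOfUnity.qNum_exchange {h : ℂ} (hh : NotRootOfUnity h) (a b : ℚ) :
    qNum h a * qNum h b - qNum h (a + 1) * qNum h (b - 1) = qNum h (a - b + 1) := by
  rw [← mul_one (qNum h (a - b + 1)), ← hh.qNum_one, qNum_mul_qNum, qNum_mul_qNum, qNum_mul_qNum,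
    show a + 1 + (b - 1) = a + b by ring, show a + 1 - (b - 1) = a - b + 1 + 1 by ring,
    show a - b + 1 - 1 = a - b by ring]
  ring

theorem NotRootOfUnity.qTwo_mul {h : ℂ} (hh : NotRootOfUnity h) (b : ℚ) :
    qTwo h * qNum h b = qNum h (b + 1) + qNum h (b - 1) := by
  have h2 : qTwo h = qNum h 2 := by
    rw [qTwo_eq, show (2 : ℚ) = 2 * 1 by norm_num, qNum_two_mul, hh.qNum_one, one_mul]
  rw [h2, ← mul_one (qNum h (b + 1)), ← mul_one (qNum h (b - 1)), ← hh.qNum_one, qNum_mul_qNum,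
    qNum_mul_qNum, qNum_mul_qNum, show (2 : ℚ) - b = -(b - 2) by ring, qCosh_neg,
    show b + 1 + 1 = 2 + b by ring, show b + 1 - 1 = b by ring, show b - 1 + 1 = b by ring,
    show b - 1 - 1 = b - 2 by ring]
  ring

theorem NotRootOfUnity.qNum_add_sub {h : ℂ} (hh : NotRootOfUnity h) (b : ℚ) :
    qNum h (b + 1) - qNum h (b - 1) = qCosh h b := by
  have h0 := hh.exp_sub_ne (b := 1) ⟨2, by norm_num⟩ one_ne_zero
  simp only [Rat.cast_one, mul_one] at h0
  have e1 : Complex.exp (h * ((b + 1 : ℚ) : ℂ) / 2) =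
      Complex.exp (h * b / 2) * Complex.exp (h / 2) := by
    rw [← Complex.exp_add]; congr 1; push_cast; ring
  have e2 : Complex.exp (-(h * ((b + 1 : ℚ) : ℂ) / 2)) =
      Complex.exp (-(h * b / 2)) * Complex.exp (-(h / 2)) := by
    rw [← Complex.exp_add]; congr 1; push_cast; ring
  have e3 : Complex.exp (h * ((b - 1 : ℚ) : ℂ) / 2) =
      Complex.exp (h * b / 2) * Complex.exp (-(h / 2)) := by
    rw [← Complex.exp_add]; congr 1; push_cast; ring
  have e4 : Complex.exp (-(h * ((b - 1 : ℚ) : ℂ) / 2)) =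
      Complex.exp (-(h * b / 2)) * Complex.exp (h / 2) := by
    rw [← Complex.exp_add]; congr 1; push_cast; ring
  rw [qNum, qNum, qCosh, e1, e2, e3, e4, ← sub_div, div_eq_iff h0]
  ring

theorem NotRootOfUnity.qNum_mul_qNum_sub {h : ℂ} (hh : NotRootOfUnity h) (a b : ℚ) :
    qNum h a * qNum h b - qNum h (a + 1) * qNum h (b + 1) = -qNum h (a + b + 1) := by
  have := hh.qNum_exchange a (-b)
  rw [show -b - 1 = -(b + 1) by ring, qNum_neg, qNum_neg, sub_neg_eq_add] at this
  linear_combination -this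

/-! ### Reduction of operator relations to sums over paths -/

/-- Operators `U`, `V` given by moves on a set of states: if the coefficient sums over paths with
the same end points cancel, then `U` and `V` satisfy a cubic relation. -/
theorem cubic_relation_of_moves {Γ E ι : Type*} [AddCommGroup E] [Module ℂ E]
    [DecidableEq ι] (P : Γ → Prop) (e : Γ → E) (he : ∀ γ, ¬P γ → e γ = 0)
    (q : ℂ) (U V : E →ₗ[ℂ] E) (MU MV : Finset ι) (aU aV : ι → Γ → Γ) (CU CV : ι → Γ → ℂ)
    (inv : ι → ι) (hinvM : ∀ u ∈ MU, inv u ∈ MU) (hinv : ∀ u, inv (inv u) = u)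
    (hU : ∀ γ, P γ → U (e γ) = ∑ u ∈ MU, CU u γ • e (aU u γ))
    (hV : ∀ γ, P γ → V (e γ) = ∑ v ∈ MV, CV v γ • e (aV v γ))
    (hU0 : ∀ γ, P γ → ∀ u ∈ MU, ¬P (aU u γ) → CU u γ = 0)
    (hV0 : ∀ γ, P γ → ∀ v ∈ MV, ¬P (aV v γ) → CV v γ = 0)
    (hUV : ∀ u v γ, aU u (aV v γ) = aV v (aU u γ))
    (hUU : ∀ u u' γ, aU u (aU u' γ) = aU u' (aU u γ))
    (hback : ∀ u γ, aU (inv u) (aU u γ) = γ)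
    (hanti : ∀ γ, P γ → ∀ v ∈ MV, ∀ u ∈ MU, ∀ u' ∈ MU, u' ≠ inv u →
      P (aU u' (aU u (aV v γ))) →
      (CV v γ * CU u (aV v γ) * CU u' (aU u (aV v γ))
        - q * (CU u γ * CV v (aU u γ) * CU u' (aU u (aV v γ)))
        + CU u γ * CU u' (aU u γ) * CV v (aU u' (aU u γ))) +
      (CV v γ * CU u' (aV v γ) * CU u (aU u' (aV v γ))
        - q * (CU u' γ * CV v (aU u' γ) * CU u (aU u' (aV v γ)))
        + CU u' γ * CU u (aU u' γ) * CV v (aU u (aU u' γ))) = 0)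
    (hsum : ∀ γ, P γ → ∀ v ∈ MV, P (aV v γ) →
      ∑ u ∈ MU, (CV v γ * CU u (aV v γ) * CU (inv u) (aU u (aV v γ))
        - q * (CU u γ * CV v (aU u γ) * CU (inv u) (aU u (aV v γ)))
        + CU u γ * CU (inv u) (aU u γ) * CV v γ) = -CV v γ)
    (γ : Γ) (hγ : P γ) :
    U (U (V (e γ))) - q • U (V (U (e γ))) + V (U (U (e γ))) = -V (e γ) := by
  have hU' : ∀ c γ, (¬P γ → c = 0) → c • U (e γ) = ∑ u ∈ MU, (c * CU u γ) • e (aU u γ) := by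
    intro c γ hc
    by_cases hp : P γ
    · rw [hU γ hp, Finset.smul_sum]; simp only [smul_smul]
    · simp [hc hp]
  have hV' : ∀ c γ, (¬P γ → c = 0) → c • V (e γ) = ∑ u ∈ MV, (c * CV u γ) • e (aV u γ) := by
    intro c γ hc
    by_cases hp : P γ
    · rw [hV γ hp, Finset.smul_sum]; simp only [smul_smul]
    · simp [hc hp]
  -- A path through a state outside `P` has a zero coefficient at the step where it leaves, so the
  -- path expansions below may ignore membership of the intermediate states.
  have z2 : ∀ (c d : ℂ) (δ γ' : Γ), (¬P δ → c = 0) → (P δ → ¬P γ' → d = 0) →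
      ¬P γ' → c * d = 0 := by
    intro c d δ γ' h1 h2 h3
    by_cases hp : P δ
    · rw [h2 hp h3, mul_zero]
    · rw [h1 hp, zero_mul]
  have t1 : U (U (V (e γ))) = ∑ v ∈ MV, ∑ u ∈ MU, ∑ u' ∈ MU,
      (CV v γ * CU u (aV v γ) * CU u' (aU u (aV v γ))) • e (aU u' (aU u (aV v γ))) := by
    rw [hV γ hγ, map_sum, map_sum]
    refine Finset.sum_congr rfl fun v hv => ?_
    rw [map_smul, hU' _ _ (hV0 γ hγ v hv), map_sum]
    refine Finset.sum_congr rfl fun u hu => ?_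
    rw [map_smul, hU' _ _ (z2 _ _ _ _ (hV0 γ hγ v hv) (fun hp => hU0 _ hp u hu))]
  have t2 : U (V (U (e γ))) = ∑ v ∈ MV, ∑ u ∈ MU, ∑ u' ∈ MU,
      (CU u γ * CV v (aU u γ) * CU u' (aU u (aV v γ))) • e (aU u' (aU u (aV v γ))) := by
    rw [hU γ hγ, map_sum, map_sum, Finset.sum_comm]
    refine Finset.sum_congr rfl fun u hu => ?_
    rw [map_smul, hV' _ _ (hU0 γ hγ u hu), map_sum]
    refine Finset.sum_congr rfl fun v hv => ?_
    rw [map_smul, hU' _ _ (z2 _ _ _ _ (hU0 γ hγ u hu) (fun hp => hV0 _ hp v hv))]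
    simp only [hUV]
  have t3 : V (U (U (e γ))) = ∑ v ∈ MV, ∑ u ∈ MU, ∑ u' ∈ MU,
      (CU u γ * CU u' (aU u γ) * CV v (aU u' (aU u γ))) • e (aU u' (aU u (aV v γ))) := by
    rw [hU γ hγ, map_sum, map_sum, Finset.sum_comm]
    refine Finset.sum_congr rfl fun u hu => ?_
    rw [map_smul, hU' _ _ (hU0 γ hγ u hu), map_sum, Finset.sum_comm]
    refine Finset.sum_congr rfl fun u' hu' => ?_
    rw [map_smul, hV' _ _ (z2 _ _ _ _ (hU0 γ hγ u hu) (fun hp => hU0 _ hp u' hu'))]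
    simp only [hUV]
  rw [t1, t2, t3, hV γ hγ, Finset.smul_sum, ← Finset.sum_sub_distrib, ← Finset.sum_add_distrib,
    ← Finset.sum_neg_distrib]
  refine Finset.sum_congr rfl fun v hv => ?_
  set W : ι → ι → ℂ := fun u u' => CV v γ * CU u (aV v γ) * CU u' (aU u (aV v γ))
        - q * (CU u γ * CV v (aU u γ) * CU u' (aU u (aV v γ)))
        + CU u γ * CU u' (aU u γ) * CV v (aU u' (aU u γ)) with hW
  have c1 : (∑ u ∈ MU, ∑ u' ∈ MU,
      (CV v γ * CU u (aV v γ) * CU u' (aU u (aV v γ))) • e (aU u' (aU u (aV v γ)))) -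
      q • (∑ u ∈ MU, ∑ u' ∈ MU,
      (CU u γ * CV v (aU u γ) * CU u' (aU u (aV v γ))) • e (aU u' (aU u (aV v γ)))) +
      (∑ u ∈ MU, ∑ u' ∈ MU,
      (CU u γ * CU u' (aU u γ) * CV v (aU u' (aU u γ))) • e (aU u' (aU u (aV v γ)))) =
      ∑ u ∈ MU, ∑ u' ∈ MU, W u u' • e (aU u' (aU u (aV v γ))) := by
    rw [Finset.smul_sum, ← Finset.sum_sub_distrib, ← Finset.sum_add_distrib]
    refine Finset.sum_congr rfl fun u _ => ?_
    rw [Finset.smul_sum, ← Finset.sum_sub_distrib, ← Finset.sum_add_distrib]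
    refine Finset.sum_congr rfl fun u' _ => ?_
    rw [hW]; module
  rw [c1]
  -- Separate the paths that undo their own U-move from all the others.
  have c2 : ∀ u u', W u u' • e (aU u' (aU u (aV v γ))) =
      (if u' = inv u then W u u' • e (aU u' (aU u (aV v γ))) else 0) +
      (if u' = inv u then 0 else W u u' • e (aU u' (aU u (aV v γ)))) := by
    intro u u'; split_ifs <;> simp
  have c3 : ∑ u ∈ MU, ∑ u' ∈ MU,
      (if u' = inv u then (0 : E) else W u u' • e (aU u' (aU u (aV v γ)))) = 0 := by
    set G : ι → ι → E := fun u u' =>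
      if u' = inv u then (0 : E) else W u u' • e (aU u' (aU u (aV v γ))) with hG
    have hg : ∀ u ∈ MU, ∀ u' ∈ MU, G u u' + G u' u = 0 := by
      intro u hu u' hu'
      simp only [hG]
      by_cases h1 : u' = inv u
      · rw [if_pos h1, if_pos (by rw [h1, hinv]), add_zero]
      · rw [if_neg h1, if_neg (fun h2 => h1 (by rw [h2, hinv])), hUU u u', ← add_smul]
        by_cases hp : P (aU u' (aU u (aV v γ)))
        · rw [hanti γ hγ v hv u hu u' hu' h1 hp, zero_smul]
        · rw [he _ hp, smul_zero]
    -- The double sum is added to its transpose; `G` is antisymmetric, so twice the sum is zero.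
    -- This also covers a move made twice, u = u'.
    have h2 : (∑ u ∈ MU, ∑ u' ∈ MU, G u u') + (∑ u ∈ MU, ∑ u' ∈ MU, G u u') = 0 := by
      nth_rw 2 [Finset.sum_comm]
      rw [← Finset.sum_add_distrib]
      refine Finset.sum_eq_zero fun u hu => ?_
      rw [← Finset.sum_add_distrib]
      exact Finset.sum_eq_zero fun u' hu' => hg u hu u' hu'
    have h3 : (2 : ℂ) • (∑ u ∈ MU, ∑ u' ∈ MU, G u u') = 0 := by rw [two_smul, h2]
    exact (smul_eq_zero.1 h3).resolve_left two_ne_zero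
  rw [Finset.sum_congr rfl fun u _ => Finset.sum_congr rfl fun u' _ => c2 u u']
  simp only [Finset.sum_add_distrib]
  rw [c3, add_zero]
  have c4 : ∀ u ∈ MU, ∑ u' ∈ MU,
      (if u' = inv u then W u u' • e (aU u' (aU u (aV v γ))) else 0) =
      W u (inv u) • e (aV v γ) := by
    intro u hu
    rw [Finset.sum_ite_eq' MU, if_pos (hinvM u hu), hback]
  rw [Finset.sum_congr rfl c4, ← Finset.sum_smul, ← neg_smul]
  by_cases hp : P (aV v γ)
  · congr 1
    rw [← hsum γ hγ v hv hp]
    simp only [hW, hback]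
  · rw [he _ hp, smul_zero, smul_zero]

/-- Operators given by moves that do not interact commute. -/
theorem commute_of_moves {Γ E ι : Type*} [AddCommGroup E] [Module ℂ E]
    (P : Γ → Prop) (e : Γ → E)
    (U V : E →ₗ[ℂ] E) (MU MV : Finset ι) (aU aV : ι → Γ → Γ) (CU CV : ι → Γ → ℂ)
    (hU : ∀ γ, P γ → U (e γ) = ∑ u ∈ MU, CU u γ • e (aU u γ))
    (hV : ∀ γ, P γ → V (e γ) = ∑ v ∈ MV, CV v γ • e (aV v γ))
    (hU0 : ∀ γ, P γ → ∀ u ∈ MU, ¬P (aU u γ) → CU u γ = 0)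
    (hV0 : ∀ γ, P γ → ∀ v ∈ MV, ¬P (aV v γ) → CV v γ = 0)
    (hUV : ∀ u v γ, aU u (aV v γ) = aV v (aU u γ))
    (hCU : ∀ u v γ, CU u (aV v γ) = CU u γ) (hCV : ∀ u v γ, CV v (aU u γ) = CV v γ)
    (γ : Γ) (hγ : P γ) : U (V (e γ)) = V (U (e γ)) := by
  rw [hU γ hγ, hV γ hγ, map_sum, map_sum]
  have t1 : ∀ v ∈ MV, U (CV v γ • e (aV v γ)) =
      ∑ u ∈ MU, (CV v γ * CU u γ) • e (aU u (aV v γ)) := by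
    intro v hv
    rw [map_smul]
    by_cases hp : P (aV v γ)
    · rw [hU _ hp, Finset.smul_sum]; simp only [smul_smul, hCU]
    · simp [hV0 γ hγ v hv hp]
  have t2 : ∀ u ∈ MU, V (CU u γ • e (aU u γ)) =
      ∑ v ∈ MV, (CV v γ * CU u γ) • e (aU u (aV v γ)) := by
    intro u hu
    rw [map_smul]
    by_cases hp : P (aU u γ)
    · rw [hV _ hp, Finset.smul_sum]; simp only [smul_smul, hCV, hUV, mul_comm]
    · simp [hU0 γ hγ u hu hp]
  rw [Finset.sum_congr rfl t1, Finset.sum_congr rfl t2, Finset.sum_comm]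

/-! ## Coefficients of moves in terms of three neighbouring rows -/

/-- `s` is an even function with `s b ^ 2 = [b]` for `b ≥ 0`. -/
structure IsEvenRoot (h : ℂ) (s : ℚ → ℂ) : Prop where
  neg : ∀ b, s (-b) = s b
  sq : ∀ b, 0 ≤ b → s b ^ 2 = qNum h b

theorem IsEvenRoot.eq {h : ℂ} {s : ℚ → ℂ} (hs : IsEvenRoot h s) {a b : ℚ} (hab : a = -b) :
    s a = s b := by rw [hab, hs.neg]

theorem IsEvenRoot.sq_nonpos {h : ℂ} {s : ℚ → ℂ} (hs : IsEvenRoot h s) {b : ℚ} (hb : b ≤ 0) :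
    s b ^ 2 = -qNum h b := by
  rw [← hs.neg, hs.sq _ (by linarith), qNum_neg]

theorem IsEvenRoot.zero {h : ℂ} {s : ℚ → ℂ} (hs : IsEvenRoot h s) : s 0 = 0 := by
  have := hs.sq 0 le_rfl
  rw [qNum_zero] at this
  exact pow_eq_zero_iff two_ne_zero |>.1 this

/-- Consecutive integers have a common sign. -/
theorem IsEvenRoot.exists_sign {h : ℂ} {s : ℚ → ℂ} (hs : IsEvenRoot h s) {d : ℚ}
    (hd : ∃ z : ℤ, d = z) :
    ∃ σ : ℂ, σ ^ 2 = 1 ∧ s d ^ 2 = σ * qNum h d ∧ s (d - 1) ^ 2 = σ * qNum h (d - 1) := by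
  obtain ⟨z, rfl⟩ := hd
  rcases le_or_gt 1 z with hz | hz
  · have : (1 : ℚ) ≤ z := by exact_mod_cast hz
    exact ⟨1, by norm_num, by rw [hs.sq _ (by linarith), one_mul],
      by rw [hs.sq _ (by linarith), one_mul]⟩
  · have : (z : ℚ) ≤ 0 := by exact_mod_cast Int.le_of_lt_add_one hz
    exact ⟨-1, by norm_num, by rw [hs.sq_nonpos (by linarith), neg_one_mul],
      by rw [hs.sq_nonpos (by linarith), neg_one_mul]⟩

/-- Substituting [2][b - 1] = [b] + [b - 2] leaves one instance of the exchange identity. The three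
products are the relative weights of a path with the middle move placed before, between and after
two other moves. -/
theorem NotRootOfUnity.cubic_identity {h : ℂ} (hh : NotRootOfUnity h) (a b : ℚ) :
    qNum h (a - 1) * qNum h (b - 1) - qTwo h * (qNum h a * qNum h (b - 1)) +
      qNum h a * qNum h b = qNum h (a - b + 1) := by
  have h1 := hh.qTwo_mul (b - 1)
  have h2 := hh.qNum_exchange (a - 1) (b - 1)
  rw [sub_add_cancel] at h1 h2
  rw [show a - 1 - (b - 1) + 1 = a - b + 1 by ring] at h2
  linear_combination h2 - qNum h a * h1

/-- Replace the entry `x j` by `x j + ε`, where `a = (j, ε)`. -/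
def rowShift (x : ℕ → ℚ) (a : ℕ × ℚ) : ℕ → ℚ := Function.update x a.1 (x a.1 + a.2)

theorem rowShift_self (x : ℕ → ℚ) (a : ℕ × ℚ) : rowShift x a a.1 = x a.1 + a.2 := by
  simp [rowShift]

theorem rowShift_ne (x : ℕ → ℚ) {a : ℕ × ℚ} {k : ℕ} (hk : k ≠ a.1) : rowShift x a k = x k := by
  simp [rowShift, hk]

theorem rowShift_zero (x : ℕ → ℚ) (k : ℕ) : rowShift x (k, 0) = x := by
  simp [rowShift]

theorem rowShift_back (x : ℕ → ℚ) (a : ℕ × ℚ) : rowShift (rowShift x a) (a.1, -a.2) = x := by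
  simp [rowShift]

theorem rowShift_comm (x : ℕ → ℚ) (a b : ℕ × ℚ) :
    rowShift (rowShift x a) b = rowShift (rowShift x b) a := by
  funext k
  rcases eq_or_ne a.1 b.1 with hab | hab
  · by_cases hk : k = a.1
    · subst hk; simp only [rowShift, hab, Function.update_self]; ring
    · have hk' : k ≠ b.1 := hab ▸ hk
      simp [rowShift, hk, hk']
  · by_cases hk : k = a.1
    · subst hk; simp [rowShift, hab]
    · by_cases hk' : k = b.1
      · subst hk'; simp [rowShift, hk]
      · simp [rowShift, hk, hk']

/-- The reflected entry of an even row: `x` for raising and `-x` for lowering. -/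
def evenBar (x : ℕ → ℚ) (a : ℕ × ℚ) : ℚ := a.2 * x a.1

/-- The reflected entry of an odd row: `y` for raising, `1 - y` for lowering, `0` for the
diagonal term. -/
def oddBar (y : ℕ → ℚ) (b : ℕ × ℚ) : ℚ := b.2 * y b.1 + (b.2 ^ 2 - b.2) / 2

/-- The factor that an entry y of a neighbouring odd row contributes to an even-row move with
reflected entry v. `psi` has the same role for a neighbouring even row, while `chiEven` and `chiOdd`
are the interactions within one row. -/
def phi (s : ℚ → ℂ) (y v : ℚ) : ℂ := s (y + v) * s (y - v - 1)

def psi (s : ℚ → ℂ) (x v : ℚ) : ℂ := s (x + v) * s (x - v)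

def chiEven (s : ℚ → ℂ) (u v : ℚ) : ℂ := s (u + v) * s (u - v) * s (u + v + 1) * s (u - v - 1)

def chiOdd (s : ℚ → ℂ) (u v : ℚ) : ℂ := s (u + v) * s (u - v) * s (u + v - 1) * s (u - v - 1)

/-- The dependence of the coefficient of the move `b` in an odd row on an entry of a neighbour. -/
def psiM (h : ℂ) (s : ℚ → ℂ) (δ x v : ℚ) : ℂ := if δ = 0 then qNum h x else psi s x v

/-- The part of the coefficient of a move in the even row `x` that does not depend on the
neighbour `y`. -/
def evenCoeffPart (s t : ℚ → ℂ) (J W : Finset ℕ) (w x : ℕ → ℚ) (a : ℕ × ℚ) : ℂ :=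
  a.2 * (t (x a.1) * t (x a.1 + a.2)) *
    ((∏ k ∈ W, phi s (w k) (evenBar x a)) / ∏ r ∈ J.erase a.1, chiEven s (x r) (evenBar x a))

/-- The coefficient of the move `a` in the even row `x`. -/
def evenCoeff (s t : ℚ → ℂ) (J W K : Finset ℕ) (w x y : ℕ → ℚ) (a : ℕ × ℚ) : ℂ :=
  evenCoeffPart s t J W w x a * ∏ k ∈ K, phi s (y k) (evenBar x a)

/-- The part of the coefficient of a move in the odd row `y` that does not depend on the
neighbour `x`. -/
def oddCoeffPart (h : ℂ) (s : ℚ → ℂ) (K Z : Finset ℕ) (z y : ℕ → ℚ) (b : ℕ × ℚ) : ℂ :=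
  if b.2 = 0 then
    Complex.I * (∏ r ∈ Z, qNum h (z r)) * (∏ k ∈ K, qNum h (y k) * qNum h (y k - 1))⁻¹
  else
    b.2 * (∏ r ∈ Z, psi s (z r) (oddBar y b)) / (∏ k ∈ K.erase b.1, chiOdd s (y k) (oddBar y b)) *
      (1 / (s (oddBar y b) ^ 2 * s (2 * oddBar y b + 1) * s (2 * oddBar y b - 1)))

/-- The coefficient of the move `b` in the odd row `y`. -/
def oddCoeff (h : ℂ) (s : ℚ → ℂ) (K Z J : Finset ℕ) (z x y : ℕ → ℚ) (b : ℕ × ℚ) : ℂ :=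
  oddCoeffPart h s K Z z y b * ∏ r ∈ J, psiM h s b.2 (x r) (oddBar y b)

def IsEvenMove (J : Finset ℕ) (a : ℕ × ℚ) : Prop := a.1 ∈ J ∧ (a.2 = 1 ∨ a.2 = -1)

/-- The pair (0, 0) encodes the diagonal term: entries are labelled from 1, so position 0 is free,
and a shift by 0 changes nothing. -/
def IsOddMove (K : Finset ℕ) (b : ℕ × ℚ) : Prop := IsEvenMove K b ∨ b = (0, 0)

theorem evenBar_shift_ne (x : ℕ → ℚ) {a b : ℕ × ℚ} (hab : a.1 ≠ b.1) :
    evenBar (rowShift x b) a = evenBar x a := by rw [evenBar, rowShift_ne _ hab, evenBar]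

theorem oddBar_shift_ne (y : ℕ → ℚ) {a b : ℕ × ℚ} (hab : a.1 ≠ b.1) :
    oddBar (rowShift y b) a = oddBar y a := by rw [oddBar, rowShift_ne _ hab, oddBar]

theorem oddBar_zero (y : ℕ → ℚ) (k : ℕ) : oddBar y (k, 0) = 0 := by simp [oddBar]

theorem evenBar_shift_self (x : ℕ → ℚ) {J : Finset ℕ} {a : ℕ × ℚ} (ha : IsEvenMove J a) :
    evenBar (rowShift x a) a = evenBar x a + 1 := by
  rw [evenBar, rowShift_self, evenBar]
  rcases ha.2 with h | h <;> rw [h] <;> ring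

theorem oddBar_shift_self (y : ℕ → ℚ) {K : Finset ℕ} {b : ℕ × ℚ} (hb : IsEvenMove K b) :
    oddBar (rowShift y b) b = oddBar y b + 1 := by
  rw [oddBar, rowShift_self, oddBar]
  rcases hb.2 with h | h <;> rw [h] <;> ring

section even
variable {h : ℂ} {s : ℚ → ℂ} (hs : IsEvenRoot h s)
include hs

/-- Changing the sign of an even-row entry permutes the four factors, since s is even. This is why
raising and lowering can be handled together. -/
theorem chiEven_bar (u v ε : ℚ) (hε : ε = 1 ∨ ε = -1) :
    chiEven s u v = chiEven s (ε * u) v := by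
  rcases hε with rfl | rfl
  · rw [one_mul]
  · simp only [chiEven]
    rw [hs.eq (show u + v = -(-1 * u - v) by ring), hs.eq (show u - v = -(-1 * u + v) by ring),
      hs.eq (show u + v + 1 = -(-1 * u - v - 1) by ring),
      hs.eq (show u - v - 1 = -(-1 * u + v + 1) by ring)]
    ring

theorem psi_bar (u v ε : ℚ) (hε : ε = 1 ∨ ε = -1) : psi s u v = psi s (ε * u) v := by
  rcases hε with rfl | rfl
  · rw [one_mul]
  · simp only [psi]
    rw [hs.eq (show u + v = -(-1 * u - v) by ring), hs.eq (show u - v = -(-1 * u + v) by ring)]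
    ring

/-- For odd rows the symmetry is y ↦ 1 - y, which swaps the two factors up to the sign of their
arguments. -/
theorem phi_bar (y v δ : ℚ) (hδ : δ = 1 ∨ δ = -1) :
    phi s y v = phi s (δ * y + (δ ^ 2 - δ) / 2) v := by
  rcases hδ with rfl | rfl
  · congr 1; ring
  · simp only [phi]
    rw [hs.eq (show y + v = -(-1 * y + ((-1) ^ 2 - (-1)) / 2 - v - 1) by ring),
      hs.eq (show y - v - 1 = -(-1 * y + ((-1) ^ 2 - (-1)) / 2 + v) by ring)]
    ring

theorem chiOdd_bar (u v δ : ℚ) (hδ : δ = 1 ∨ δ = -1) :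
    chiOdd s u v = chiOdd s (δ * u + (δ ^ 2 - δ) / 2) v := by
  rcases hδ with rfl | rfl
  · congr 1; ring
  · simp only [chiOdd]
    rw [hs.eq (show u + v = -(-1 * u + ((-1) ^ 2 - (-1)) / 2 - v - 1) by ring),
      hs.eq (show u - v - 1 = -(-1 * u + ((-1) ^ 2 - (-1)) / 2 + v) by ring),
      hs.eq (show u - v = -(-1 * u + ((-1) ^ 2 - (-1)) / 2 + v - 1) by ring),
      hs.eq (show u + v - 1 = -(-1 * u + ((-1) ^ 2 - (-1)) / 2 - v) by ring)]
    ring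

/-- The effect of exchanging the order of a move in an even row and a move in an adjacent odd
row. -/
theorem exists_exchange (x y ε δ : ℚ) (hε : ε = 1 ∨ ε = -1) (hδ : (δ = 1 ∨ δ = -1) ∨ δ = 0)
    (hθ : δ ≠ 0 → ∃ n : ℤ, δ * y + (δ ^ 2 - δ) / 2 - ε * x = n) :
    ∃ κ : ℂ,
      (if δ = 0 then 1 else phi s y (ε * x)) *
        psiM h s δ (x + ε) (δ * y + (δ ^ 2 - δ) / 2) =
          κ * qNum h (δ * y + (δ ^ 2 - δ) / 2 - ε * x - 1) ∧
      psiM h s δ x (δ * y + (δ ^ 2 - δ) / 2) *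
        (if δ = 0 then 1 else phi s (y + δ) (ε * x)) =
          κ * qNum h (δ * y + (δ ^ 2 - δ) / 2 - ε * x) := by
  rcases hδ with hδ | rfl
  · have hδ0 : δ ≠ 0 := by rcases hδ with rfl | rfl <;> norm_num
    obtain ⟨σ, -, h1, h2⟩ := hs.exists_sign (hθ hδ0)
    set v := δ * y + (δ ^ 2 - δ) / 2 with hv
    simp only [psiM, if_neg hδ0]
    rw [psi_bar hs x v ε hε, psi_bar hs (x + ε) v ε hε, phi_bar hs y _ δ hδ,
      phi_bar hs (y + δ) _ δ hδ, ← hv,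
      show ε * (x + ε) = ε * x + 1 by rcases hε with rfl | rfl <;> ring,
      show δ * (y + δ) + (δ ^ 2 - δ) / 2 = v + 1 by rcases hδ with rfl | rfl <;> rw [hv] <;> ring]
    -- The factors in v + εx occur in both orders. What differs is s(θ - 1)^2 against s(θ)^2 for the
    -- integer θ = v - εx, and two consecutive integers share the sign `σ`.
    refine ⟨s (v + ε * x) * s (v + ε * x + 1) * σ, ?_, ?_⟩
    · simp only [phi, psi]
      rw [hs.eq (show ε * x + 1 - v = -(v - ε * x - 1) by ring),
        show ε * x + 1 + v = v + ε * x + 1 by ring]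
      linear_combination s (v + ε * x) * s (v + ε * x + 1) * h2
    · simp only [phi, psi]
      rw [hs.eq (show ε * x - v = -(v - ε * x) by ring), show ε * x + v = v + ε * x by ring,
        show v + 1 + ε * x = v + ε * x + 1 by ring, show v + 1 - ε * x - 1 = v - ε * x by ring]
      linear_combination s (v + ε * x) * s (v + ε * x + 1) * h1
  -- For the diagonal term only [x + ε] against [x] matters; these are [θ - 1] and [θ] for θ = -εx,
  -- up to the factor -ε.
  · refine ⟨-ε, ?_, ?_⟩ <;> simp only [psiM, if_true, one_mul, mul_one] <;>
      rcases hε with rfl | rfl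
    · rw [show (0 : ℚ) * y + (0 ^ 2 - 0) / 2 - 1 * x - 1 = -(x + 1) by ring, qNum_neg]
      push_cast; ring
    · rw [show (0 : ℚ) * y + (0 ^ 2 - 0) / 2 - -1 * x - 1 = x + -1 by ring]
      push_cast; ring
    · rw [show (0 : ℚ) * y + (0 ^ 2 - 0) / 2 - 1 * x = -x by ring, qNum_neg]
      push_cast; ring
    · rw [show (0 : ℚ) * y + (0 ^ 2 - 0) / 2 - -1 * x = x by ring]
      push_cast; ring

end even

/-- A product over the entries of a row, before and after two moves at different places. -/
theorem exists_prod_rowShift (K : Finset ℕ) (f : ℚ → ℂ) (y : ℕ → ℚ) (b₁ b₂ : ℕ × ℚ)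
    (h₁ : IsEvenMove K b₁) (h₂ : IsOddMove K b₂) (hne : b₁.1 ≠ b₂.1) :
    ∃ c : ℂ, (∏ k ∈ K, f (y k) = c * f (y b₁.1) * (if b₂.2 = 0 then 1 else f (y b₂.1))) ∧
      (∏ k ∈ K, f (rowShift y b₁ k) =
        c * f (y b₁.1 + b₁.2) * (if b₂.2 = 0 then 1 else f (y b₂.1))) ∧
      (∏ k ∈ K, f (rowShift y b₂ k) =
        c * f (y b₁.1) * (if b₂.2 = 0 then 1 else f (y b₂.1 + b₂.2))) ∧
      (∏ k ∈ K, f (rowShift (rowShift y b₁) b₂ k) =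
        c * f (y b₁.1 + b₁.2) * (if b₂.2 = 0 then 1 else f (y b₂.1 + b₂.2))) := by
  rcases h₂ with h₂ | rfl
  · have hδ0 : b₂.2 ≠ 0 := by rcases h₂.2 with h | h <;> rw [h] <;> norm_num
    simp only [if_neg hδ0]
    have key : ∀ g : ℕ → ℚ, (∀ k, k ≠ b₁.1 → k ≠ b₂.1 → g k = y k) →
        ∏ k ∈ K, f (g k) =
          (∏ k ∈ (K.erase b₁.1).erase b₂.1, f (y k)) * f (g b₁.1) * f (g b₂.1) := by
      intro g hg
      rw [← Finset.mul_prod_erase K _ h₁.1,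
        ← Finset.mul_prod_erase _ _ (Finset.mem_erase.2 ⟨hne.symm, h₂.1⟩)]
      rw [Finset.prod_congr rfl fun k hk => by
        rw [hg k (Finset.mem_erase.1 (Finset.mem_erase.1 hk).2).1 (Finset.mem_erase.1 hk).1]]
      ring
    refine ⟨_, key _ fun _ _ _ => rfl, ?_, ?_, ?_⟩
    · rw [key _ fun k k1 k2 => rowShift_ne _ k1, rowShift_self, rowShift_ne _ hne.symm]
    · rw [key _ fun k k1 k2 => rowShift_ne _ k2, rowShift_self, rowShift_ne _ hne]
    · rw [key _ fun k k1 k2 => by rw [rowShift_ne _ k2, rowShift_ne _ k1], rowShift_self,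
        rowShift_ne _ hne, rowShift_self, rowShift_ne _ hne.symm]
  · have key : ∀ g : ℕ → ℚ, (∀ k, k ≠ b₁.1 → g k = y k) →
        ∏ k ∈ K, f (g k) = (∏ k ∈ K.erase b₁.1, f (y k)) * f (g b₁.1) := by
      intro g hg
      rw [← Finset.mul_prod_erase K _ h₁.1]
      rw [Finset.prod_congr rfl fun k hk => by rw [hg k (Finset.mem_erase.1 hk).1]]
      ring
    simp only [if_true, mul_one, rowShift_zero]
    refine ⟨_, key _ fun _ _ => rfl, ?_, key _ fun _ _ => rfl, ?_⟩ <;>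
    · rw [key _ fun k k1 => rowShift_ne _ k1, rowShift_self]

theorem prod_rowShift (K : Finset ℕ) (f : ℚ → ℂ) (y : ℕ → ℚ) (b : ℕ × ℚ) (hb : b.1 ∈ K) :
    (∏ k ∈ K, f (y k) = (∏ k ∈ K.erase b.1, f (y k)) * f (y b.1)) ∧
      (∏ k ∈ K, f (rowShift y b k) = (∏ k ∈ K.erase b.1, f (y k)) * f (y b.1 + b.2)) := by
  constructor
  · rw [← Finset.mul_prod_erase K _ hb, mul_comm]
  · rw [← Finset.mul_prod_erase K _ hb, mul_comm, rowShift_self,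
      Finset.prod_congr rfl fun k hk => by rw [rowShift_ne _ (Finset.mem_erase.1 hk).1]]

theorem prod_rowShift_twice (K : Finset ℕ) (f : ℚ → ℂ) (y : ℕ → ℚ) (b : ℕ × ℚ) (hb : b.1 ∈ K) :
    ∏ k ∈ K, f (rowShift (rowShift y b) b k) =
      (∏ k ∈ K.erase b.1, f (y k)) * f (y b.1 + b.2 + b.2) := by
  rw [← Finset.mul_prod_erase K _ hb, mul_comm, rowShift_self, rowShift_self]
  congr 1
  refine Finset.prod_congr rfl fun k hk => ?_
  rw [rowShift_ne _ (Finset.mem_erase.1 hk).1, rowShift_ne _ (Finset.mem_erase.1 hk).1]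

theorem IsEvenMove.ne_zero {J : Finset ℕ} {a : ℕ × ℚ} (ha : IsEvenMove J a) : a.2 ≠ 0 := by
  rcases ha.2 with h | h <;> rw [h] <;> norm_num

theorem IsEvenMove.isOddMove {J : Finset ℕ} {a : ℕ × ℚ} (ha : IsEvenMove J a) : IsOddMove J a :=
  Or.inl ha

theorem IsOddMove.cases {J : Finset ℕ} {a : ℕ × ℚ} (ha : IsOddMove J a) :
    (a.2 = 1 ∨ a.2 = -1) ∨ a.2 = 0 := by
  rcases ha with ha | rfl
  · exact Or.inl ha.2
  · exact Or.inr rfl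

/-! ### Exchanging two moves in the same row -/

/-- Coefficients of two successive moves in one row, in the two orders. -/
def PartsExchange (h : ℂ) (part : (ℕ → ℚ) → ℕ × ℚ → ℂ) (x : ℕ → ℚ) (a₁ a₂ : ℕ × ℚ) (d : ℚ) :
    Prop :=
  ∃ Λ : ℂ, part x a₁ * part (rowShift x a₁) a₂ = Λ * qNum h (d + 1) ∧
    part x a₂ * part (rowShift x a₂) a₁ = Λ * qNum h (d - 1)

theorem PartsExchange.symm {h : ℂ} {part : (ℕ → ℚ) → ℕ × ℚ → ℂ} {x : ℕ → ℚ} {a₁ a₂ : ℕ × ℚ}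
    {d : ℚ} (hp : PartsExchange h part x a₁ a₂ d) : PartsExchange h part x a₂ a₁ (-d) := by
  obtain ⟨Λ, h1, h2⟩ := hp
  refine ⟨-Λ, ?_, ?_⟩
  · rw [h2, show -d + 1 = -(d - 1) by ring, qNum_neg]; ring
  · rw [h1, show -d - 1 = -(d + 1) by ring, qNum_neg]; ring

/-- If the two orders differ only by s(d - 1)^2 against s(d + 1)^2 in the denominator, then |d| ≥ 2
makes both q-numbers nonzero with a common sign, and the denominators can be crossed over to the
numerators. -/
theorem IsEvenRoot.exists_exchange_div {h : ℂ} {s : ℚ → ℂ} (hs : IsEvenRoot h s)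
    (hh : NotRootOfUnity h) {d : ℚ} (hd : ∃ z : ℤ, d = z) (hd2 : 2 ≤ d ∨ d ≤ -2)
    {C M p₁ p₂ k₁ k₂ : ℂ} (h₁ : p₁ = C / k₁) (h₂ : p₂ = C / k₂)
    (hk₁ : k₁ = M * s (d - 1) ^ 2) (hk₂ : k₂ = M * s (d + 1) ^ 2) :
    ∃ Λ : ℂ, p₁ = Λ * qNum h (d + 1) ∧ p₂ = Λ * qNum h (d - 1) := by
  have n1 : qNum h (d + 1) ≠ 0 := by
    obtain ⟨z, rfl⟩ := hd
    refine hh.qNum_ne ⟨2 * (z + 1), by push_cast; ring⟩ ?_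
    rcases hd2 with h | h <;> intro h0 <;> linarith
  have n2 : qNum h (d - 1) ≠ 0 := by
    obtain ⟨z, rfl⟩ := hd
    refine hh.qNum_ne ⟨2 * (z - 1), by push_cast; ring⟩ ?_
    rcases hd2 with h | h <;> intro h0 <;> linarith
  obtain ⟨σ, hσ, e1, e2⟩ : ∃ σ : ℂ, σ ≠ 0 ∧ s (d - 1) ^ 2 = σ * qNum h (d - 1) ∧
      s (d + 1) ^ 2 = σ * qNum h (d + 1) := by
    rcases hd2 with h | h
    · exact ⟨1, one_ne_zero, by rw [hs.sq _ (by linarith), one_mul],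
        by rw [hs.sq _ (by linarith), one_mul]⟩
    · exact ⟨-1, by norm_num, by rw [hs.sq_nonpos (by linarith), neg_one_mul],
        by rw [hs.sq_nonpos (by linarith), neg_one_mul]⟩
  refine ⟨C / (M * σ * qNum h (d - 1) * qNum h (d + 1)), ?_, ?_⟩
  · rw [h₁, hk₁, e1, div_mul_eq_mul_div, ← mul_assoc, mul_div_mul_right _ _ n1]
  · rw [h₂, hk₂, e2, div_mul_eq_mul_div, mul_right_comm (M * σ), ← mul_assoc,
      mul_div_mul_right _ _ n2]

theorem prod_chi_split (J : Finset ℕ) (f : ℚ → ℂ) (x : ℕ → ℚ) {a₁ a₂ : ℕ × ℚ}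
    (h₂ : IsEvenMove J a₂) (hne : a₁.1 ≠ a₂.1) :
    ∏ r ∈ J.erase a₁.1, f (x r) = f (x a₂.1) * ∏ r ∈ (J.erase a₁.1).erase a₂.1, f (x r) :=
  (Finset.mul_prod_erase _ _ (Finset.mem_erase.2 ⟨hne.symm, h₂.1⟩)).symm

theorem prod_chi_split_shift (J : Finset ℕ) (f : ℚ → ℂ) (x : ℕ → ℚ) {a₁ a₂ : ℕ × ℚ}
    (h₁ : IsEvenMove J a₁) (hne : a₁.1 ≠ a₂.1) :
    ∏ r ∈ J.erase a₂.1, f (rowShift x a₁ r) =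
      f (x a₁.1 + a₁.2) * ∏ r ∈ (J.erase a₁.1).erase a₂.1, f (x r) := by
  rw [← Finset.mul_prod_erase _ _ (Finset.mem_erase.2 ⟨hne, h₁.1⟩), rowShift_self,
    Finset.erase_right_comm]
  congr 1
  refine Finset.prod_congr rfl fun k hk => ?_
  rw [rowShift_ne _ (Finset.mem_erase.1 (Finset.mem_erase.1 hk).2).1]

section
variable {h : ℂ} {s : ℚ → ℂ} (hs : IsEvenRoot h s) (hh : NotRootOfUnity h)
include hs hh

/-- Only the mutual `chiEven` factors depend on the order. With v₁, v₂ the reflected entries, their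
product is symmetric in v₁ and v₂ except for s(v₂ - v₁ - 1)^2, which becomes s(v₂ - v₁ + 1)^2 in the
other order. -/
theorem evenCoeffPart_exchange (t : ℚ → ℂ) (J W : Finset ℕ) (w x : ℕ → ℚ) (a₁ a₂ : ℕ × ℚ)
    (h₁ : IsEvenMove J a₁) (h₂ : IsEvenMove J a₂) (hne : a₁.1 ≠ a₂.1)
    (hd : ∃ z : ℤ, evenBar x a₂ - evenBar x a₁ = z)
    (hd2 : 2 ≤ evenBar x a₂ - evenBar x a₁ ∨ evenBar x a₂ - evenBar x a₁ ≤ -2) :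
    PartsExchange h (evenCoeffPart s t J W w) x a₁ a₂ (evenBar x a₂ - evenBar x a₁) := by
  have key : ∀ a₁ a₂ : ℕ × ℚ, IsEvenMove J a₁ → IsEvenMove J a₂ → a₁.1 ≠ a₂.1 →
      evenCoeffPart s t J W w x a₁ * evenCoeffPart s t J W w (rowShift x a₁) a₂ =
      (a₁.2 * a₂.2 * (t (x a₁.1) * t (x a₁.1 + a₁.2)) * (t (x a₂.1) * t (x a₂.1 + a₂.2)) *
        ((∏ k ∈ W, phi s (w k) (evenBar x a₁)) * (∏ k ∈ W, phi s (w k) (evenBar x a₂))) /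
        ((∏ r ∈ (J.erase a₁.1).erase a₂.1, chiEven s (x r) (evenBar x a₁)) *
        ∏ r ∈ (J.erase a₁.1).erase a₂.1, chiEven s (x r) (evenBar x a₂))) /
      (s (evenBar x a₁ + evenBar x a₂) * s (evenBar x a₁ + evenBar x a₂ + 1) ^ 2 *
        s (evenBar x a₁ + evenBar x a₂ + 2) * s (evenBar x a₂ - evenBar x a₁) ^ 2 *
        s (evenBar x a₂ - evenBar x a₁ - 1) ^ 2) := by
    intro a₁ a₂ h₁ h₂ hne
    have e1 : evenBar (rowShift x a₁) a₁ = a₁.2 * (x a₁.1 + a₁.2) := by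
      rw [evenBar, rowShift_self]
    rw [evenCoeffPart, evenCoeffPart, evenBar_shift_ne _ hne.symm, rowShift_ne _ hne.symm,
      prod_chi_split J (fun u => chiEven s u (evenBar x a₁)) x h₂ hne,
      prod_chi_split_shift J (fun u => chiEven s u (evenBar x a₂)) x h₁ hne,
      chiEven_bar hs (x a₂.1) _ _ h₂.2, chiEven_bar hs (x a₁.1 + a₁.2) _ _ h₁.2, ← e1,
      evenBar_shift_self _ h₁]
    change _ * (_ / (chiEven s (evenBar x a₂) _ * _)) * _ = _
    set v₁ := evenBar x a₁
    set v₂ := evenBar x a₂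
    have e2 : chiEven s v₂ v₁ * chiEven s (v₁ + 1) v₂ = s (v₁ + v₂) * s (v₁ + v₂ + 1) ^ 2 *
        s (v₁ + v₂ + 2) * s (v₂ - v₁) ^ 2 * s (v₂ - v₁ - 1) ^ 2 := by
      rw [chiEven, chiEven, hs.eq (show v₁ + 1 - v₂ = -(v₂ - v₁ - 1) by ring),
        hs.eq (show v₁ + 1 - v₂ - 1 = -(v₂ - v₁) by ring), add_comm v₂ v₁,
        show v₁ + 1 + v₂ = v₁ + v₂ + 1 by ring, show v₁ + v₂ + 1 + 1 = v₁ + v₂ + 2 by ring]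
      ring
    rw [← e2]
    simp only [div_eq_mul_inv, mul_inv]
    ring
  refine hs.exists_exchange_div hh hd hd2 (key a₁ a₂ h₁ h₂ hne)
    ((key a₂ a₁ h₂ h₁ hne.symm).trans ?_)
    (M := s (evenBar x a₁ + evenBar x a₂) * s (evenBar x a₁ + evenBar x a₂ + 1) ^ 2 *
        s (evenBar x a₁ + evenBar x a₂ + 2) * s (evenBar x a₂ - evenBar x a₁) ^ 2) rfl rfl
  rw [add_comm (evenBar x a₂), Finset.erase_right_comm (a := a₂.1),
    hs.eq (show evenBar x a₁ - evenBar x a₂ = -(evenBar x a₂ - evenBar x a₁) by ring),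
    hs.eq (show evenBar x a₁ - evenBar x a₂ - 1 = -(evenBar x a₂ - evenBar x a₁ + 1) by ring)]
  congr 1
  ring

/-- As for even rows: the mutual `chiOdd` factors are symmetric in the two reflected entries apart
from s(v₂ - v₁ - 1)^2. -/
theorem oddCoeffPart_exchange (K Z : Finset ℕ) (z y : ℕ → ℚ) (a₁ a₂ : ℕ × ℚ)
    (h₁ : IsEvenMove K a₁) (h₂ : IsEvenMove K a₂) (hne : a₁.1 ≠ a₂.1)
    (hd : ∃ z : ℤ, oddBar y a₂ - oddBar y a₁ = z)
    (hd2 : 2 ≤ oddBar y a₂ - oddBar y a₁ ∨ oddBar y a₂ - oddBar y a₁ ≤ -2) :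
    PartsExchange h (oddCoeffPart h s K Z z) y a₁ a₂ (oddBar y a₂ - oddBar y a₁) := by
  have key : ∀ a₁ a₂ : ℕ × ℚ, IsEvenMove K a₁ → IsEvenMove K a₂ → a₁.1 ≠ a₂.1 →
      oddCoeffPart h s K Z z y a₁ * oddCoeffPart h s K Z z (rowShift y a₁) a₂ =
      (a₁.2 * a₂.2 *
        ((∏ k ∈ Z, psi s (z k) (oddBar y a₁)) * (∏ k ∈ Z, psi s (z k) (oddBar y a₂))) *
        ((1 / (s (oddBar y a₁) ^ 2 * s (2 * oddBar y a₁ + 1) * s (2 * oddBar y a₁ - 1))) *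
        (1 / (s (oddBar y a₂) ^ 2 * s (2 * oddBar y a₂ + 1) * s (2 * oddBar y a₂ - 1)))) /
        ((∏ r ∈ (K.erase a₁.1).erase a₂.1, chiOdd s (y r) (oddBar y a₁)) *
        ∏ r ∈ (K.erase a₁.1).erase a₂.1, chiOdd s (y r) (oddBar y a₂))) /
      (s (oddBar y a₁ + oddBar y a₂) ^ 2 * s (oddBar y a₁ + oddBar y a₂ + 1) *
        s (oddBar y a₁ + oddBar y a₂ - 1) * s (oddBar y a₂ - oddBar y a₁) ^ 2 *
        s (oddBar y a₂ - oddBar y a₁ - 1) ^ 2) := by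
    intro a₁ a₂ h₁ h₂ hne
    have e1 : oddBar (rowShift y a₁) a₁ = a₁.2 * (y a₁.1 + a₁.2) + (a₁.2 ^ 2 - a₁.2) / 2 := by
      rw [oddBar, rowShift_self]
    rw [oddCoeffPart, oddCoeffPart, if_neg h₁.ne_zero, if_neg h₂.ne_zero,
      oddBar_shift_ne _ hne.symm,
      prod_chi_split K (fun u => chiOdd s u (oddBar y a₁)) y h₂ hne,
      prod_chi_split_shift K (fun u => chiOdd s u (oddBar y a₂)) y h₁ hne,
      chiOdd_bar hs (y a₂.1) _ _ h₂.2, chiOdd_bar hs (y a₁.1 + a₁.2) _ _ h₁.2, ← e1,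
      oddBar_shift_self _ h₁]
    change _ / (chiOdd s (oddBar y a₂) _ * _) * _ * _ = _
    set v₁ := oddBar y a₁
    set v₂ := oddBar y a₂
    have e2 : chiOdd s v₂ v₁ * chiOdd s (v₁ + 1) v₂ = s (v₁ + v₂) ^ 2 * s (v₁ + v₂ + 1) *
        s (v₁ + v₂ - 1) * s (v₂ - v₁) ^ 2 * s (v₂ - v₁ - 1) ^ 2 := by
      rw [chiOdd, chiOdd, hs.eq (show v₁ + 1 - v₂ = -(v₂ - v₁ - 1) by ring),
        hs.eq (show v₁ + 1 - v₂ - 1 = -(v₂ - v₁) by ring), add_comm v₂ v₁,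
        show v₁ + 1 + v₂ = v₁ + v₂ + 1 by ring, show v₁ + v₂ + 1 - 1 = v₁ + v₂ by ring]
      ring
    rw [← e2]
    simp only [div_eq_mul_inv, mul_inv]
    ring
  refine hs.exists_exchange_div hh hd hd2 (key a₁ a₂ h₁ h₂ hne)
    ((key a₂ a₁ h₂ h₁ hne.symm).trans ?_)
    (M := s (oddBar y a₁ + oddBar y a₂) ^ 2 * s (oddBar y a₁ + oddBar y a₂ + 1) *
        s (oddBar y a₁ + oddBar y a₂ - 1) * s (oddBar y a₂ - oddBar y a₁) ^ 2) rfl rfl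
  rw [add_comm (oddBar y a₂), Finset.erase_right_comm (a := a₂.1),
    hs.eq (show oddBar y a₁ - oddBar y a₂ = -(oddBar y a₂ - oddBar y a₁) by ring),
    hs.eq (show oddBar y a₁ - oddBar y a₂ - 1 = -(oddBar y a₂ - oddBar y a₁ + 1) by ring)]
  congr 1
  ring

omit hs in
/-- The diagonal term exchanged with a move. -/
theorem oddCoeffPart_exchange_diag (K Z : Finset ℕ) (h0 : 0 ∉ K) (z y : ℕ → ℚ) (a : ℕ × ℚ)
    (ha : IsEvenMove K a) (hz : ∃ n : ℤ, 2 * y a.1 = n)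
    (h1 : oddBar y a = 1 ∨ oddBar y a = -1 → ∏ r ∈ Z, qNum h (z r) = 0) :
    PartsExchange h (oddCoeffPart h s K Z z) y a (0, 0) (-oddBar y a) := by
  have hne : (0 : ℕ) ≠ a.1 := fun h => h0 (h ▸ ha.1)
  have f1 : ∀ g : ℕ → ℚ, (∀ k, k ≠ a.1 → g k = y k) →
      (∏ k ∈ K, qNum h (g k) * qNum h (g k - 1))⁻¹ =
      (∏ k ∈ K.erase a.1, qNum h (y k) * qNum h (y k - 1))⁻¹ *
        (qNum h (a.2 * g a.1 + (a.2 ^ 2 - a.2) / 2) *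
          qNum h (a.2 * g a.1 + (a.2 ^ 2 - a.2) / 2 - 1))⁻¹ := by
    intro g hg
    rw [← Finset.mul_prod_erase K _ ha.1, mul_inv, mul_comm]
    congr 2
    · exact Finset.prod_congr rfl fun k hk => by rw [hg k (Finset.mem_erase.1 hk).1]
    · rcases ha.2 with h' | h' <;> rw [h']
      · congr 2 <;> ring
      · rw [show (-1 : ℚ) * g a.1 + ((-1) ^ 2 - -1) / 2 = -(g a.1 - 1) by ring, qNum_neg,
          show -(g a.1 - 1) - 1 = -(g a.1) by ring, qNum_neg]
        ring
  have e0 := f1 y fun _ _ => rfl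
  have e1 := f1 (rowShift y a) fun k hk => rowShift_ne _ hk
  change _ = _ * (qNum h (oddBar y a) * qNum h (oddBar y a - 1))⁻¹ at e0
  change _ = _ * (qNum h (oddBar (rowShift y a) a) * qNum h (oddBar (rowShift y a) a - 1))⁻¹ at e1
  rw [oddBar_shift_self _ ha, add_sub_cancel_right] at e1
  unfold PartsExchange
  simp only [oddCoeffPart, if_true, if_neg ha.ne_zero, rowShift_zero]
  rw [e0, e1]
  -- When the product over `z` vanishes there is nothing to compare. Otherwise v ≠ ±1, so the
  -- q-numbers of v - 1 and v + 1 are invertible; [v] occurs equally on both sides and may vanish.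
  by_cases hZ : ∏ r ∈ Z, qNum h (z r) = 0
  · exact ⟨0, by simp [hZ], by simp [hZ]⟩
  have hv : oddBar y a ≠ 1 ∧ oddBar y a ≠ -1 := by
    constructor <;> intro h' <;> exact hZ (h1 (by simp [h']))
  have hint : ∃ n : ℤ, 2 * oddBar y a = n := by
    obtain ⟨n, hn⟩ := hz
    rcases ha.2 with h' | h' <;> rw [oddBar, h']
    · exact ⟨n, by rw [← hn]; ring⟩
    · exact ⟨2 - n, by push_cast; rw [← hn]; ring⟩
  set v := oddBar y a
  have n1 : qNum h (v - 1) ≠ 0 := hh.qNum_ne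
    (by obtain ⟨n, hn⟩ := hint; exact ⟨n - 2, by push_cast; rw [← hn]; ring⟩)
    (fun h' => hv.1 (by linarith))
  have n2 : qNum h (v + 1) ≠ 0 := hh.qNum_ne
    (by obtain ⟨n, hn⟩ := hint; exact ⟨n + 2, by push_cast; rw [← hn]; ring⟩)
    (fun h' => hv.2 (by linarith))
  rw [show -v + 1 = -(v - 1) by ring, show -v - 1 = -(v + 1) by ring, qNum_neg, qNum_neg]
  set X := a.2 * (∏ r ∈ Z, psi s (z r) v) / (∏ k ∈ K.erase a.1, chiOdd s (y k) v) *
      (1 / (s v ^ 2 * s (2 * v + 1) * s (2 * v - 1)))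
  set Y := Complex.I * (∏ r ∈ Z, qNum h (z r))
  set R := (∏ k ∈ K.erase a.1, qNum h (y k) * qNum h (y k - 1))⁻¹
  refine ⟨-(X * Y * R * (qNum h v)⁻¹ * (qNum h (v - 1))⁻¹ * (qNum h (v + 1))⁻¹), ?_, ?_⟩ <;>
  · simp only [mul_inv]
    field_simp

end

/-! ### Cancellation of paths that do not return -/

/-- The coefficient of a path made of one move with coefficients `V` in the row `x` and two moves
`b₁`, `b₂` with coefficients `U` in the row `y`, in the cubic relation. -/
def pathWeight (q : ℂ) (V : (ℕ → ℚ) → (ℕ → ℚ) → ℕ × ℚ → ℂ) (U : (ℕ → ℚ) → (ℕ → ℚ) → ℕ × ℚ → ℂ)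
    (x y : ℕ → ℚ) (a b₁ b₂ : ℕ × ℚ) : ℂ :=
  V x y a * U (rowShift x a) y b₁ * U (rowShift x a) (rowShift y b₁) b₂
    - q * (U x y b₁ * V x (rowShift y b₁) a * U (rowShift x a) (rowShift y b₁) b₂)
    + U x y b₁ * U x (rowShift y b₁) b₂ * V x (rowShift (rowShift y b₁) b₂) a

section
variable {h : ℂ} {s : ℚ → ℂ} (hs : IsEvenRoot h s) (hh : NotRootOfUnity h)
include hs hh

/-- With d = v₂ - v₁, the order b₁, b₂ carries Λ[d + 1] from the row itself and -[d - 1] from the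
three positions of the even move; the other order carries Λ[d - 1] and [d + 1]. -/
theorem pathWeight_odd_odd_of_even (t : ℚ → ℂ) (J W K Z : Finset ℕ) (w z x y : ℕ → ℚ)
    (a b₁ b₂ : ℕ × ℚ) (ha : IsEvenMove J a) (h₁ : IsEvenMove K b₁) (h₂ : IsOddMove K b₂)
    (hne : b₁.1 ≠ b₂.1)
    (hθ₁ : b₁.2 ≠ 0 → ∃ n : ℤ, oddBar y b₁ - evenBar x a = n)
    (hθ₂ : b₂.2 ≠ 0 → ∃ n : ℤ, oddBar y b₂ - evenBar x a = n)
    (hex : PartsExchange h (oddCoeffPart h s K Z z) y b₁ b₂ (oddBar y b₂ - oddBar y b₁)) :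
    pathWeight (qTwo h) (evenCoeff s t J W K w) (oddCoeff h s K Z J z) x y a b₁ b₂ +
      pathWeight (qTwo h) (evenCoeff s t J W K w) (oddCoeff h s K Z J z) x y a b₂ b₁ = 0 := by
  obtain ⟨Λ, l1, l2⟩ := hex
  obtain ⟨c, c0, c1, c2, c3⟩ := exists_prod_rowShift K (fun u => phi s u (evenBar x a)) y b₁ b₂
    h₁ h₂ hne
  obtain ⟨κ₁, k1, k2⟩ := exists_exchange hs (x a.1) (y b₁.1) a.2 b₁.2 ha.2 h₁.isOddMove.cases hθ₁
  obtain ⟨κ₂, k3, k4⟩ := exists_exchange hs (x a.1) (y b₂.1) a.2 b₂.2 ha.2 h₂.cases hθ₂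
  obtain ⟨p1, p2⟩ := prod_rowShift J (fun u => psiM h s b₁.2 u (oddBar y b₁)) x a ha.1
  obtain ⟨p3, p4⟩ := prod_rowShift J (fun u => psiM h s b₂.2 u (oddBar y b₂)) x a ha.1
  rw [if_neg h₁.ne_zero] at k1 k2
  change _ * psiM h s b₁.2 _ (oddBar y b₁) = κ₁ * qNum h (oddBar y b₁ - evenBar x a - 1) at k1
  change psiM h s b₁.2 _ (oddBar y b₁) * _ = κ₁ * qNum h (oddBar y b₁ - evenBar x a) at k2
  change _ * psiM h s b₂.2 _ (oddBar y b₂) = κ₂ * qNum h (oddBar y b₂ - evenBar x a - 1) at k3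
  change psiM h s b₂.2 _ (oddBar y b₂) * _ = κ₂ * qNum h (oddBar y b₂ - evenBar x a) at k4
  change phi s _ (evenBar x a) * _ = _ at k1
  change _ * phi s _ (evenBar x a) = _ at k2
  change (if _ then _ else phi s _ (evenBar x a)) * _ = _ at k3
  change _ * (if _ then _ else phi s _ (evenBar x a)) = _ at k4
  have i1 := hh.cubic_identity (oddBar y b₁ - evenBar x a) (oddBar y b₂ - evenBar x a)
  have i2 := hh.cubic_identity (oddBar y b₂ - evenBar x a) (oddBar y b₁ - evenBar x a)
  rw [show oddBar y b₁ - evenBar x a - (oddBar y b₂ - evenBar x a) + 1 =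
    -(oddBar y b₂ - oddBar y b₁ - 1) by ring, qNum_neg] at i1
  rw [show oddBar y b₂ - evenBar x a - (oddBar y b₁ - evenBar x a) + 1 =
    oddBar y b₂ - oddBar y b₁ + 1 by ring] at i2
  simp only [pathWeight, evenCoeff, oddCoeff]
  rw [oddBar_shift_ne y hne, oddBar_shift_ne y hne.symm, rowShift_comm y b₂ b₁, c0, c1, c2, c3,
    p1, p2, p3, p4]
  set R := evenCoeffPart s t J W w x a
  set S₁ := oddCoeffPart h s K Z z y b₁
  set S₂ := oddCoeffPart h s K Z z y b₂
  set S₁₂ := oddCoeffPart h s K Z z (rowShift y b₁) b₂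
  set S₂₁ := oddCoeffPart h s K Z z (rowShift y b₂) b₁
  set Ψ₁ := ∏ r ∈ J.erase a.1, psiM h s b₁.2 (x r) (oddBar y b₁)
  set Ψ₂ := ∏ r ∈ J.erase a.1, psiM h s b₂.2 (x r) (oddBar y b₂)
  set g₁ := phi s (y b₁.1) (evenBar x a)
  set g₁' := phi s (y b₁.1 + b₁.2) (evenBar x a)
  set g₂ : ℂ := if b₂.2 = 0 then 1 else phi s (y b₂.1) (evenBar x a)
  set g₂' : ℂ := if b₂.2 = 0 then 1 else phi s (y b₂.1 + b₂.2) (evenBar x a)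
  set u₁ := psiM h s b₁.2 (x a.1) (oddBar y b₁)
  set u₁' := psiM h s b₁.2 (x a.1 + a.2) (oddBar y b₁)
  set u₂ := psiM h s b₂.2 (x a.1) (oddBar y b₂)
  set u₂' := psiM h s b₂.2 (x a.1 + a.2) (oddBar y b₂)
  set m₁ := qNum h (oddBar y b₁ - evenBar x a - 1)
  set n₁ := qNum h (oddBar y b₁ - evenBar x a)
  set m₂ := qNum h (oddBar y b₂ - evenBar x a - 1)
  set n₂ := qNum h (oddBar y b₂ - evenBar x a)
  set D₁ := qNum h (oddBar y b₂ - oddBar y b₁ + 1)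
  set D₂ := qNum h (oddBar y b₂ - oddBar y b₁ - 1)
  have w1 : R * c * Ψ₁ * Ψ₂ * (S₁ * S₁₂) * (g₁ * u₁' * (g₂ * u₂') -
      qTwo h * (u₁ * g₁' * (g₂ * u₂')) + u₁ * g₁' * (u₂ * g₂')) =
      R * c * Ψ₁ * Ψ₂ * (Λ * D₁) * (κ₁ * κ₂ * -D₂) := by
    rw [k1, k2, k3, k4, l1, ← i1]; ring
  have w2 : R * c * Ψ₁ * Ψ₂ * (S₂ * S₂₁) * (g₁ * u₁' * (g₂ * u₂') -
      qTwo h * (u₂ * g₂' * (g₁ * u₁')) + u₁ * g₁' * (u₂ * g₂')) =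
      R * c * Ψ₁ * Ψ₂ * (Λ * D₂) * (κ₁ * κ₂ * D₁) := by
    rw [k1, k2, k3, k4, l2, ← i2]; ring
  linear_combination w1 + w2

theorem pathWeight_odd_odd (t : ℚ → ℂ) (J W K Z : Finset ℕ) (w z x y : ℕ → ℚ)
    (a b₁ b₂ : ℕ × ℚ) (ha : IsEvenMove J a) (h₁ : IsOddMove K b₁) (h₂ : IsOddMove K b₂)
    (hne : b₁.1 ≠ b₂.1)
    (hθ₁ : b₁.2 ≠ 0 → ∃ n : ℤ, oddBar y b₁ - evenBar x a = n)
    (hθ₂ : b₂.2 ≠ 0 → ∃ n : ℤ, oddBar y b₂ - evenBar x a = n)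
    (hex : PartsExchange h (oddCoeffPart h s K Z z) y b₁ b₂ (oddBar y b₂ - oddBar y b₁)) :
    pathWeight (qTwo h) (evenCoeff s t J W K w) (oddCoeff h s K Z J z) x y a b₁ b₂ +
      pathWeight (qTwo h) (evenCoeff s t J W K w) (oddCoeff h s K Z J z) x y a b₂ b₁ = 0 := by
  rcases h₁ with h₁ | rfl
  · exact pathWeight_odd_odd_of_even hs hh t J W K Z w z x y a b₁ b₂ ha h₁ h₂ hne hθ₁ hθ₂ hex
  rcases h₂ with h₂ | rfl
  -- If the first move is the diagonal one, interchange the two orders; the exchange relation is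
  -- symmetric under d ↦ -d.
  · rw [add_comm]
    have := hex.symm
    rw [neg_sub] at this
    exact pathWeight_odd_odd_of_even hs hh t J W K Z w z x y a b₂ _ ha h₂ (Or.inr rfl) hne.symm
      hθ₂ hθ₁ this
  · exact absurd rfl hne

/-- The same cancellation with the roles of the rows interchanged; the move b, which may be the
diagonal term, is the one whose position varies. -/
theorem pathWeight_even_even (t : ℚ → ℂ) (J W K Z : Finset ℕ) (w z x y : ℕ → ℚ)
    (b a₁ a₂ : ℕ × ℚ) (hb : IsOddMove K b) (h₁ : IsEvenMove J a₁) (h₂ : IsEvenMove J a₂)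
    (hne : a₁.1 ≠ a₂.1)
    (hθ₁ : b.2 ≠ 0 → ∃ n : ℤ, oddBar y b - evenBar x a₁ = n)
    (hθ₂ : b.2 ≠ 0 → ∃ n : ℤ, oddBar y b - evenBar x a₂ = n)
    (hex : PartsExchange h (evenCoeffPart s t J W w) x a₁ a₂ (evenBar x a₂ - evenBar x a₁)) :
    pathWeight (qTwo h) (fun y x => oddCoeff h s K Z J z x y)
        (fun y x => evenCoeff s t J W K w x y) y x b a₁ a₂ +
      pathWeight (qTwo h) (fun y x => oddCoeff h s K Z J z x y)
        (fun y x => evenCoeff s t J W K w x y) y x b a₂ a₁ = 0 := by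
  obtain ⟨Λ, l1, l2⟩ := hex
  obtain ⟨c, c0, c1, c2, c3⟩ := exists_prod_rowShift J (fun u => psiM h s b.2 u (oddBar y b)) x
    a₁ a₂ h₁ h₂.isOddMove hne
  simp only [if_neg h₂.ne_zero] at c0 c1 c2 c3
  obtain ⟨κ₁, k1, k2⟩ := exists_exchange hs (x a₁.1) (y b.1) a₁.2 b.2 h₁.2 hb.cases hθ₁
  obtain ⟨κ₂, k3, k4⟩ := exists_exchange hs (x a₂.1) (y b.1) a₂.2 b.2 h₂.2 hb.cases hθ₂
  have hp : ∀ v, ∃ d : ℂ, (∏ k ∈ K, phi s (y k) v = d * if b.2 = 0 then 1 else phi s (y b.1) v) ∧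
      (∏ k ∈ K, phi s (rowShift y b k) v = d * if b.2 = 0 then 1 else phi s (y b.1 + b.2) v) := by
    intro v
    rcases hb with hb | rfl
    · obtain ⟨p1, p2⟩ := prod_rowShift K (fun u => phi s u v) y b hb.1
      exact ⟨_, by rw [if_neg hb.ne_zero, p1], by rw [if_neg hb.ne_zero, p2]⟩
    · exact ⟨_, by rw [if_pos rfl, mul_one], by rw [if_pos rfl, mul_one, rowShift_zero]⟩
  obtain ⟨d₁, p1, p2⟩ := hp (evenBar x a₁)
  obtain ⟨d₂, p3, p4⟩ := hp (evenBar x a₂)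
  change _ * psiM h s b.2 _ (oddBar y b) = κ₁ * qNum h (oddBar y b - evenBar x a₁ - 1) at k1
  change psiM h s b.2 _ (oddBar y b) * _ = κ₁ * qNum h (oddBar y b - evenBar x a₁) at k2
  change _ * psiM h s b.2 _ (oddBar y b) = κ₂ * qNum h (oddBar y b - evenBar x a₂ - 1) at k3
  change psiM h s b.2 _ (oddBar y b) * _ = κ₂ * qNum h (oddBar y b - evenBar x a₂) at k4
  change (if _ then _ else phi s _ (evenBar x a₁)) * _ = _ at k1
  change _ * (if _ then _ else phi s _ (evenBar x a₁)) = _ at k2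
  change (if _ then _ else phi s _ (evenBar x a₂)) * _ = _ at k3
  change _ * (if _ then _ else phi s _ (evenBar x a₂)) = _ at k4
  have i1 := hh.cubic_identity (oddBar y b - evenBar x a₁) (oddBar y b - evenBar x a₂)
  have i2 := hh.cubic_identity (oddBar y b - evenBar x a₂) (oddBar y b - evenBar x a₁)
  rw [show oddBar y b - evenBar x a₁ - (oddBar y b - evenBar x a₂) + 1 =
    evenBar x a₂ - evenBar x a₁ + 1 by ring] at i1
  rw [show oddBar y b - evenBar x a₂ - (oddBar y b - evenBar x a₁) + 1 =
    -(evenBar x a₂ - evenBar x a₁ - 1) by ring, qNum_neg] at i2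
  simp only [pathWeight, evenCoeff, oddCoeff]
  rw [evenBar_shift_ne x hne, evenBar_shift_ne x hne.symm, rowShift_comm x a₂ a₁, c0, c1, c2, c3,
    p1, p2, p3, p4]
  set S := oddCoeffPart h s K Z z y b
  set R₁ := evenCoeffPart s t J W w x a₁
  set R₂ := evenCoeffPart s t J W w x a₂
  set R₁₂ := evenCoeffPart s t J W w (rowShift x a₁) a₂
  set R₂₁ := evenCoeffPart s t J W w (rowShift x a₂) a₁
  set g₁ : ℂ := if b.2 = 0 then 1 else phi s (y b.1) (evenBar x a₁)
  set g₁' : ℂ := if b.2 = 0 then 1 else phi s (y b.1 + b.2) (evenBar x a₁)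
  set g₂ : ℂ := if b.2 = 0 then 1 else phi s (y b.1) (evenBar x a₂)
  set g₂' : ℂ := if b.2 = 0 then 1 else phi s (y b.1 + b.2) (evenBar x a₂)
  set u₁ := psiM h s b.2 (x a₁.1) (oddBar y b)
  set u₁' := psiM h s b.2 (x a₁.1 + a₁.2) (oddBar y b)
  set u₂ := psiM h s b.2 (x a₂.1) (oddBar y b)
  set u₂' := psiM h s b.2 (x a₂.1 + a₂.2) (oddBar y b)
  set m₁ := qNum h (oddBar y b - evenBar x a₁ - 1)
  set n₁ := qNum h (oddBar y b - evenBar x a₁)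
  set m₂ := qNum h (oddBar y b - evenBar x a₂ - 1)
  set n₂ := qNum h (oddBar y b - evenBar x a₂)
  set D₁ := qNum h (evenBar x a₂ - evenBar x a₁ + 1)
  set D₂ := qNum h (evenBar x a₂ - evenBar x a₁ - 1)
  have w1 : S * c * d₁ * d₂ * (R₁ * R₁₂) * (u₁ * g₁' * (u₂ * g₂') -
      qTwo h * (u₂ * g₂' * (g₁ * u₁')) + g₁ * u₁' * (g₂ * u₂')) =
      S * c * d₁ * d₂ * (Λ * D₁) * (κ₁ * κ₂ * -D₂) := by
    rw [k1, k2, k3, k4, l1, ← i2]; ring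
  have w2 : S * c * d₁ * d₂ * (R₂ * R₂₁) * (u₁ * g₁' * (u₂ * g₂') -
      qTwo h * (u₁ * g₁' * (g₂ * u₂')) + g₁ * u₁' * (g₂ * u₂')) =
      S * c * d₁ * d₂ * (Λ * D₂) * (κ₁ * κ₂ * D₁) := by
    rw [k1, k2, k3, k4, l2, ← i1]; ring
  linear_combination w1 + w2

/-- Three consecutive values: the sum vanishes unless the middle one is zero. -/
theorem consecutive_sum {d : ℚ} (hd : ∃ z : ℤ, d = z) :
    s d * (s (d - 1) ^ 2 - qTwo h * s d ^ 2 + s (d + 1) ^ 2) = 0 := by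
  obtain ⟨z, rfl⟩ := hd
  have h2 := hh.qTwo_mul (z : ℚ)
  rcases lt_trichotomy z 0 with hz | rfl | hz
  · have : (z : ℚ) + 1 ≤ 0 := by exact_mod_cast hz
    rw [hs.sq_nonpos (by linarith), hs.sq_nonpos (by linarith), hs.sq_nonpos (by linarith)]
    linear_combination s z * h2
  · rw [Int.cast_zero, hs.zero, zero_mul]
  · have : (1 : ℚ) ≤ z := by exact_mod_cast hz
    rw [hs.sq _ (by linarith), hs.sq _ (by linarith), hs.sq _ (by linarith)]
    linear_combination -s z * h2

/-- Making one move twice leaves a single order. Exchanging the even move past each copy gives s(d)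
times a combination of the squares s(d - 1)^2, s(d)^2, s(d + 1)^2, which vanishes by
`consecutive_sum`. -/
theorem pathWeight_odd_same (t : ℚ → ℂ) (J W K Z : Finset ℕ) (w z x y : ℕ → ℚ)
    (a b : ℕ × ℚ) (ha : IsEvenMove J a) (hb : IsEvenMove K b)
    (hθ : ∃ n : ℤ, oddBar y b - evenBar x a = n) :
    pathWeight (qTwo h) (evenCoeff s t J W K w) (oddCoeff h s K Z J z) x y a b b = 0 := by
  have c0 := (prod_rowShift K (fun u => phi s u (evenBar x a)) y b hb.1).1
  have c1 := (prod_rowShift K (fun u => phi s u (evenBar x a)) y b hb.1).2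
  have c2 := prod_rowShift_twice K (fun u => phi s u (evenBar x a)) y b hb.1
  obtain ⟨p1, p2⟩ := prod_rowShift J (fun u => psi s u (oddBar y b)) x a ha.1
  obtain ⟨p3, p4⟩ := prod_rowShift J (fun u => psi s u (oddBar y b + 1)) x a ha.1
  have f0 := phi_bar hs (y b.1) (evenBar x a) b.2 hb.2
  have f1 := phi_bar hs (y b.1 + b.2) (evenBar x a) b.2 hb.2
  have f2 := phi_bar hs (y b.1 + b.2 + b.2) (evenBar x a) b.2 hb.2
  have e0 : b.2 * y b.1 + (b.2 ^ 2 - b.2) / 2 = oddBar y b := rfl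
  have e1 : b.2 * (y b.1 + b.2) + (b.2 ^ 2 - b.2) / 2 = oddBar y b + 1 := by
    rw [← oddBar_shift_self y hb, oddBar, rowShift_self]
  have e2 : b.2 * (y b.1 + b.2 + b.2) + (b.2 ^ 2 - b.2) / 2 = oddBar y b + 2 := by
    rw [oddBar]; rcases hb.2 with h' | h' <;> rw [h'] <;> ring
  rw [e0] at f0
  rw [e1] at f1
  rw [e2] at f2
  have g0 : ∀ v, psi s (x a.1) v = psi s (evenBar x a) v := fun v => psi_bar hs _ _ _ ha.2
  have g1 : ∀ v, psi s (x a.1 + a.2) v = psi s (evenBar x a + 1) v := fun v => by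
    rw [psi_bar hs (x a.1 + a.2) v _ ha.2, ← evenBar_shift_self x ha, evenBar, rowShift_self]
  simp only [pathWeight, evenCoeff, oddCoeff, psiM, if_neg hb.ne_zero]
  rw [oddBar_shift_self y hb, c0, c1, c2, p1, p2, p3, p4, f0, f1, f2, g0, g0, g1, g1]
  have key := consecutive_sum hs hh hθ
  set u := evenBar x a
  set v := oddBar y b
  generalize ∏ k ∈ K.erase b.1, phi s (y k) u = Φ
  generalize ∏ k ∈ J.erase a.1, psi s (x k) v = Ψ
  generalize ∏ k ∈ J.erase a.1, psi s (x k) (v + 1) = Ψ'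
  simp only [phi, psi]
  rw [hs.eq (show u + 1 - v = -(v - u - 1) by ring),
    hs.eq (show u + 1 - (v + 1) = -(v - u) by ring), hs.eq (show u - v = -(v - u) by ring),
    hs.eq (show u - (v + 1) = -(v - u + 1) by ring), show v + 1 - u - 1 = v - u by ring,
    show v + 2 - u - 1 = v - u + 1 by ring, show u + 1 + v = v + u + 1 by ring,
    show u + 1 + (v + 1) = v + u + 2 by ring, show u + v = v + u by ring,
    show u + (v + 1) = v + u + 1 by ring, show v + 1 + u = v + u + 1 by ring,
    show v + 2 + u = v + u + 2 by ring]
  linear_combination (evenCoeffPart s t J W w x a * oddCoeffPart h s K Z z y b *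
    oddCoeffPart h s K Z z (rowShift y b) b * Φ * Ψ * Ψ' *
    s (v + u) * s (v + u + 1) * s (v + u + 2)) * key

/-- Here the consecutive integers are centred at θ - 1, with θ the difference of the reflected
entries. For the diagonal term the recurrence is applied directly to [x], [x + ε] and [x + 2ε]. -/
theorem pathWeight_even_same (t : ℚ → ℂ) (J W K Z : Finset ℕ) (w z x y : ℕ → ℚ)
    (a b : ℕ × ℚ) (ha : IsEvenMove J a) (hb : IsOddMove K b)
    (hθ : b.2 ≠ 0 → ∃ n : ℤ, oddBar y b - evenBar x a = n) :
    pathWeight (qTwo h) (fun y x => oddCoeff h s K Z J z x y)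
        (fun y x => evenCoeff s t J W K w x y) y x b a a = 0 := by
  have p0 := (prod_rowShift J (fun u => psiM h s b.2 u (oddBar y b)) x a ha.1).1
  have p1 := (prod_rowShift J (fun u => psiM h s b.2 u (oddBar y b)) x a ha.1).2
  have p2 := prod_rowShift_twice J (fun u => psiM h s b.2 u (oddBar y b)) x a ha.1
  rcases hb with hb | rfl
  · obtain ⟨c0, c1⟩ := prod_rowShift K (fun u => phi s u (evenBar x a)) y b hb.1
    obtain ⟨c2, c3⟩ := prod_rowShift K (fun u => phi s u (evenBar x a + 1)) y b hb.1
    have f0 : ∀ v, phi s (y b.1) v = phi s (oddBar y b) v := fun v => phi_bar hs _ _ _ hb.2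
    have f1 : ∀ v, phi s (y b.1 + b.2) v = phi s (oddBar y b + 1) v := fun v => by
      rw [phi_bar hs _ _ _ hb.2, ← oddBar_shift_self y hb, oddBar, rowShift_self]
    have g0 := psi_bar hs (x a.1) (oddBar y b) _ ha.2
    have g1 := psi_bar hs (x a.1 + a.2) (oddBar y b) _ ha.2
    have g2 := psi_bar hs (x a.1 + a.2 + a.2) (oddBar y b) _ ha.2
    have e0 : a.2 * x a.1 = evenBar x a := rfl
    have e1 : a.2 * (x a.1 + a.2) = evenBar x a + 1 := by
      rw [← evenBar_shift_self x ha, evenBar, rowShift_self]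
    have e2 : a.2 * (x a.1 + a.2 + a.2) = evenBar x a + 2 := by
      rw [evenBar]; rcases ha.2 with h' | h' <;> rw [h'] <;> ring
    rw [e0] at g0
    rw [e1] at g1
    rw [e2] at g2
    simp only [psiM, if_neg hb.ne_zero] at p0 p1 p2
    simp only [pathWeight, evenCoeff, oddCoeff, psiM, if_neg hb.ne_zero]
    rw [evenBar_shift_self x ha, c0, c1, c2, c3, p0, p1, p2, f0, f0, f1, f1, g0, g1, g2]
    have hθ' : ∃ n : ℤ, oddBar y b - evenBar x a - 1 = n := by
      obtain ⟨n, hn⟩ := hθ hb.ne_zero; exact ⟨n - 1, by push_cast; rw [← hn]⟩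
    have key := consecutive_sum hs hh hθ'
    set u := evenBar x a
    set v := oddBar y b
    generalize ∏ k ∈ J.erase a.1, psi s (x k) v = Ψ
    generalize ∏ k ∈ K.erase b.1, phi s (y k) u = Φ
    generalize ∏ k ∈ K.erase b.1, phi s (y k) (u + 1) = Φ'
    simp only [phi, psi]
    rw [hs.eq (show u + 1 - v = -(v - u - 1) by ring), hs.eq (show u - v = -(v - u) by ring),
      hs.eq (show u + 2 - v = -(v - u - 1 - 1) by ring), show v - (u + 1) - 1 = v - u - 1 - 1 by ring,
      show v + 1 - u - 1 = v - u by ring,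
      show v + 1 - (u + 1) - 1 = v - u - 1 by ring, show u + 1 + v = v + u + 1 by ring,
      show u + 2 + v = v + u + 2 by ring, show u + v = v + u by ring,
      show v + (u + 1) = v + u + 1 by ring, show v + 1 + u = v + u + 1 by ring,
      show v + 1 + (u + 1) = v + u + 2 by ring]
    rw [sub_add_cancel] at key
    linear_combination (evenCoeffPart s t J W w x a * oddCoeffPart h s K Z z y b *
      evenCoeffPart s t J W w (rowShift x a) a * Ψ * Φ * Φ' *
      s (v + u) * s (v + u + 1) * s (v + u + 2)) * key
  · simp only [psiM, if_true] at p0 p1 p2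
    simp only [pathWeight, evenCoeff, oddCoeff, psiM, if_true, rowShift_zero]
    rw [p0, p1, p2]
    have key := hh.qTwo_mul (x a.1 + a.2)
    have key' : qNum h (x a.1) + qNum h (x a.1 + a.2 + a.2) =
        qTwo h * qNum h (x a.1 + a.2) := by
      rw [key]
      rcases ha.2 with h' | h' <;> rw [h']
      · rw [add_sub_cancel_right, add_comm]
      · rw [show x a.1 + -1 + 1 = x a.1 by ring, show x a.1 + -1 - 1 = x a.1 + -1 + -1 by ring]
    linear_combination (oddCoeffPart h s K Z z y (0, 0) * (∏ k ∈ J.erase a.1, qNum h (x k)) *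
      evenCoeffPart s t J W w x a * (∏ k ∈ K, phi s (y k) (evenBar x a)) *
      evenCoeffPart s t J W w (rowShift x a) a *
      (∏ k ∈ K, phi s (y k) (evenBar (rowShift x a) a))) * key'

end

/-! ### Interpolation at values of the hyperbolic cosine -/

theorem int_two_mul_add {x : ℚ} (hx : ∃ n : ℤ, 2 * x = n) (m : ℤ) : ∃ n : ℤ, 2 * x + m = n := by
  obtain ⟨n, hn⟩ := hx; exact ⟨n + m, by push_cast; rw [hn]⟩

section
variable {h : ℂ} (hh : NotRootOfUnity h)
include hh

/-- The interpolation identity for an even row whose entries are positive. -/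
theorem even_interpolation {κ : Type*} [DecidableEq κ] (J : Finset ℕ) (R : Finset κ)
    (ρ : κ → ℂ) (x : ℕ → ℚ) (hcard : R.card + 1 = 2 * J.card)
    (hint : ∀ j ∈ J, ∃ n : ℤ, 2 * x j = n) (hpos : ∀ j ∈ J, 0 < x j)
    (hgap : ∀ i ∈ J, ∀ j ∈ J, i ≠ j → x i + 1 ≤ x j ∨ x j + 1 ≤ x i)
    (hdup : ∀ i ∈ J, ∀ j ∈ J, x i + 1 = x j → ∃ k ∈ R, ∃ l ∈ R, k ≠ l ∧
      ρ k = qCosh h (2 * x j - 1) ∧ ρ l = qCosh h (2 * x j - 1)) :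
    ∑ j ∈ J, ((∏ k ∈ R, (ρ k - qCosh h (2 * x j + 1))) /
        ((qCosh h (2 * x j - 1) - qCosh h (2 * x j + 1)) *
          ∏ r ∈ J.erase j, (qCosh h (2 * x r + 1) - qCosh h (2 * x j + 1)) *
            (qCosh h (2 * x r - 1) - qCosh h (2 * x j + 1))) +
      (∏ k ∈ R, (ρ k - qCosh h (2 * x j - 1))) /
        ((qCosh h (2 * x j + 1) - qCosh h (2 * x j - 1)) *
          ∏ r ∈ J.erase j, (qCosh h (2 * x r + 1) - qCosh h (2 * x j - 1)) *
            (qCosh h (2 * x r - 1) - qCosh h (2 * x j - 1)))) = 1 := by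
  have hi : ∀ j ∈ J, ∃ n : ℤ, 2 * x j + 1 = n := fun j hj => by
    simpa using int_two_mul_add (hint j hj) 1
  have hi' : ∀ j ∈ J, ∃ n : ℤ, 2 * x j - 1 = n := fun j hj => by
    simpa [sub_eq_add_neg] using int_two_mul_add (hint j hj) (-1)
  -- The families are the raising nodes c(2x + 1) and the lowering nodes c(2x - 1), negated to turn
  -- node minus root into root minus node. Positivity and the gaps exclude collisions inside a
  -- family; across the families only x_i + 1 = x_j remains.
  have key := sum_prod_sub_div_two J J R (fun j => -qCosh h (2 * x j + 1))
    (fun j => -qCosh h (2 * x j - 1)) (fun k => -ρ k) (by omega) (by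
      intro i hI j hJ hij
      by_contra hne
      have p1 := hpos i hI
      have p2 := hpos j hJ
      rcases hgap i hI j hJ hne with g | g <;>
      rcases hh.qCosh_inj (hi i hI) (hi j hJ) (neg_injective hij) with e | e <;> linarith) (by
      intro i hI j hJ hij
      by_contra hne
      have p1 := hpos i hI
      have p2 := hpos j hJ
      rcases hgap i hI j hJ hne with g | g <;>
      rcases hh.qCosh_inj (hi' i hI) (hi' j hJ) (neg_injective hij) with e | e <;> linarith) (by
      intro i hI j hJ hij
      have p1 := hpos i hI
      have p2 := hpos j hJ
      have e0 := neg_injective hij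
      rcases hh.qCosh_inj (hi i hI) (hi' j hJ) e0 with e | e
      · obtain ⟨k, hk, l, hl, hkl, h1, h2⟩ := hdup i hI j hJ (by linarith)
        exact ⟨k, hk, l, hl, hkl, by rw [h1, e], by rw [h2, e]⟩
      · linarith)
  rw [← key, ← Finset.sum_add_distrib]
  refine Finset.sum_congr rfl fun j hj => ?_
  rw [← Finset.mul_prod_erase J (fun t => -qCosh h (2 * x j + 1) - -qCosh h (2 * x t - 1)) hj,
    ← Finset.mul_prod_erase J (fun t => -qCosh h (2 * x j - 1) - -qCosh h (2 * x t + 1)) hj]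
  simp only [Finset.prod_mul_distrib, neg_sub_neg]
  congr 2
  · ring
  · ring

/-- The interpolation identity for an even row whose last entry is zero. -/
theorem even_interpolation_zero {κ : Type*} [DecidableEq κ] (J : Finset ℕ) (p : ℕ) (hp : p ∈ J)
    (R : Finset κ) (ρ : κ → ℂ) (x : ℕ → ℚ) (hcard : R.card + 2 = 2 * J.card)
    (hint : ∀ j ∈ J, ∃ n : ℤ, 2 * x j = n) (hp0 : x p = 0) (hpos : ∀ j ∈ J, j ≠ p → 1 ≤ x j)
    (hgap : ∀ i ∈ J, ∀ j ∈ J, i ≠ j → x i + 1 ≤ x j ∨ x j + 1 ≤ x i)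
    (hdup : ∀ i ∈ J, ∀ j ∈ J, x i + 1 = x j → ∃ k ∈ R, ∃ l ∈ R, k ≠ l ∧
      ρ k = qCosh h (2 * x j - 1) ∧ ρ l = qCosh h (2 * x j - 1)) :
    (∏ k ∈ R, (ρ k - qCosh h 1)) / (∏ r ∈ J.erase p, (qCosh h (2 * x r + 1) - qCosh h 1) *
            (qCosh h (2 * x r - 1) - qCosh h 1)) +
    ∑ j ∈ J.erase p, ((∏ k ∈ R, (ρ k - qCosh h (2 * x j + 1))) /
        ((qCosh h (2 * x j - 1) - qCosh h (2 * x j + 1)) * ((qCosh h 1 - qCosh h (2 * x j + 1)) *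
          ∏ r ∈ (J.erase p).erase j, (qCosh h (2 * x r + 1) - qCosh h (2 * x j + 1)) *
            (qCosh h (2 * x r - 1) - qCosh h (2 * x j + 1)))) +
      (∏ k ∈ R, (ρ k - qCosh h (2 * x j - 1))) /
        ((qCosh h (2 * x j + 1) - qCosh h (2 * x j - 1)) * ((qCosh h 1 - qCosh h (2 * x j - 1)) *
          ∏ r ∈ (J.erase p).erase j, (qCosh h (2 * x r + 1) - qCosh h (2 * x j - 1)) *
            (qCosh h (2 * x r - 1) - qCosh h (2 * x j - 1))))) = 1 := by
  have hi : ∀ j ∈ J, ∃ n : ℤ, 2 * x j + 1 = n := fun j hj => by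
    simpa using int_two_mul_add (hint j hj) 1
  have hi' : ∀ j ∈ J, ∃ n : ℤ, 2 * x j - 1 = n := fun j hj => by
    simpa [sub_eq_add_neg] using int_two_mul_add (hint j hj) (-1)
  have hpos' : ∀ j ∈ J, 0 ≤ x j := fun j hj => by
    rcases eq_or_ne j p with rfl | hne
    · rw [hp0]
    · linarith [hpos j hj hne]
  -- At the zero entry the raising and lowering nodes are both c(1), so one copy is dropped, and
  -- correspondingly there is one root fewer.
  have key := sum_prod_sub_div_two J (J.erase p) R (fun j => -qCosh h (2 * x j + 1))
    (fun j => -qCosh h (2 * x j - 1)) (fun k => -ρ k)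
    (by rw [Finset.card_erase_of_mem hp]; have := Finset.card_pos.2 ⟨p, hp⟩; omega) (by
      intro i hI j hJ hij
      by_contra hne
      have p1 := hpos' i hI
      have p2 := hpos' j hJ
      rcases hgap i hI j hJ hne with g | g <;>
      rcases hh.qCosh_inj (hi i hI) (hi j hJ) (neg_injective hij) with e | e <;> linarith) (by
      intro i hI j hJ hij
      by_contra hne
      obtain ⟨i0, hI⟩ := Finset.mem_erase.1 hI
      obtain ⟨j0, hJ⟩ := Finset.mem_erase.1 hJ
      have p1 := hpos i hI i0
      have p2 := hpos j hJ j0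
      rcases hgap i hI j hJ hne with g | g <;>
      rcases hh.qCosh_inj (hi' i hI) (hi' j hJ) (neg_injective hij) with e | e <;> linarith) (by
      intro i hI j hJ hij
      obtain ⟨j0, hJ⟩ := Finset.mem_erase.1 hJ
      have p1 := hpos' i hI
      have p2 := hpos j hJ j0
      have e0 := neg_injective hij
      rcases hh.qCosh_inj (hi i hI) (hi' j hJ) e0 with e | e
      · obtain ⟨k, hk, l, hl, hkl, h1, h2⟩ := hdup i hI j hJ (by linarith)
        exact ⟨k, hk, l, hl, hkl, by rw [h1, e], by rw [h2, e]⟩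
      · linarith)
  have e0 : 2 * x p + 1 = 1 := by rw [hp0]; norm_num
  rw [← key, ← Finset.add_sum_erase J _ hp, add_assoc, ← Finset.sum_add_distrib]
  simp only [Finset.prod_mul_distrib, neg_sub_neg, e0]
  congr 1
  refine Finset.sum_congr rfl fun j hj => ?_
  obtain ⟨j0, hJ⟩ := Finset.mem_erase.1 hj
  rw [← Finset.mul_prod_erase (J.erase p)
      (fun t => qCosh h (2 * x t - 1) - qCosh h (2 * x j + 1)) hj,
    ← Finset.mul_prod_erase J (fun t => qCosh h (2 * x t + 1) - qCosh h (2 * x j - 1)) hJ,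
    ← Finset.mul_prod_erase (J.erase j)
      (fun t => qCosh h (2 * x t + 1) - qCosh h (2 * x j - 1)) (Finset.mem_erase.2 ⟨j0.symm, hp⟩),
    ← Finset.mul_prod_erase (J.erase j)
      (fun t => qCosh h (2 * x t + 1) - qCosh h (2 * x j + 1)) (Finset.mem_erase.2 ⟨j0.symm, hp⟩),
    e0, Finset.erase_right_comm (a := j)]
  congr 2
  · ring
  · ring

/-- The interpolation identity for an odd row. -/
theorem odd_interpolation {κ : Type*} [DecidableEq κ] (K : Finset ℕ) (R : Finset κ)
    (ρ : κ → ℂ) (y : ℕ → ℚ) (hcard : R.card = 2 * K.card)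
    (hint : ∀ j ∈ K, ∃ n : ℤ, 2 * y j = n) (hpos : ∀ j ∈ K, 1 ≤ y j)
    (hgap : ∀ i ∈ K, ∀ j ∈ K, i ≠ j → y i + 1 ≤ y j ∨ y j + 1 ≤ y i)
    (hdup : ∀ i ∈ K, ∀ j ∈ K, y i + 1 = y j → ∃ k ∈ R, ∃ l ∈ R, k ≠ l ∧
      ρ k = qCosh h (2 * y i) ∧ ρ l = qCosh h (2 * y i))
    (hdup0 : ∀ j ∈ K, y j = 1 → ∃ k ∈ R, ∃ l ∈ R, k ≠ l ∧
      ρ k = qCosh h 0 ∧ ρ l = qCosh h 0) :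
    (∏ k ∈ R, (ρ k - qCosh h 0)) / (∏ r ∈ K, (qCosh h (2 * y r) - qCosh h 0) *
            (qCosh h (2 * y r - 2) - qCosh h 0)) +
    ∑ j ∈ K, ((∏ k ∈ R, (ρ k - qCosh h (2 * y j))) /
        ((qCosh h (2 * y j - 2) - qCosh h (2 * y j)) * ((qCosh h 0 - qCosh h (2 * y j)) *
          ∏ r ∈ K.erase j, (qCosh h (2 * y r) - qCosh h (2 * y j)) *
            (qCosh h (2 * y r - 2) - qCosh h (2 * y j)))) +
      (∏ k ∈ R, (ρ k - qCosh h (2 * y j - 2))) /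
        ((qCosh h (2 * y j) - qCosh h (2 * y j - 2)) * ((qCosh h 0 - qCosh h (2 * y j - 2)) *
          ∏ r ∈ K.erase j, (qCosh h (2 * y r) - qCosh h (2 * y j - 2)) *
            (qCosh h (2 * y r - 2) - qCosh h (2 * y j - 2))))) = 1 := by
  have hi' : ∀ j ∈ K, ∃ n : ℤ, 2 * y j - 2 = n := fun j hj => by
    simpa [sub_eq_add_neg] using int_two_mul_add (hint j hj) (-2)
  -- The element `none` carries the extra node c(0) of the diagonal term. It collides with the
  -- lowering node c(2y - 2) exactly when y = 1.
  have key := sum_prod_sub_div_two (Finset.insertNone K) K R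
    (fun o => o.elim (-qCosh h 0) fun j => -qCosh h (2 * y j))
    (fun j => -qCosh h (2 * y j - 2)) (fun k => -ρ k)
    (by rw [Finset.card_insertNone]; omega) (by
      have h0 : ∀ j ∈ K, qCosh h (2 * y j) ≠ qCosh h 0 := fun j hj e0 => by
        have := hpos j hj
        rcases hh.qCosh_inj (hint j hj) ⟨0, by simp⟩ e0 with e | e <;> linarith
      rintro (_ | i) hI (_ | j) hJ hij
      · rfl
      · exact absurd (neg_injective hij).symm (h0 j (by simpa using hJ))
      · exact absurd (neg_injective hij) (h0 i (by simpa using hI))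
      · replace hI : i ∈ K := by simpa using hI
        replace hJ : j ∈ K := by simpa using hJ
        have p1 := hpos i hI
        have p2 := hpos j hJ
        by_contra hne
        rcases hgap i hI j hJ (fun e => hne (by rw [e])) with g | g <;>
        rcases hh.qCosh_inj (hint i hI) (hint j hJ) (neg_injective hij) with e | e <;> linarith) (by
      intro i hI j hJ hij
      by_contra hne
      have p1 := hpos i hI
      have p2 := hpos j hJ
      rcases hgap i hI j hJ hne with g | g <;>
      rcases hh.qCosh_inj (hi' i hI) (hi' j hJ) (neg_injective hij) with e | e <;> linarith) (by
      rintro (_ | i) hI j hJ hij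
      · have p2 := hpos j hJ
        have : y j = 1 := by
          rcases hh.qCosh_inj ⟨0, by simp⟩ (hi' j hJ) (neg_injective hij) with e | e <;> linarith
        obtain ⟨k, hk, l, hl, hkl, h1, h2⟩ := hdup0 j hJ this
        exact ⟨k, hk, l, hl, hkl, by rw [h1]; rfl, by rw [h2]; rfl⟩
      · replace hI : i ∈ K := by simpa using hI
        have p1 := hpos i hI
        have p2 := hpos j hJ
        rcases hh.qCosh_inj (hint i hI) (hi' j hJ) (neg_injective hij) with e | e
        · obtain ⟨k, hk, l, hl, hkl, h1, h2⟩ := hdup i hI j hJ (by linarith)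
          exact ⟨k, hk, l, hl, hkl, by rw [h1]; rfl, by rw [h2]; rfl⟩
        · linarith)
  have e1 : (Finset.insertNone K).erase none = K.map Function.Embedding.some := by
    ext (_ | i) <;> simp
  have e2 : ∀ j, (Finset.insertNone K).erase (some j) = Finset.insertNone (K.erase j) := by
    intro j; ext (_ | i) <;> simp
  rw [← key, Finset.sum_insertNone, add_assoc, ← Finset.sum_add_distrib]
  simp only [e1, e2, Finset.prod_map, Finset.prod_insertNone, Function.Embedding.some_apply,
    Option.elim, Finset.prod_mul_distrib, neg_sub_neg]
  congr 1
  refine Finset.sum_congr rfl fun j hj => ?_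
  rw [← Finset.mul_prod_erase K (fun t => qCosh h (2 * y t - 2) - qCosh h (2 * y j)) hj,
    ← Finset.mul_prod_erase K (fun t => qCosh h (2 * y t) - qCosh h (2 * y j - 2)) hj]
  congr 2
  · ring
  · ring

end

section
variable {h : ℂ} (hh : NotRootOfUnity h)

theorem qHalf_neg (h : ℂ) (b : ℚ) : qHalf h (-b) = qHalf h b := by
  rw [qHalf_def, qHalf_def, qCosh_neg]

/-- The denominators attached to an even row, in terms of reflected entries. -/
def evenDen (h : ℂ) (J : Finset ℕ) (x : ℕ → ℚ) (j : ℕ) (u : ℚ) : ℂ :=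
  ∏ r ∈ J.erase j, (qCosh h (2 * x r + 1) - qCosh h (2 * u + 1)) *
    (qCosh h (2 * x r - 1) - qCosh h (2 * u + 1))

theorem evenDen_abs (h : ℂ) (J : Finset ℕ) (x : ℕ → ℚ) (j : ℕ) (u : ℚ) :
    evenDen h J (fun r => |x r|) j u = evenDen h J x j u := by
  refine Finset.prod_congr rfl fun r _ => ?_
  rcases abs_choice (x r) with e | e <;> simp only [e]
  rw [show 2 * -x r + 1 = -(2 * x r - 1) by ring, show 2 * -x r - 1 = -(2 * x r + 1) by ring,
    qCosh_neg, qCosh_neg, mul_comm]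

/-- Replacing x by -x merely interchanges the raising and the lowering term, so a negative entry
needs no separate treatment. -/
theorem sum_abs_eq (J : Finset ℕ) (x : ℕ → ℚ) (f : ℕ → ℚ → ℂ) :
    ∑ j ∈ J, (f j (x j) + f j (-x j)) = ∑ j ∈ J, (f j |x j| + f j (-|x j|)) := by
  refine Finset.sum_congr rfl fun j _ => ?_
  rcases abs_choice (x j) with e | e <;> simp only [e]
  rw [neg_neg, add_comm]

theorem exists_two_mul_abs {x : ℚ} (hx : ∃ n : ℤ, 2 * x = n) : ∃ n : ℤ, 2 * |x| = n := by
  obtain ⟨n, hn⟩ := hx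
  rcases abs_choice x with e | e <;> rw [e]
  · exact ⟨n, hn⟩
  · exact ⟨-n, by push_cast; rw [← hn]; ring⟩

theorem exists_two_mul_neg {x : ℚ} (hx : ∃ n : ℤ, 2 * x = n) : ∃ n : ℤ, 2 * -x = n := by
  obtain ⟨n, hn⟩ := hx
  exact ⟨-n, by push_cast; rw [← hn]; ring⟩

include hh

/-- The bracket [2u + 2] together with the two `qHalf` factors supplies an extra root c(1) and the
denominator between the two nodes of the same entry. -/
theorem qNum_qHalf_ratio {u : ℚ} (hu : ∃ n : ℤ, 2 * u = n) (hu0 : u ≠ 0) :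
    qNum h (2 * u + 2) * (qHalf h u * qHalf h (u + 1)) =
      (qCosh h 1 - qCosh h (2 * u + 1)) / (qCosh h (2 * u - 1) - qCosh h (2 * u + 1)) := by
  have n1 := hh.qCosh_ne hu
  have n2 : qCosh h (u + 1) ≠ 0 := hh.qCosh_ne (by
    obtain ⟨n, hn⟩ := hu; exact ⟨n + 2, by push_cast; rw [← hn]; ring⟩)
  have n3 := hh.qNum_ne hu hu0
  have n4 := hh.qDen_ne
  have e1 : qCosh h 1 - qCosh h (2 * u + 1) = -(qDen h * (qNum h (u + 1) * qNum h u)) := by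
    rw [qNum_mul_eq (u := 2 * u + 1) (v := 1) (by ring) (by ring)]; field_simp; ring
  have e2 : qCosh h (2 * u - 1) - qCosh h (2 * u + 1) = -(qDen h * (qNum h u * qCosh h u)) := by
    rw [← qNum_two_mul, ← mul_one (qNum h (2 * u)), ← hh.qNum_one, qNum_mul_qNum]
    field_simp; ring
  rw [e1, e2, show 2 * u + 2 = 2 * (u + 1) by ring, qNum_two_mul, qHalf_def, qHalf_def]
  field_simp

/-- The analogue for the diagonal term: the denominator between the two nodes appears, with no extra
root. -/
theorem qCosh_qHalf_ratio {u : ℚ} (hu : ∃ n : ℤ, 2 * u = n) (hu0 : u ≠ 0) :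
    -qCosh h (u + 1) * (qHalf h u * qHalf h (u + 1)) =
      qNum h u * qDen h / (qCosh h (2 * u - 1) - qCosh h (2 * u + 1)) := by
  have n1 := hh.qCosh_ne hu
  have n2 : qCosh h (u + 1) ≠ 0 := hh.qCosh_ne (by
    obtain ⟨n, hn⟩ := hu; exact ⟨n + 2, by push_cast; rw [← hn]; ring⟩)
  have n3 := hh.qNum_ne hu hu0
  have n4 := hh.qDen_ne
  have e2 : qCosh h (2 * u - 1) - qCosh h (2 * u + 1) = -(qDen h * (qNum h u * qCosh h u)) := by
    rw [← qNum_two_mul, ← mul_one (qNum h (2 * u)), ← hh.qNum_one, qNum_mul_qNum]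
    field_simp; ring
  rw [e2, qHalf_def, qHalf_def]
  field_simp

/-- The form of interpolation used when no entry vanishes: `f` is any expression for the individual
terms, so that both the move case and the diagonal case can use it. A negative entry is replaced by
its absolute value. -/
theorem even_sum_pos {κ : Type*} [DecidableEq κ] (J : Finset ℕ) (R : Finset κ)
    (ρ : κ → ℂ) (x : ℕ → ℚ) (hcard : R.card + 1 = 2 * J.card)
    (hint : ∀ j ∈ J, ∃ n : ℤ, 2 * x j = n) (hne : ∀ j ∈ J, x j ≠ 0)
    (hgap : ∀ i ∈ J, ∀ j ∈ J, i ≠ j → |x i| + 1 ≤ x j ∨ |x j| + 1 ≤ x i)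
    (hdup : ∀ i ∈ J, ∀ j ∈ J, |x i| + 1 = x j → ∃ k ∈ R, ∃ l ∈ R, k ≠ l ∧
      ρ k = qCosh h (2 * x j - 1) ∧ ρ l = qCosh h (2 * x j - 1))
    (f : ℕ → ℚ → ℂ) (hf : ∀ j ∈ J, ∀ u : ℚ, (∃ n : ℤ, 2 * u = n) → u ≠ 0 →
      f j u = (∏ k ∈ R, (ρ k - qCosh h (2 * u + 1))) /
        ((qCosh h (2 * u - 1) - qCosh h (2 * u + 1)) * evenDen h J x j u)) :
    ∑ j ∈ J, (f j (x j) + f j (-x j)) = 1 := by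
  rw [sum_abs_eq]
  have key := even_interpolation hh J R ρ (fun j => |x j|) hcard
    (fun j hj => exists_two_mul_abs (hint j hj)) (fun j hj => abs_pos.2 (hne j hj))
    (fun i hi j hj hij => (hgap i hi j hj hij).imp (fun g => g.trans (le_abs_self _))
      (fun g => g.trans (le_abs_self _))) (by
      intro i hi j hj hij
      have hij' : i ≠ j := by rintro rfl; linarith
      have : 0 ≤ x j := by
        have := abs_nonneg (x i)
        rcases hgap i hi j hj hij' with g | g
        · linarith
        · have := le_abs_self (x i); linarith
      rw [abs_of_nonneg this] at hij ⊢
      exact hdup i hi j hj hij)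
  rw [← key]
  refine Finset.sum_congr rfl fun j hj => ?_
  have i1 := exists_two_mul_abs (hint j hj)
  have i0 := abs_ne_zero.2 (hne j hj)
  rw [hf j hj _ i1 i0, hf j hj _ (exists_two_mul_neg i1) (neg_ne_zero.2 i0),
    ← evenDen_abs h J x j |x j|, ← evenDen_abs h J x j (-|x j|)]
  simp only [evenDen]
  rw [show 2 * -|x j| + 1 = -(2 * |x j| - 1) by ring,
    show 2 * -|x j| - 1 = -(2 * |x j| + 1) by ring, qCosh_neg, qCosh_neg]

/-- The sum over the moves in an even row, between two odd rows one of which is shifted. -/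
theorem even_sum_move {κ : Type*} [DecidableEq κ] (J : Finset ℕ) (R : Finset κ)
    (ρ : κ → ℂ) (x : ℕ → ℚ) (hcard : R.card + 2 = 2 * J.card)
    (hint : ∀ j ∈ J, ∃ n : ℤ, 2 * x j = n)
    (hgap : ∀ i ∈ J, ∀ j ∈ J, i ≠ j → |x i| + 1 ≤ x j ∨ |x j| + 1 ≤ x i)
    (hdup : ∀ i ∈ J, ∀ j ∈ J, |x i| + 1 = x j → ∃ k ∈ R, ∃ l ∈ R, k ≠ l ∧
      ρ k = qCosh h (2 * x j - 1) ∧ ρ l = qCosh h (2 * x j - 1)) :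
    ∑ j ∈ J, (qNum h (2 * x j + 2) * (qHalf h (x j) * qHalf h (x j + 1)) *
        (∏ k ∈ R, (ρ k - qCosh h (2 * x j + 1))) / evenDen h J x j (x j) +
      qNum h (2 * -x j + 2) * (qHalf h (-x j) * qHalf h (-x j + 1)) *
        (∏ k ∈ R, (ρ k - qCosh h (2 * -x j + 1))) / evenDen h J x j (-x j)) = 1 := by
  by_cases hne : ∀ j ∈ J, x j ≠ 0
  · refine even_sum_pos hh J (Finset.insertNone R) (fun o => o.elim (qCosh h 1) ρ) x
      (by rw [Finset.card_insertNone]; omega) hint hne hgap (by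
        intro i hi j hj hij
        obtain ⟨k, hk, l, hl, hkl, h1, h2⟩ := hdup i hi j hj hij
        exact ⟨some k, by simpa using hk, some l, by simpa using hl, by simpa using hkl, h1, h2⟩)
      (fun j u => qNum h (2 * u + 2) * (qHalf h u * qHalf h (u + 1)) *
        (∏ k ∈ R, (ρ k - qCosh h (2 * u + 1))) / evenDen h J x j u) ?_
    intro j hj u hu hu0
    simp only [Finset.prod_insertNone, Option.elim]
    rw [qNum_qHalf_ratio hh hu hu0, div_mul_eq_mul_div, div_div]
  · push Not at hne
    obtain ⟨p, hp, hp0⟩ := hne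
    have hpos : ∀ j ∈ J, j ≠ p → 1 ≤ |x j| := by
      intro j hj hjp
      rcases hgap j hj p hp hjp with g | g
      · have := abs_nonneg (x j); linarith
      · rw [hp0, abs_zero] at g; exact (by linarith : 1 ≤ x j).trans (le_abs_self _)
    rw [sum_abs_eq J x fun j u => qNum h (2 * u + 2) * (qHalf h u * qHalf h (u + 1)) *
        (∏ k ∈ R, (ρ k - qCosh h (2 * u + 1))) / evenDen h J x j u]
    have key := even_interpolation_zero hh J p hp R ρ (fun j => |x j|) hcard
      (fun j hj => exists_two_mul_abs (hint j hj)) (by simp [hp0]) hpos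
      (fun i hi j hj hij => (hgap i hi j hj hij).imp (fun g => g.trans (le_abs_self _))
        (fun g => g.trans (le_abs_self _))) (by
        intro i hi j hj hij
        have hij' : i ≠ j := by rintro rfl; linarith
        have : 0 ≤ x j := by
          have := abs_nonneg (x i)
          rcases hgap i hi j hj hij' with g | g
          · linarith
          · have := le_abs_self (x i); linarith
        rw [abs_of_nonneg this] at hij ⊢
        exact hdup i hi j hj hij)
    rw [← key, ← Finset.add_sum_erase J _ hp]
    congr 1
    · rw [← evenDen_abs h J x p |x p|, ← evenDen_abs h J x p (-|x p|), hp0]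
      simp only [evenDen, abs_zero, neg_zero, mul_zero, zero_add]
      -- At the zero entry the raising and lowering terms coincide, each with weight [2] / (c(0)
      -- c(1)) = 1/2; together they give the single remaining node.
      have h2 : qNum h 2 * (qHalf h 0 * qHalf h 1) = 1 / 2 := by
        rw [show (2 : ℚ) = 2 * 1 by norm_num, qNum_two_mul, hh.qNum_one, qHalf_def, qHalf_def]
        have := hh.qCosh_ne (b := 1) ⟨2, by norm_num⟩
        have h0 : qCosh h 0 = 2 := by simp [qCosh]; norm_num
        rw [h0]; field_simp
      rw [h2, mul_div_assoc, ← add_mul]; norm_num [hp0]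
    · refine Finset.sum_congr rfl fun j hj => ?_
      obtain ⟨hjp, hj'⟩ := Finset.mem_erase.1 hj
      have hp' : p ∈ J.erase j := Finset.mem_erase.2 ⟨hjp.symm, hp⟩
      have i1 := exists_two_mul_abs (hint j hj')
      have i0 : |x j| ≠ 0 := by have := hpos j hj' hjp; intro h0; linarith
      -- The zero entry contributes its node c(1) twice to the denominator; the extra root c(1) of
      -- `qNum_qHalf_ratio` cancels one copy.
      have c1 : ∀ u, evenDen h J x j u = (qCosh h 1 - qCosh h (2 * u + 1)) *
          (qCosh h 1 - qCosh h (2 * u + 1)) * ∏ r ∈ (J.erase p).erase j,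
            (qCosh h (2 * |x r| + 1) - qCosh h (2 * u + 1)) *
            (qCosh h (2 * |x r| - 1) - qCosh h (2 * u + 1)) := by
        intro u
        rw [← evenDen_abs, evenDen, ← Finset.mul_prod_erase _ _ hp', hp0, Finset.erase_right_comm,
          abs_zero, mul_zero, zero_add, zero_sub, qCosh_neg]
      have c2 : ∀ u : ℚ, (∃ n : ℤ, 2 * u = n) → u ≠ 0 →
          qNum h (2 * u + 2) * (qHalf h u * qHalf h (u + 1)) *
          (∏ k ∈ R, (ρ k - qCosh h (2 * u + 1))) / evenDen h J x j u =
          (∏ k ∈ R, (ρ k - qCosh h (2 * u + 1))) /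
          ((qCosh h (2 * u - 1) - qCosh h (2 * u + 1)) * ((qCosh h 1 - qCosh h (2 * u + 1)) *
          ∏ r ∈ (J.erase p).erase j, (qCosh h (2 * |x r| + 1) - qCosh h (2 * u + 1)) *
            (qCosh h (2 * |x r| - 1) - qCosh h (2 * u + 1)))) := by
        intro u hu hu0
        rw [qNum_qHalf_ratio hh hu hu0, c1]
        by_cases hz : qCosh h 1 - qCosh h (2 * u + 1) = 0
        · simp [hz]
        · rw [div_mul_eq_mul_div, div_div, mul_assoc (qCosh h 1 - _), mul_left_comm,
            mul_div_mul_left _ _ hz]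
      rw [c2 _ i1 i0, c2 _ (exists_two_mul_neg i1) (neg_ne_zero.2 i0),
        show 2 * -|x j| + 1 = -(2 * |x j| - 1) by ring,
        show 2 * -|x j| - 1 = -(2 * |x j| + 1) by ring, qCosh_neg, qCosh_neg]

end

/-! ## Interlacing -/

/-- The even row `x` of length `p` and the odd row `y` of length `r` interlace; `e = 1` if `y` is
above `x`, and `e = 0` if it is below. -/
def Interlaced (e p r : ℕ) (x y : ℕ → ℚ) : Prop :=
  ∀ j k, 1 ≤ j → j ≤ p → 1 ≤ k → k ≤ r → (k < j + e → |x j| + 1 ≤ y k) ∧ (j + e ≤ k → y k ≤ x j)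

/-- Four consecutive rows, in one order or the other: `x`, `y` in the middle, `w` next to `x` and
`z` next to `y`. -/
structure GTRows (e p r : ℕ) (w z x y : ℕ → ℚ) : Prop where
  he : e ≤ 1
  hp : 1 ≤ p
  hr : r + 1 = p + e
  xy : Interlaced e p r x y
  xw : Interlaced (1 - e) p (p - e) x w
  zy : Interlaced (1 - e) (r + e) r z y
  int : ∃ c : ℚ, (∃ n : ℤ, 2 * c = n) ∧ (∀ j, 1 ≤ j → j ≤ p → ∃ n : ℤ, x j = c + n) ∧
    (∀ k, 1 ≤ k → k ≤ r → ∃ n : ℤ, y k = c + n) ∧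
    (∀ k, 1 ≤ k → k ≤ p - e → ∃ n : ℤ, w k = c + n) ∧
    (∀ j, 1 ≤ j → j ≤ r + e → ∃ n : ℤ, z j = c + n)

namespace GTRows
variable {e p r : ℕ} {w z x y : ℕ → ℚ} (G : GTRows e p r w z x y)
include G

/-- Entries of an even row, possibly in two different patterns, are separated by the row `w`. -/
theorem x_gap {x' y' : ℕ → ℚ} (G' : GTRows e p r w z x' y') {j i : ℕ} (hj : 1 ≤ j) (hji : j < i)
    (hi : i ≤ p) : |x' i| + 1 ≤ x j := by
  have := G.he
  have h1 := (G.xw j (j + (1 - e)) hj (by omega) (by omega) (by omega)).2 le_rfl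
  have h2 := (G'.xw i (j + (1 - e)) (by omega) hi (by omega) (by omega)).1 (by omega)
  linarith

theorem y_gap {x' y' : ℕ → ℚ} (G' : GTRows e p r w z x' y') {k i : ℕ} (hk : 1 ≤ k) (hki : k < i)
    (hi : i ≤ r) : y' i + 1 ≤ y k := by
  have := G.he
  have h1 := (G.zy (k + e) k (by omega) (by omega) hk (by omega)).1 (by omega)
  have h2 := (G'.zy (k + e) i (by omega) (by omega) (by omega) hi).2 (by omega)
  have := le_abs_self (z (k + e))
  linarith

theorem one_le_y {k : ℕ} (hk : 1 ≤ k) (hkr : k ≤ r) : 1 ≤ y k := by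
  have := G.he
  have h1 := (G.zy (k + e) k (by omega) (by omega) hk (by omega)).1 (by omega)
  have := abs_nonneg (z (k + e))
  linarith

theorem one_le_w {k : ℕ} (hk : 1 ≤ k) (hkr : k ≤ p - e) : 1 ≤ w k := by
  have := G.he
  have h1 := (G.xw (k + e) k (by omega) (by omega) hk (by omega)).1 (by omega)
  have := abs_nonneg (x (k + e))
  linarith

theorem two_x_int {j : ℕ} (hj : 1 ≤ j) (hjp : j ≤ p) : ∃ n : ℤ, 2 * x j = n := by
  obtain ⟨c, ⟨m, hm⟩, h1, -⟩ := G.int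
  obtain ⟨n, hn⟩ := h1 j hj hjp
  exact ⟨m + 2 * n, by push_cast; rw [hn, ← hm]; ring⟩

theorem two_y_int {j : ℕ} (hj : 1 ≤ j) (hjp : j ≤ r) : ∃ n : ℤ, 2 * y j = n := by
  obtain ⟨c, ⟨m, hm⟩, -, h1, -⟩ := G.int
  obtain ⟨n, hn⟩ := h1 j hj hjp
  exact ⟨m + 2 * n, by push_cast; rw [hn, ← hm]; ring⟩

end GTRows

/-! ### Signs and squares of the factors -/

/-- The sign of `y k - x j` for interlacing rows. -/
def interSign (e j k : ℕ) : ℂ := if k < j + e then 1 else -1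

theorem prod_interSign_right (e j r : ℕ) (hj : 1 ≤ j + e) :
    ∏ k ∈ Finset.Icc 1 r, interSign e j k = (-1) ^ (r + 1 - (j + e)) := by
  induction r with
  | zero => simp [show 1 - (j + e) = 0 by omega]
  | succ r ih =>
    rw [Finset.prod_Icc_succ_top (by omega), ih, interSign]
    split_ifs with hlt
    · rw [show r + 1 - (j + e) = 0 by omega, show r + 1 + 1 - (j + e) = 0 by omega]; simp
    · rw [show r + 1 + 1 - (j + e) = (r + 1 - (j + e)) + 1 by omega, pow_succ]

theorem prod_interSign_left (e k p : ℕ) (hk : k ≤ p + e) :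
    ∏ j ∈ Finset.Icc 1 p, interSign e j k = (-1) ^ (k - e) := by
  have : ∀ q, ∏ j ∈ Finset.Icc 1 q, interSign e j k = (-1) ^ (min q (k - e)) := by
    intro q
    induction q with
    | zero => simp
    | succ q ih =>
      rw [Finset.prod_Icc_succ_top (by omega), ih, interSign]
      split_ifs with hlt
      · rw [show min (q + 1) (k - e) = min q (k - e) by omega, mul_one]
      · rw [show min (q + 1) (k - e) = min q (k - e) + 1 by omega, pow_succ]
  rw [this, show min p (k - e) = k - e by omega]

/-- The two exponents of -1, one from each neighbouring row, add up to 2(p - j). -/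
theorem GTRows.prod_sign_even {e p r : ℕ} {w z x y : ℕ → ℚ} (G : GTRows e p r w z x y) {j : ℕ}
    (hj : 1 ≤ j) (hjp : j ≤ p) : (∏ k ∈ Finset.Icc 1 r, interSign e j k) *
      ∏ k ∈ Finset.Icc 1 (p - e), interSign (1 - e) j k = 1 := by
  have := G.he
  have := G.hr
  rw [prod_interSign_right _ _ _ (by omega), prod_interSign_right _ _ _ (by omega), ← pow_add,
    show r + 1 - (j + e) + (p - e + 1 - (j + (1 - e))) = 2 * (p - j) by omega, pow_mul]
  simp

/-- The two exponents add up to the odd number 2(k - 1) + 1. The resulting -1 compensates the minus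
sign in `bracket_odd`. -/
theorem GTRows.prod_sign_odd {e p r : ℕ} {w z x y : ℕ → ℚ} (G : GTRows e p r w z x y) {k : ℕ}
    (hk : 1 ≤ k) (hkr : k ≤ r) : (∏ j ∈ Finset.Icc 1 p, interSign e j k) *
      ∏ j ∈ Finset.Icc 1 (r + e), interSign (1 - e) j k = -1 := by
  have := G.he
  have := G.hr
  rw [prod_interSign_left _ _ _ (by omega), prod_interSign_left _ _ _ (by omega), ← pow_add,
    show k - e + (k - (1 - e)) = 2 * (k - 1) + 1 by omega, pow_succ, pow_mul]
  simp

section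
variable {h : ℂ} {s : ℚ → ℂ} (hs : IsEvenRoot h s) (hh : NotRootOfUnity h)
include hs

theorem IsEvenRoot.sq_mul_of_nonneg {a b : ℚ} (hab : (0 ≤ a ∧ 0 ≤ b) ∨ (a ≤ 0 ∧ b ≤ 0)) :
    (s a * s b) ^ 2 = qNum h a * qNum h b := by
  rw [mul_pow]
  rcases hab with ⟨ha, hb⟩ | ⟨ha, hb⟩
  · rw [hs.sq _ ha, hs.sq _ hb]
  · rw [hs.sq_nonpos ha, hs.sq_nonpos hb]; ring

theorem IsEvenRoot.sq_mul_of_nonpos {a b : ℚ} (hab : (0 ≤ a ∧ b ≤ 0) ∨ (a ≤ 0 ∧ 0 ≤ b)) :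
    (s a * s b) ^ 2 = -(qNum h a * qNum h b) := by
  rw [mul_pow]
  rcases hab with ⟨ha, hb⟩ | ⟨ha, hb⟩
  · rw [hs.sq _ ha, hs.sq_nonpos hb]; ring
  · rw [hs.sq_nonpos ha, hs.sq _ hb]; ring

/-- The arguments y + u and y - u - 1 have the same sign if y exceeds |x| and opposite signs if y ≤
x; their product is a difference of two values of `qCosh`, one a root and the other a node. -/
theorem phi_sq {x y u : ℚ} {σ : ℂ} (hxy : (|x| + 1 ≤ y ∧ σ = 1) ∨ (y ≤ x ∧ 1 ≤ y ∧ σ = -1))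
    (hu : u = x ∨ u = -x) :
    phi s y u ^ 2 = σ * ((qCosh h (2 * y - 1) - qCosh h (2 * u + 1)) / qDen h) := by
  rw [phi, ← qNum_mul_eq (a := y + u) (b := y - u - 1) (by ring) (by ring)]
  rcases hxy with ⟨h1, rfl⟩ | ⟨h1, h2, rfl⟩
  · have := abs_le.1 (le_sub_iff_add_le.2 h1)
    rw [hs.sq_mul_of_nonneg, one_mul]
    left; rcases hu with rfl | rfl <;> constructor <;> linarith
  · rw [hs.sq_mul_of_nonpos, neg_one_mul]
    rcases hu with rfl | rfl
    · left; constructor <;> linarith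
    · right; constructor <;> linarith

theorem psi_sq {x y v : ℚ} {σ : ℂ} (hxy : (|x| + 1 ≤ y ∧ σ = 1) ∨ (y ≤ x ∧ 1 ≤ y ∧ σ = -1))
    (hv : v = y ∨ v = 1 - y) :
    psi s x v ^ 2 = -(σ * ((qCosh h (2 * x) - qCosh h (2 * v)) / qDen h)) := by
  rw [psi, ← qNum_mul_eq (a := x + v) (b := x - v) (by ring) (by ring)]
  rcases hxy with ⟨h1, rfl⟩ | ⟨h1, h2, rfl⟩
  · have := abs_le.1 (le_sub_iff_add_le.2 h1)
    rw [hs.sq_mul_of_nonpos, one_mul]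
    rcases hv with rfl | rfl
    · left; constructor <;> linarith
    · right; constructor <;> linarith
  · rw [hs.sq_mul_of_nonneg, neg_one_mul, neg_neg]
    left; rcases hv with rfl | rfl <;> constructor <;> linarith

/-- No sign arises: x' + u and x' + u + 1 have a common sign, and so do x' - u and x' - u - 1.
Pairing the factors the other way produces the differences of nodes. -/
theorem chiEven_sq {x x' u : ℚ} (hx : |x| + 1 ≤ x' ∨ |x'| + 1 ≤ x) (hu : u = x ∨ u = -x) :
    chiEven s x' u ^ 2 = (qCosh h (2 * x' + 1) - qCosh h (2 * u + 1)) / qDen h *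
      ((qCosh h (2 * x' - 1) - qCosh h (2 * u + 1)) / qDen h) := by
  rw [← qNum_mul_eq (a := x' + u + 1) (b := x' - u) (by ring) (by ring),
    ← qNum_mul_eq (a := x' + u) (b := x' - u - 1) (by ring) (by ring), chiEven]
  have e1 : (s (x' + u) * s (x' + u + 1)) ^ 2 = qNum h (x' + u) * qNum h (x' + u + 1) := by
    refine hs.sq_mul_of_nonneg ?_
    rcases hx with hx | hx
    · have := abs_le.1 (le_sub_iff_add_le.2 hx)
      left; rcases hu with rfl | rfl <;> constructor <;> linarith
    · have := abs_le.1 (le_sub_iff_add_le.2 hx)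
      rcases hu with rfl | rfl
      · left; constructor <;> linarith
      · right; constructor <;> linarith
  have e2 : (s (x' - u) * s (x' - u - 1)) ^ 2 = qNum h (x' - u) * qNum h (x' - u - 1) := by
    refine hs.sq_mul_of_nonneg ?_
    rcases hx with hx | hx
    · have := abs_le.1 (le_sub_iff_add_le.2 hx)
      left; rcases hu with rfl | rfl <;> constructor <;> linarith
    · have := abs_le.1 (le_sub_iff_add_le.2 hx)
      rcases hu with rfl | rfl
      · right; constructor <;> linarith
      · left; constructor <;> linarith
  calc _ = (s (x' + u) * s (x' + u + 1)) ^ 2 * (s (x' - u) * s (x' - u - 1)) ^ 2 := by ring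
    _ = _ := by rw [e1, e2]; ring

theorem chiOdd_sq {y y' v : ℚ} (h1 : 1 ≤ y) (h1' : 1 ≤ y') (hy : y + 1 ≤ y' ∨ y' + 1 ≤ y)
    (hv : v = y ∨ v = 1 - y) :
    chiOdd s y' v ^ 2 = (qCosh h (2 * y') - qCosh h (2 * v)) / qDen h *
      ((qCosh h (2 * y' - 2) - qCosh h (2 * v)) / qDen h) := by
  rw [← qNum_mul_eq (a := y' + v) (b := y' - v) (by ring) (by ring),
    ← qNum_mul_eq (a := y' + v - 1) (b := y' - v - 1) (by ring) (by ring), chiOdd]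
  have e1 : (s (y' + v) * s (y' + v - 1)) ^ 2 = qNum h (y' + v) * qNum h (y' + v - 1) := by
    refine hs.sq_mul_of_nonneg ?_
    rcases hv with rfl | rfl
    · left; constructor <;> linarith
    · rcases hy with hy | hy
      · left; constructor <;> linarith
      · right; constructor <;> linarith
  have e2 : (s (y' - v) * s (y' - v - 1)) ^ 2 = qNum h (y' - v) * qNum h (y' - v - 1) := by
    refine hs.sq_mul_of_nonneg ?_
    rcases hv with rfl | rfl
    · rcases hy with hy | hy
      · left; constructor <;> linarith
      · right; constructor <;> linarith
    · left; constructor <;> linarith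
  calc _ = (s (y' + v) * s (y' + v - 1)) ^ 2 * (s (y' - v) * s (y' - v - 1)) ^ 2 := by ring
    _ = _ := by rw [e1, e2]; ring

include hh

/-- What is left of the three positions of the odd move along an even-row return path. Eliminating
[2] by the recurrence reduces it to one exchange identity. That the entry stays on the same side of
x after its move gives all three squares the same sign. -/
theorem bracket_even {x y δ ε : ℚ} {σ : ℂ} (hδ : δ = 1 ∨ δ = -1) (hε : ε = 1 ∨ ε = -1)
    (hxy : (|x| + 1 ≤ y ∧ |x| + 1 ≤ y + δ ∧ σ = 1) ∨
      (y ≤ x ∧ y + δ ≤ x ∧ 1 ≤ y ∧ 1 ≤ y + δ ∧ σ = -1)) :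
    (s (δ * y + (δ ^ 2 - δ) / 2 + ε * x + 1) * s (δ * y + (δ ^ 2 - δ) / 2 - ε * x)) ^ 2 -
      qTwo h *
        (s (δ * y + (δ ^ 2 - δ) / 2 + ε * x + 1) * s (δ * y + (δ ^ 2 - δ) / 2 - ε * x - 1)) ^ 2 +
      (s (δ * y + (δ ^ 2 - δ) / 2 + ε * x) * s (δ * y + (δ ^ 2 - δ) / 2 - ε * x - 1)) ^ 2 =
      σ * qNum h (2 * (ε * x) + 2) := by
  set u := ε * x with hu
  set v := δ * y + (δ ^ 2 - δ) / 2 with hv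
  have i1 := hh.qTwo_mul (v - u - 1)
  have i2 := hh.qNum_exchange (v + u) (v - u - 1)
  rw [sub_add_cancel] at i1
  rw [show v + u - (v - u - 1) + 1 = 2 * u + 2 by ring] at i2
  rcases hxy with ⟨h1, h2, rfl⟩ | ⟨h1, h2, h3, h4, rfl⟩
  · have a1 := abs_le.1 (le_sub_iff_add_le.2 h1)
    have a2 := abs_le.1 (le_sub_iff_add_le.2 h2)
    rw [hs.sq_mul_of_nonneg, hs.sq_mul_of_nonneg, hs.sq_mul_of_nonneg]
    · linear_combination i2 - qNum h (v + u + 1) * i1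
    all_goals
      rcases hδ with rfl | rfl <;> rcases hε with rfl | rfl <;> rw [hu, hv]
      · left; constructor <;> linarith
      · left; constructor <;> linarith
      · right; constructor <;> linarith
      · right; constructor <;> linarith
  · rw [hs.sq_mul_of_nonpos, hs.sq_mul_of_nonpos, hs.sq_mul_of_nonpos]
    · linear_combination -i2 + qNum h (v + u + 1) * i1
    all_goals
      rcases hδ with rfl | rfl <;> rcases hε with rfl | rfl <;> rw [hu, hv]
      · left; constructor <;> linarith
      · right; constructor <;> linarith
      · left; constructor <;> linarith
      · right; constructor <;> linarith

theorem bracket_odd {x y δ ε : ℚ} {σ : ℂ} (hδ : δ = 1 ∨ δ = -1) (hε : ε = 1 ∨ ε = -1)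
    (hxy : (|x| + 1 ≤ y ∧ |x + ε| + 1 ≤ y ∧ σ = 1) ∨
      (y ≤ x ∧ y ≤ x + ε ∧ 1 ≤ y ∧ σ = -1)) :
    (s (δ * y + (δ ^ 2 - δ) / 2 + ε * x + 1) * s (δ * y + (δ ^ 2 - δ) / 2 - ε * x - 1)) ^ 2 -
      qTwo h *
        (s (δ * y + (δ ^ 2 - δ) / 2 + ε * x + 1) * s (δ * y + (δ ^ 2 - δ) / 2 - ε * x)) ^ 2 +
      (s (δ * y + (δ ^ 2 - δ) / 2 + ε * x) * s (δ * y + (δ ^ 2 - δ) / 2 - ε * x)) ^ 2 =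
      -(σ * qNum h (2 * (δ * y + (δ ^ 2 - δ) / 2) + 1)) := by
  set u := ε * x with hu
  set v := δ * y + (δ ^ 2 - δ) / 2 with hv
  have i1 := hh.qTwo_mul (v - u)
  have i2 := hh.qNum_mul_qNum_sub (v + u) (v - u)
  rw [show v + u + (v - u) + 1 = 2 * v + 1 by ring] at i2
  rcases hxy with ⟨h1, h2, rfl⟩ | ⟨h1, h2, h3, rfl⟩
  · have a1 := abs_le.1 (le_sub_iff_add_le.2 h1)
    have a2 := abs_le.1 (le_sub_iff_add_le.2 h2)
    rw [hs.sq_mul_of_nonneg, hs.sq_mul_of_nonneg, hs.sq_mul_of_nonneg]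
    · linear_combination i2 - qNum h (v + u + 1) * i1
    all_goals
      rcases hδ with rfl | rfl <;> rcases hε with rfl | rfl <;> rw [hu, hv]
      · left; constructor <;> linarith
      · left; constructor <;> linarith
      · right; constructor <;> linarith
      · right; constructor <;> linarith
  · rw [hs.sq_mul_of_nonpos, hs.sq_mul_of_nonpos, hs.sq_mul_of_nonpos]
    · linear_combination -i2 + qNum h (v + u + 1) * i1
    all_goals
      rcases hδ with rfl | rfl <;> rcases hε with rfl | rfl <;> rw [hu, hv]
      · left; constructor <;> linarith
      · right; constructor <;> linarith
      · left; constructor <;> linarith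
      · right; constructor <;> linarith

omit hh

omit hs in
-- The return move has reflected entry -u - 1, and u ↦ -u - 1 preserves every factor by permutation
-- alone; only the explicit sign of the move changes. Thus return paths involve squares of
-- coefficients.
theorem evenCoeff_back (t : ℚ → ℂ) (J W K : Finset ℕ) (w x y : ℕ → ℚ) (a : ℕ × ℚ)
    (ha : IsEvenMove J a) :
    evenCoeff s t J W K w (rowShift x a) y (a.1, -a.2) = -evenCoeff s t J W K w x y a := by
  have e0 : evenBar (rowShift x a) (a.1, -a.2) = -evenBar x a - 1 := by
    rw [evenBar, rowShift_self, evenBar]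
    rcases ha.2 with h' | h' <;> rw [h'] <;> ring
  have e1 : ∀ y u, phi s y (-u - 1) = phi s y u := by
    intro y u
    rw [phi, phi, show y + (-u - 1) = y - u - 1 by ring, show y - (-u - 1) - 1 = y + u by ring,
      mul_comm]
  have e2 : ∀ y u, chiEven s y (-u - 1) = chiEven s y u := by
    intro y u
    rw [chiEven, chiEven, show y + (-u - 1) = y - u - 1 by ring,
      show y - (-u - 1) = y + u + 1 by ring, show y - u - 1 + 1 = y - u by ring,
      show y + u + 1 - 1 = y + u by ring]
    ring
  rw [evenCoeff, evenCoeff, evenCoeffPart, evenCoeffPart, e0]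
  simp only [e1, e2, rowShift_self, add_neg_cancel_right]
  have e3 : ∏ r ∈ J.erase a.1, chiEven s (rowShift x a r) (evenBar x a) =
      ∏ r ∈ J.erase a.1, chiEven s (x r) (evenBar x a) :=
    Finset.prod_congr rfl fun r hr => by rw [rowShift_ne x (Finset.mem_erase.1 hr).1]
  rw [e3]
  push_cast
  ring

theorem oddCoeff_back (K Z J : Finset ℕ) (z x y : ℕ → ℚ) (b : ℕ × ℚ)
    (hb : IsEvenMove K b) :
    oddCoeff h s K Z J z x (rowShift y b) (b.1, -b.2) = -oddCoeff h s K Z J z x y b := by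
  have e0 : oddBar (rowShift y b) (b.1, -b.2) = -oddBar y b := by
    rw [oddBar, rowShift_self, oddBar]
    rcases hb.2 with h' | h' <;> rw [h'] <;> ring
  have e1 : ∀ x u, psi s x (-u) = psi s x u := by
    intro x u
    rw [psi, psi, ← sub_eq_add_neg, sub_neg_eq_add, mul_comm]
  have e2 : ∀ y u, chiOdd s y (-u) = chiOdd s y u := by
    intro y u
    rw [chiOdd, chiOdd, ← sub_eq_add_neg, sub_neg_eq_add]
    ring
  have hn := hb.ne_zero
  simp only [oddCoeff, oddCoeffPart, psiM, neg_eq_zero, if_neg hn, e0, e1, e2, hs.neg]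
  have e3 : ∏ r ∈ K.erase b.1, chiOdd s (rowShift y b r) (oddBar y b) =
      ∏ r ∈ K.erase b.1, chiOdd s (y r) (oddBar y b) :=
    Finset.prod_congr rfl fun r hr => by rw [rowShift_ne y (Finset.mem_erase.1 hr).1]
  rw [e3, hs.eq (show 2 * -oddBar y b + 1 = -(2 * oddBar y b - 1) by ring),
    hs.eq (show 2 * -oddBar y b - 1 = -(2 * oddBar y b + 1) by ring)]
  push_cast
  ring

end

/-! ### Sums over returning paths -/

section
variable {h : ℂ} {s t : ℚ → ℂ} (hs : IsEvenRoot h s) (hh : NotRootOfUnity h)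
  (ht : ∀ b, t b ^ 2 = qHalf h b) {e p r : ℕ} {w z x y : ℕ → ℚ} (G : GTRows e p r w z x y)

theorem GTRows.xy_cases {e p r : ℕ} {w z x y : ℕ → ℚ} (G : GTRows e p r w z x y) {j k : ℕ}
    (hj : j ∈ Finset.Icc 1 p) (hk : k ∈ Finset.Icc 1 r) :
    (|x j| + 1 ≤ y k ∧ interSign e j k = 1) ∨ (y k ≤ x j ∧ 1 ≤ y k ∧ interSign e j k = -1) := by
  rw [Finset.mem_Icc] at hj hk
  have hxy := G.xy j k hj.1 hj.2 hk.1 hk.2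
  by_cases hlt : k < j + e
  · exact Or.inl ⟨hxy.1 hlt, if_pos hlt⟩
  · exact Or.inr ⟨hxy.2 (by omega), G.one_le_y hk.1 hk.2, if_neg hlt⟩

theorem GTRows.xw_cases {e p r : ℕ} {w z x y : ℕ → ℚ} (G : GTRows e p r w z x y) {j k : ℕ}
    (hj : j ∈ Finset.Icc 1 p) (hk : k ∈ Finset.Icc 1 (p - e)) :
    (|x j| + 1 ≤ w k ∧ interSign (1 - e) j k = 1) ∨
      (w k ≤ x j ∧ 1 ≤ w k ∧ interSign (1 - e) j k = -1) := by
  rw [Finset.mem_Icc] at hj hk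
  have hxy := G.xw j k hj.1 hj.2 hk.1 hk.2
  by_cases hlt : k < j + (1 - e)
  · exact Or.inl ⟨hxy.1 hlt, if_pos hlt⟩
  · exact Or.inr ⟨hxy.2 (by omega), G.one_le_w hk.1 hk.2, if_neg hlt⟩

theorem GTRows.zy_cases {e p r : ℕ} {w z x y : ℕ → ℚ} (G : GTRows e p r w z x y) {j k : ℕ}
    (hj : j ∈ Finset.Icc 1 (r + e)) (hk : k ∈ Finset.Icc 1 r) :
    (|z j| + 1 ≤ y k ∧ interSign (1 - e) j k = 1) ∨
      (y k ≤ z j ∧ 1 ≤ y k ∧ interSign (1 - e) j k = -1) := by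
  rw [Finset.mem_Icc] at hj hk
  have hxy := G.zy j k hj.1 hj.2 hk.1 hk.2
  by_cases hlt : k < j + (1 - e)
  · exact Or.inl ⟨hxy.1 hlt, if_pos hlt⟩
  · exact Or.inr ⟨hxy.2 (by omega), G.one_le_y hk.1 hk.2, if_neg hlt⟩

theorem GTRows.x_gap_or {e p r : ℕ} {w z x y : ℕ → ℚ} (G : GTRows e p r w z x y) :
    ∀ i ∈ Finset.Icc 1 p, ∀ j ∈ Finset.Icc 1 p, i ≠ j → |x i| + 1 ≤ x j ∨ |x j| + 1 ≤ x i := by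
  intro i hi j hj hij
  rw [Finset.mem_Icc] at hi hj
  rcases lt_or_gt_of_ne hij with hlt | hlt
  · exact Or.inr (G.x_gap G hi.1 hlt hj.2)
  · exact Or.inl (G.x_gap G hj.1 hlt hi.2)

theorem GTRows.y_gap_or {e p r : ℕ} {w z x y : ℕ → ℚ} (G : GTRows e p r w z x y) :
    ∀ i ∈ Finset.Icc 1 r, ∀ j ∈ Finset.Icc 1 r, i ≠ j → y i + 1 ≤ y j ∨ y j + 1 ≤ y i := by
  intro i hi j hj hij
  rw [Finset.mem_Icc] at hi hj
  rcases lt_or_gt_of_ne hij with hlt | hlt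
  · exact Or.inr (G.y_gap G hi.1 hlt hj.2)
  · exact Or.inl (G.y_gap G hj.1 hlt hi.2)

/-- Even-row entries at distance one pinch entries of both neighbouring rows. -/
theorem GTRows.x_pinch {e p r : ℕ} {w z x y : ℕ → ℚ} (G : GTRows e p r w z x y) {i j : ℕ}
    (hi : i ∈ Finset.Icc 1 p) (hj : j ∈ Finset.Icc 1 p) (hij : |x i| + 1 = x j) :
    (j + e ∈ Finset.Icc 1 r ∧ y (j + e) = x j) ∧
      (j + (1 - e) ∈ Finset.Icc 1 (p - e) ∧ w (j + (1 - e)) = x j) := by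
  rw [Finset.mem_Icc] at hi hj
  have he := G.he
  have hr := G.hr
  have hne : i ≠ j := by
    rintro rfl
    linarith [le_abs_self (x i)]
  have hlt : j < i := by
    by_contra hle
    have := G.x_gap G hi.1 (by omega : i < j) hj.2
    linarith [le_abs_self (x i), le_abs_self (x j)]
  refine ⟨⟨Finset.mem_Icc.2 ⟨by omega, by omega⟩, ?_⟩, Finset.mem_Icc.2 ⟨by omega, by omega⟩, ?_⟩
  · have h1 := (G.xy j (j + e) hj.1 hj.2 (by omega) (by omega)).2 le_rfl
    have h2 := (G.xy i (j + e) hi.1 hi.2 (by omega) (by omega)).1 (by omega)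
    linarith
  · have h1 := (G.xw j (j + (1 - e)) hj.1 hj.2 (by omega) (by omega)).2 le_rfl
    have h2 := (G.xw i (j + (1 - e)) hi.1 hi.2 (by omega) (by omega)).1 (by omega)
    linarith

include hs hh ht G

/-- The square of the coefficient of a move in an even row, possibly with some of the factors
omitted. -/
theorem evenCoeffPart_prod_sq {a : ℕ × ℚ} (ha : IsEvenMove (Finset.Icc 1 p) a) {S : Finset ℕ}
    (hS : S ⊆ Finset.Icc 1 r) {u : ℚ} (hu : u = evenBar x a) :
    (evenCoeffPart s t (Finset.Icc 1 p) (Finset.Icc 1 (p - e)) w x a *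
        ∏ k ∈ S, phi s (y k) (evenBar x a)) ^ 2 =
      (qHalf h u * qHalf h (u + 1)) *
        ((∏ k ∈ S, interSign e a.1 k) * ∏ k ∈ Finset.Icc 1 (p - e), interSign (1 - e) a.1 k) *
        ((∏ k ∈ S, (qCosh h (2 * y k - 1) - qCosh h (2 * u + 1))) *
          ∏ k ∈ Finset.Icc 1 (p - e), (qCosh h (2 * w k - 1) - qCosh h (2 * u + 1))) /
        evenDen h (Finset.Icc 1 p) x a.1 u *
        (qDen h ^ (2 * (p - 1)) / qDen h ^ (S.card + (p - e))) := by
  have hu' : u = x a.1 ∨ u = -x a.1 := by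
    rw [hu, evenBar]
    rcases ha.2 with h' | h' <;> rw [h']
    · left; ring
    · right; ring
  have hN := hh.qDen_ne
  have e1 : ((a.2 : ℂ) * (t (x a.1) * t (x a.1 + a.2))) ^ 2 = qHalf h u * qHalf h (u + 1) := by
    rw [mul_pow, mul_pow, ht, ht, hu, evenBar]
    rcases ha.2 with h' | h' <;> rw [h']
    · push_cast; ring_nf
    · rw [neg_one_mul, qHalf_neg, show -x a.1 + 1 = -(x a.1 + -1) by ring, qHalf_neg]
      push_cast; ring
  have e2 : ∏ k ∈ Finset.Icc 1 (p - e), phi s (w k) u ^ 2 =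
      (∏ k ∈ Finset.Icc 1 (p - e), interSign (1 - e) a.1 k) *
        (∏ k ∈ Finset.Icc 1 (p - e), (qCosh h (2 * w k - 1) - qCosh h (2 * u + 1))) /
          qDen h ^ (p - e) := by
    rw [Finset.prod_congr rfl fun k hk => phi_sq hs (G.xw_cases ha.1 hk) hu',
      Finset.prod_mul_distrib, Finset.prod_div_distrib, Finset.prod_const, Nat.card_Icc,
      Nat.add_sub_cancel, mul_div_assoc]
  have e3 : ∏ k ∈ S, phi s (y k) u ^ 2 =
      (∏ k ∈ S, interSign e a.1 k) *
        (∏ k ∈ S, (qCosh h (2 * y k - 1) - qCosh h (2 * u + 1))) / qDen h ^ S.card := by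
    rw [Finset.prod_congr rfl fun k hk => phi_sq hs (G.xy_cases ha.1 (hS hk)) hu',
      Finset.prod_mul_distrib, Finset.prod_div_distrib, Finset.prod_const, mul_div_assoc]
  have e4 : ∏ k ∈ (Finset.Icc 1 p).erase a.1, chiEven s (x k) u ^ 2 =
      evenDen h (Finset.Icc 1 p) x a.1 u / qDen h ^ (2 * (p - 1)) := by
    rw [Finset.prod_congr rfl fun k hk => chiEven_sq hs (G.x_gap_or _ ha.1 _
      (Finset.mem_of_mem_erase hk) (Finset.ne_of_mem_erase hk).symm) hu', evenDen]
    simp only [div_mul_div_comm]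
    rw [Finset.prod_div_distrib, Finset.prod_const, Finset.card_erase_of_mem ha.1, Nat.card_Icc,
      Nat.add_sub_cancel, ← pow_two, ← pow_mul]
  rw [evenCoeffPart, mul_pow, mul_pow, e1, ← hu, div_pow, ← Finset.prod_pow, ← Finset.prod_pow,
    ← Finset.prod_pow, e2, e3, e4, pow_add]
  field_simp

/-- The factor of the moved entry of y is absorbed by `bracket_even` into [2u + 2]; the square of
the remaining coefficient has the other entries of y and those of w as roots, so the sum is the one
in `even_sum_move`. -/
theorem even_sum_of_odd_move {b : ℕ × ℚ} (hb : IsEvenMove (Finset.Icc 1 r) b)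
    (G' : GTRows e p r w z x (rowShift y b)) :
    ∑ a ∈ Finset.Icc 1 p ×ˢ ({1, -1} : Finset ℚ),
      pathWeight (qTwo h)
        (fun y x => oddCoeff h s (Finset.Icc 1 r) (Finset.Icc 1 (r + e)) (Finset.Icc 1 p) z x y)
        (fun y x => evenCoeff s t (Finset.Icc 1 p) (Finset.Icc 1 (p - e)) (Finset.Icc 1 r) w x y)
        y x b a (a.1, -a.2) =
      -oddCoeff h s (Finset.Icc 1 r) (Finset.Icc 1 (r + e)) (Finset.Icc 1 p) z x y b := by
  set J := Finset.Icc 1 p with hJ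
  set K := Finset.Icc 1 r with hK
  set W := Finset.Icc 1 (p - e) with hW
  set Z := Finset.Icc 1 (r + e) with hZ
  have he := G.he
  have hr := G.hr
  have hp := G.hp
  have hr1 : 1 ≤ r := by have := Finset.mem_Icc.1 hb.1; omega
  have hb0 := hb.ne_zero
  set ρ : ℕ ⊕ ℕ → ℂ := Sum.elim (fun k => qCosh h (2 * y k - 1)) fun k => qCosh h (2 * w k - 1)
    with hρ
  have hN := hh.qDen_ne
  have hterm : ∀ a, IsEvenMove J a → pathWeight (qTwo h)
        (fun y x => oddCoeff h s K Z J z x y) (fun y x => evenCoeff s t J W K w x y)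
        y x b a (a.1, -a.2) = -oddCoeff h s K Z J z x y b *
        (qNum h (2 * evenBar x a + 2) * (qHalf h (evenBar x a) * qHalf h (evenBar x a + 1)) *
        (∏ k ∈ (K.erase b.1).disjSum W, (ρ k - qCosh h (2 * evenBar x a + 1))) /
          evenDen h J x a.1 (evenBar x a)) := by
    intro a ha
    obtain ⟨c0, c1⟩ := prod_rowShift K (fun u => phi s u (evenBar x a)) y b hb.1
    obtain ⟨p0, p1⟩ := prod_rowShift J (fun u => psi s u (oddBar y b)) x a ha.1
    have f0 : phi s (y b.1) (evenBar x a) = phi s (oddBar y b) (evenBar x a) :=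
      phi_bar hs _ _ _ hb.2
    have f1 : phi s (y b.1 + b.2) (evenBar x a) = phi s (oddBar y b + 1) (evenBar x a) := by
      rw [phi_bar hs _ _ _ hb.2, ← oddBar_shift_self y hb, oddBar, rowShift_self]
    have g0 : psi s (x a.1) (oddBar y b) = psi s (evenBar x a) (oddBar y b) :=
      psi_bar hs _ _ _ ha.2
    have g1 : psi s (x a.1 + a.2) (oddBar y b) = psi s (evenBar x a + 1) (oddBar y b) := by
      rw [psi_bar hs _ _ _ ha.2, ← evenBar_shift_self x ha, evenBar, rowShift_self]
    have hsq := evenCoeffPart_prod_sq hs hh ht G ha (Finset.erase_subset b.1 K) rfl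
    have hbr := bracket_even hs hh (x := x a.1) (y := y b.1) (σ := interSign e a.1 b.1) hb.2 ha.2
      (by
        rcases G.xy_cases ha.1 hb.1 with ⟨q1, q2⟩ | ⟨q1, q2, q3⟩
        · rcases G'.xy_cases ha.1 hb.1 with ⟨q1', q2'⟩ | ⟨q1', q2', q3'⟩
          · rw [rowShift_self] at q1'; exact Or.inl ⟨q1, q1', q2⟩
          · rw [q2] at q3'; norm_num at q3'
        · rcases G'.xy_cases ha.1 hb.1 with ⟨q1', q2'⟩ | ⟨q1', q2', q3'⟩
          · rw [q3] at q2'; norm_num at q2'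
          · rw [rowShift_self] at q1' q2'; exact Or.inr ⟨q1, q1', q2, q2', q3⟩)
    have hsign : interSign e a.1 b.1 * ((∏ k ∈ K.erase b.1, interSign e a.1 k) *
        ∏ k ∈ W, interSign (1 - e) a.1 k) = 1 := by
      have := G.prod_sign_even (Finset.mem_Icc.1 ha.1).1 (Finset.mem_Icc.1 ha.1).2
      rwa [← Finset.mul_prod_erase _ _ hb.1, mul_assoc] at this
    -- The powers of `qDen` cancel exactly after the moved entry has been removed.
    have hcard : (K.erase b.1).card + (p - e) = 2 * (p - 1) := by
      rw [Finset.card_erase_of_mem hb.1, hK, Nat.card_Icc]; omega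
    rw [hcard, div_self (pow_ne_zero _ hN), mul_one] at hsq
    rw [Finset.prod_disjSum]
    simp only [hρ, Sum.elim_inl, Sum.elim_inr]
    have e0 : b.2 * y b.1 + (b.2 ^ 2 - b.2) / 2 = oddBar y b := rfl
    have e0' : a.2 * x a.1 = evenBar x a := rfl
    rw [e0, e0'] at hbr
    have m1 : s (evenBar x a - oddBar y b) = s (oddBar y b - evenBar x a) := hs.eq (by ring)
    have m2 : s (evenBar x a + 1 - oddBar y b) = s (oddBar y b - evenBar x a - 1) := hs.eq (by ring)
    have hfin : pathWeight (qTwo h)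
        (fun y x => oddCoeff h s K Z J z x y) (fun y x => evenCoeff s t J W K w x y)
        y x b a (a.1, -a.2) = -oddCoeff h s K Z J z x y b *
        ((evenCoeffPart s t J W w x a * ∏ k ∈ K.erase b.1, phi s (y k) (evenBar x a)) ^ 2 *
          (interSign e a.1 b.1 * qNum h (2 * evenBar x a + 2))) := by
      rw [← hbr]
      simp only [pathWeight, evenCoeff_back t J W K w x _ a ha, rowShift_back]
      simp only [evenCoeff, oddCoeff, psiM, if_neg hb0]
      rw [c0, c1, p0, p1, f0, f1, g0, g1]
      simp only [phi, psi, m1, m2]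
      rw [show oddBar y b + 1 + evenBar x a = oddBar y b + evenBar x a + 1 by ring,
        show oddBar y b + 1 - evenBar x a - 1 = oddBar y b - evenBar x a by ring,
        show evenBar x a + oddBar y b = oddBar y b + evenBar x a by ring,
        show evenBar x a + 1 + oddBar y b = oddBar y b + evenBar x a + 1 by ring]
      ring
    rw [hfin, hsq]
    linear_combination (-oddCoeff h s K Z J z x y b * (qNum h (2 * evenBar x a + 2) *
      (qHalf h (evenBar x a) * qHalf h (evenBar x a + 1)) *
        ((∏ k ∈ K.erase b.1, (qCosh h (2 * y k - 1) - qCosh h (2 * evenBar x a + 1))) *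
          ∏ k ∈ W, (qCosh h (2 * w k - 1) - qCosh h (2 * evenBar x a + 1))) /
          evenDen h J x a.1 (evenBar x a))) * hsign
  have hdup : ∀ i ∈ J, ∀ j ∈ J, |x i| + 1 = x j → ∃ k ∈ (K.erase b.1).disjSum W,
      ∃ l ∈ (K.erase b.1).disjSum W, k ≠ l ∧
      ρ k = qCosh h (2 * x j - 1) ∧ ρ l = qCosh h (2 * x j - 1) := by
    intro i hi j hj hij
    obtain ⟨⟨k1, k2⟩, l1, l2⟩ := G.x_pinch hi hj hij
    refine ⟨Sum.inl (j + e), ?_, Sum.inr (j + (1 - e)), ?_, by simp, by simp [hρ, k2],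
      by simp [hρ, l2]⟩
    -- A pinched entry of y cannot be the one that moves: after the move it would have to equal the
    -- same x_j.
    · refine Finset.inl_mem_disjSum.2 (Finset.mem_erase.2 ⟨?_, k1⟩)
      intro hk
      have := (G'.x_pinch hi hj hij).1.2
      rw [hk, rowShift_self, ← hk, k2] at this
      exact hb0 (by linarith)
    · exact Finset.inr_mem_disjSum.2 l1
  have hsum := even_sum_move hh J ((K.erase b.1).disjSum W) ρ x (by
      rw [Finset.card_disjSum, Finset.card_erase_of_mem hb.1, hK, hW, hJ, Nat.card_Icc,
        Nat.card_Icc, Nat.card_Icc]; omega)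
    (fun j hj => G.two_x_int (Finset.mem_Icc.1 hj).1 (Finset.mem_Icc.1 hj).2) G.x_gap_or hdup
  rw [← mul_one (-oddCoeff h s K Z J z x y b), ← hsum, Finset.sum_product, Finset.mul_sum]
  refine Finset.sum_congr rfl fun j hj => ?_
  rw [Finset.sum_pair (by norm_num), hterm (j, 1) ⟨hj, Or.inl rfl⟩, hterm (j, -1) ⟨hj, Or.inr rfl⟩,
    ← mul_add]
  simp only [evenBar, one_mul, neg_one_mul]

/-- For a diagonal V the path factor, up to sign, is [2][u + 1] - 2[u] = [u + 2] - [u] = c(u + 1),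
and the interpolation now uses every entry of y. A zero entry of x makes the diagonal term itself
vanish and is treated apart. -/
theorem even_sum_of_diag :
    ∑ a ∈ Finset.Icc 1 p ×ˢ ({1, -1} : Finset ℚ),
      pathWeight (qTwo h)
        (fun y x => oddCoeff h s (Finset.Icc 1 r) (Finset.Icc 1 (r + e)) (Finset.Icc 1 p) z x y)
        (fun y x => evenCoeff s t (Finset.Icc 1 p) (Finset.Icc 1 (p - e)) (Finset.Icc 1 r) w x y)
        y x (0, 0) a (a.1, -a.2) =
      -oddCoeff h s (Finset.Icc 1 r) (Finset.Icc 1 (r + e)) (Finset.Icc 1 p) z x y (0, 0) := by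
  set J := Finset.Icc 1 p with hJ
  set K := Finset.Icc 1 r with hK
  set W := Finset.Icc 1 (p - e) with hW
  set Z := Finset.Icc 1 (r + e) with hZ
  have he := G.he
  have hr := G.hr
  have hp := G.hp
  have hN := hh.qDen_ne
  set F : ℕ → ℚ → ℂ := fun j u => (qHalf h u * qHalf h (u + 1)) *
        ((∏ k ∈ K, (qCosh h (2 * y k - 1) - qCosh h (2 * u + 1))) *
          ∏ k ∈ W, (qCosh h (2 * w k - 1) - qCosh h (2 * u + 1))) /
        evenDen h J x j u / qDen h with hF
  have hterm : ∀ a, IsEvenMove J a → pathWeight (qTwo h)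
        (fun y x => oddCoeff h s K Z J z x y) (fun y x => evenCoeff s t J W K w x y)
        y x (0, 0) a (a.1, -a.2) = a.2 * (oddCoeffPart h s K Z z y (0, 0) *
          ∏ j ∈ J.erase a.1, qNum h (x j)) * (qCosh h (evenBar x a + 1) * F a.1 (evenBar x a)) := by
    intro a ha
    obtain ⟨p0, p1⟩ := prod_rowShift J (fun u => qNum h u) x a ha.1
    have hsq := evenCoeffPart_prod_sq hs hh ht G ha (Finset.Subset.refl K) rfl
    have hsign := G.prod_sign_even (Finset.mem_Icc.1 ha.1).1 (Finset.mem_Icc.1 ha.1).2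
    have hcard : K.card + (p - e) = 2 * (p - 1) + 1 := by
      rw [hK, Nat.card_Icc]; omega
    have hNN : qDen h ^ (2 * (p - 1)) / qDen h ^ (2 * (p - 1) + 1) = 1 / qDen h := by
      rw [pow_succ]; field_simp
    rw [hcard, hNN, hsign, mul_one] at hsq
    have i1 := hh.qTwo_mul (evenBar x a + 1)
    have i2 := hh.qNum_add_sub (evenBar x a + 1)
    rw [add_sub_cancel_right] at i1 i2
    have g0 : qNum h (x a.1) = a.2 * qNum h (evenBar x a) := by
      rw [evenBar]
      rcases ha.2 with h' | h' <;> rw [h']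
      · simp
      · rw [neg_one_mul, qNum_neg]; push_cast; ring
    have g1 : qNum h (x a.1 + a.2) = a.2 * qNum h (evenBar x a + 1) := by
      rw [evenBar]
      rcases ha.2 with h' | h' <;> rw [h']
      · simp
      · rw [show -1 * x a.1 + 1 = -(x a.1 + -1) by ring, qNum_neg]; push_cast; ring
    simp only [pathWeight, evenCoeff_back t J W K w x _ a ha, rowShift_back, rowShift_zero]
    simp only [evenCoeff, oddCoeff, psiM, if_true]
    rw [p0, p1, g0, g1]
    have hF' : F a.1 (evenBar x a) =
        (evenCoeffPart s t J W w x a * ∏ k ∈ K, phi s (y k) (evenBar x a)) ^ 2 := by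
      rw [hsq, hF]; ring
    rw [hF']
    linear_combination (oddCoeffPart h s K Z z y (0, 0) * (∏ j ∈ J.erase a.1, qNum h (x j)) *
      (evenCoeffPart s t J W w x a * ∏ k ∈ K, phi s (y k) (evenBar x a)) ^ 2 * a.2) * (i1 + i2)
  rw [Finset.sum_product, Finset.sum_congr rfl fun j hj => by
    rw [Finset.sum_pair (by norm_num), hterm (j, 1) ⟨hj, Or.inl rfl⟩,
      hterm (j, -1) ⟨hj, Or.inr rfl⟩]]
  simp only [evenBar, one_mul, neg_one_mul]
  by_cases hne : ∀ j ∈ J, x j ≠ 0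
  · have hsum := even_sum_pos hh J (K.disjSum W)
      (Sum.elim (fun k => qCosh h (2 * y k - 1)) fun k => qCosh h (2 * w k - 1)) x (by
        rw [Finset.card_disjSum, hK, hW, hJ, Nat.card_Icc, Nat.card_Icc, Nat.card_Icc]; omega)
      (fun j hj => G.two_x_int (Finset.mem_Icc.1 hj).1 (Finset.mem_Icc.1 hj).2) hne G.x_gap_or
      (by
        intro i hi j hj hij
        obtain ⟨⟨k1, k2⟩, l1, l2⟩ := G.x_pinch hi hj hij
        exact ⟨Sum.inl (j + e), Finset.inl_mem_disjSum.2 k1, Sum.inr (j + (1 - e)),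
          Finset.inr_mem_disjSum.2 l1, by simp, by simp [k2], by simp [l2]⟩)
      (fun j u => -qCosh h (u + 1) * F j u / qNum h u) (by
        intro j hj u hu hu0
        rw [Finset.prod_disjSum]
        simp only [Sum.elim_inl, Sum.elim_inr, hF]
        have n3 := hh.qNum_ne hu hu0
        have hq := qCosh_qHalf_ratio hh hu hu0
        rw [div_eq_iff n3, div_eq_mul_inv _ (qDen h), div_eq_mul_inv, div_eq_mul_inv, mul_inv]
        rw [div_eq_mul_inv] at hq
        rw [show ∀ a b c d f g : ℂ, a * (b * c * (d * f) * g * (qDen h)⁻¹) =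
          (a * (b * c)) * (d * f) * g * (qDen h)⁻¹ from fun _ _ _ _ _ _ => by ring, hq]
        field_simp)
    rw [← mul_one (-oddCoeff h s K Z J z x y (0, 0)), ← hsum, Finset.mul_sum]
    refine Finset.sum_congr rfl fun j hj => ?_
    have n3 := hh.qNum_ne (G.two_x_int (Finset.mem_Icc.1 hj).1 (Finset.mem_Icc.1 hj).2) (hne j hj)
    simp only [oddCoeff, psiM, if_true, qNum_neg]
    rw [← Finset.mul_prod_erase _ _ hj]
    push_cast
    field_simp
    ring
  · push Not at hne
    obtain ⟨i, hi, hi0⟩ := hne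
    have h0 : oddCoeff h s K Z J z x y (0, 0) = 0 := by
      simp only [oddCoeff, psiM, if_true]
      rw [Finset.prod_eq_zero hi (by rw [hi0, qNum_zero]), mul_zero]
    rw [h0, neg_zero]
    refine Finset.sum_eq_zero fun j hj => ?_
    -- At the zero entry raising and lowering have equal terms with opposite signs; for any other
    -- entry the factor [0] remains in the product.
    rcases eq_or_ne j i with rfl | hji
    · rw [hi0]; push_cast; simp
    · rw [Finset.prod_eq_zero (Finset.mem_erase.2 ⟨hji.symm, hi⟩) (by rw [hi0, qNum_zero])]
      simp

end

namespace GTRows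
variable {e p r : ℕ} {w z x y : ℕ → ℚ} (G : GTRows e p r w z x y)
include G

/-- Odd-row entries at distance one pinch entries of both neighbouring rows. -/
theorem y_pinch {i j : ℕ} (hi : i ∈ Finset.Icc 1 r) (hj : j ∈ Finset.Icc 1 r)
    (hij : y i + 1 = y j) :
    (j + (1 - e) ∈ Finset.Icc 1 p ∧ x (j + (1 - e)) = y i) ∧
      (j + e ∈ Finset.Icc 1 (r + e) ∧ z (j + e) = y i) := by
  rw [Finset.mem_Icc] at hi hj
  have he := G.he
  have hr := G.hr
  have hne : i ≠ j := by
    rintro rfl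
    linarith
  have hlt : j < i := by
    by_contra hle
    have := G.y_gap G hi.1 (by omega : i < j) hj.2
    linarith
  refine ⟨⟨Finset.mem_Icc.2 ⟨by omega, by omega⟩, ?_⟩, Finset.mem_Icc.2 ⟨by omega, by omega⟩, ?_⟩
  · have h1 := (G.xy (j + (1 - e)) j (by omega) (by omega) hj.1 hj.2).1 (by omega)
    have h2 := (G.xy (j + (1 - e)) i (by omega) (by omega) hi.1 hi.2).2 (by omega)
    linarith [le_abs_self (x (j + (1 - e)))]
  · have h1 := (G.zy (j + e) j (by omega) (by omega) hj.1 hj.2).1 (by omega)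
    have h2 := (G.zy (j + e) i (by omega) (by omega) hi.1 hi.2).2 (by omega)
    linarith [le_abs_self (z (j + e))]

/-- The inequality |x| + 1 ≤ y for the next smaller entry of each neighbouring even row forces that
entry to be 0. Hence c(0) is a double root when the node c(2y - 2) collides with that of the
diagonal term. -/
theorem y_eq_one {j : ℕ} (hj : j ∈ Finset.Icc 1 r) (hy : y j = 1) :
    (j + (1 - e) ∈ Finset.Icc 1 p ∧ x (j + (1 - e)) = 0) ∧
      (j + e ∈ Finset.Icc 1 (r + e) ∧ z (j + e) = 0) := by
  rw [Finset.mem_Icc] at hj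
  have he := G.he
  have hr := G.hr
  refine ⟨⟨Finset.mem_Icc.2 ⟨by omega, by omega⟩, ?_⟩, Finset.mem_Icc.2 ⟨by omega, by omega⟩, ?_⟩
  · have h1 := (G.xy (j + (1 - e)) j (by omega) (by omega) hj.1 hj.2).1 (by omega)
    exact abs_nonpos_iff.1 (by linarith)
  · have h1 := (G.zy (j + e) j (by omega) (by omega) hj.1 hj.2).1 (by omega)
    exact abs_nonpos_iff.1 (by linarith)

/-- For y = 3/2 the factor s(2v + 1) vanishes at the reflected entry v = 1 - y = -1/2. Integrality
together with |z| ≤ 1/2 leaves only z = ±1/2, which supplies the root needed to make the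
interpolation term vanish as well. -/
theorem y_eq_three_halves {j : ℕ} (hj : j ∈ Finset.Icc 1 r) (hy : y j = 3 / 2) :
    j + e ∈ Finset.Icc 1 (r + e) ∧ |z (j + e)| = 1 / 2 := by
  have hj' := hj
  rw [Finset.mem_Icc] at hj
  have he := G.he
  have hr := G.hr
  have hm : j + e ∈ Finset.Icc 1 (r + e) := Finset.mem_Icc.2 ⟨by omega, by omega⟩
  refine ⟨hm, ?_⟩
  have h1 := (G.zy (j + e) j (by omega) (by omega) hj.1 hj.2).1 (by omega)
  obtain ⟨c, -, -, i1, -, i2⟩ := G.int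
  obtain ⟨m, hm⟩ := i1 j hj.1 hj.2
  obtain ⟨n, hn⟩ := i2 (j + e) (by omega) (by omega)
  have h2 := abs_le.1 (show |z (j + e)| ≤ 1 / 2 by linarith)
  have h3 : z (j + e) = 3 / 2 + ((n - m : ℤ) : ℚ) := by push_cast; linarith
  rw [h3] at h2 ⊢
  have b1 : (-2 : ℤ) ≤ n - m := by
    have : (-2 : ℚ) ≤ ((n - m : ℤ) : ℚ) := by linarith
    exact_mod_cast this
  have b2 : (n - m : ℤ) ≤ -1 := by
    have : ((n - m : ℤ) : ℚ) ≤ -1 := by linarith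
    exact_mod_cast this
  obtain h | h : n - m = -2 ∨ n - m = -1 := by omega
  · rw [h]; norm_num [abs_of_neg]
  · rw [h]; norm_num

end GTRows

section
variable {h : ℂ} {s t : ℚ → ℂ} (hs : IsEvenRoot h s) (hh : NotRootOfUnity h)
  {e p r : ℕ} {w z x y : ℕ → ℚ} (G : GTRows e p r w z x y)
include hs hh G

/-- The two exceptional values, v = 0 and 2v + 1 = 0, are excluded so that 2v + 1 and 2v - 1 have
the same sign; there 1 / 0 = 0 would have to be compared separately. -/
theorem oddCoeffPart_prod_sq {b : ℕ × ℚ} (hb : IsEvenMove (Finset.Icc 1 r) b) {S : Finset ℕ}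
    (hS : S ⊆ Finset.Icc 1 p) {v : ℚ} (hv : v = oddBar y b) (hv0 : v ≠ 0) (hv1 : 2 * v + 1 ≠ 0) :
    (oddCoeffPart h s (Finset.Icc 1 r) (Finset.Icc 1 (r + e)) z y b *
        ∏ j ∈ S, psi s (x j) (oddBar y b)) ^ 2 =
      (-1) ^ (S.card + (r + e)) *
        ((∏ j ∈ S, interSign e j b.1) * ∏ j ∈ Finset.Icc 1 (r + e), interSign (1 - e) j b.1) *
        ((∏ j ∈ S, (qCosh h (2 * x j) - qCosh h (2 * v))) *
          ∏ j ∈ Finset.Icc 1 (r + e), (qCosh h (2 * z j) - qCosh h (2 * v))) /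
        (∏ k ∈ (Finset.Icc 1 r).erase b.1, (qCosh h (2 * y k) - qCosh h (2 * v)) *
            (qCosh h (2 * y k - 2) - qCosh h (2 * v))) *
        (qDen h ^ (2 * (r - 1)) / qDen h ^ (S.card + (r + e))) /
        (qNum h v ^ 2 * (qNum h (2 * v + 1) * qNum h (2 * v - 1))) := by
  have hv' : v = y b.1 ∨ v = 1 - y b.1 := by
    rw [hv, oddBar]
    rcases hb.2 with h' | h' <;> rw [h']
    · left; ring
    · right; ring
  have hN := hh.qDen_ne
  have hb0 := hb.ne_zero
  have hbm := Finset.mem_Icc.1 hb.1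
  have hy1 : ∀ k ∈ Finset.Icc 1 r, 1 ≤ y k := fun k hk =>
    G.one_le_y (Finset.mem_Icc.1 hk).1 (Finset.mem_Icc.1 hk).2
  have hneg : ∀ (T : Finset ℕ) (f : ℕ → ℂ), ∏ j ∈ T, -f j = (-1) ^ T.card * ∏ j ∈ T, f j :=
    fun T f => by rw [Finset.prod_neg]
  have e1 : (1 / (s v ^ 2 * s (2 * v + 1) * s (2 * v - 1))) ^ 2 =
      1 / (qNum h v ^ 2 * (qNum h (2 * v + 1) * qNum h (2 * v - 1))) := by
    have a1 : (s v ^ 2) ^ 2 = qNum h v ^ 2 := by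
      rcases le_total 0 v with h0 | h0
      · rw [hs.sq _ h0]
      · rw [hs.sq_nonpos h0, neg_sq]
    rw [← hs.sq_mul_of_nonneg, ← a1]
    · rw [div_pow]; ring
    · rcases hv' with e' | e'
      · have := hy1 _ hb.1
        left; rw [e']; constructor <;> linarith
      · right
        obtain ⟨n, hn⟩ := G.two_y_int hbm.1 hbm.2
        have h1 := hy1 _ hb.1
        -- Here n = 2y is an integer with n ≥ 2; the values n = 2 and n = 3 are the exceptional
        -- ones, leaving y ≥ 2.
        have h2 : (2 : ℤ) ≤ n := by
          have : (2 : ℚ) ≤ n := by linarith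
          exact_mod_cast this
        have h3 : n ≠ 2 := by
          rintro rfl
          apply hv0; rw [e']; push_cast at hn; linarith
        have h4 : n ≠ 3 := by
          rintro rfl
          apply hv1; rw [e']; push_cast at hn; linarith
        have h5 : (4 : ℚ) ≤ n := by exact_mod_cast (show (4 : ℤ) ≤ n by omega)
        rw [e']; constructor <;> linarith
  have e2 : ∏ j ∈ Finset.Icc 1 (r + e), psi s (z j) v ^ 2 = (-1) ^ (r + e) *
      ((∏ j ∈ Finset.Icc 1 (r + e), interSign (1 - e) j b.1) *
        (∏ j ∈ Finset.Icc 1 (r + e), (qCosh h (2 * z j) - qCosh h (2 * v))) /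
          qDen h ^ (r + e)) := by
    rw [Finset.prod_congr rfl fun j hj => psi_sq hs (G.zy_cases hj hb.1) hv', hneg,
      Finset.prod_mul_distrib, Finset.prod_div_distrib, Finset.prod_const, Nat.card_Icc,
      Nat.add_sub_cancel, mul_div_assoc]
  have e3 : ∏ j ∈ S, psi s (x j) v ^ 2 = (-1) ^ S.card *
      ((∏ j ∈ S, interSign e j b.1) *
        (∏ j ∈ S, (qCosh h (2 * x j) - qCosh h (2 * v))) / qDen h ^ S.card) := by
    rw [Finset.prod_congr rfl fun j hj => psi_sq hs (G.xy_cases (hS hj) hb.1) hv', hneg,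
      Finset.prod_mul_distrib, Finset.prod_div_distrib, Finset.prod_const, mul_div_assoc]
  have e4 : ∏ k ∈ (Finset.Icc 1 r).erase b.1, chiOdd s (y k) v ^ 2 =
      (∏ k ∈ (Finset.Icc 1 r).erase b.1, (qCosh h (2 * y k) - qCosh h (2 * v)) *
            (qCosh h (2 * y k - 2) - qCosh h (2 * v))) / qDen h ^ (2 * (r - 1)) := by
    rw [Finset.prod_congr rfl fun k hk => chiOdd_sq hs (hy1 _ hb.1)
      (hy1 _ (Finset.mem_of_mem_erase hk)) (G.y_gap_or _ hb.1 _
      (Finset.mem_of_mem_erase hk) (Finset.ne_of_mem_erase hk).symm) hv']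
    simp only [div_mul_div_comm]
    rw [Finset.prod_div_distrib, Finset.prod_const, Finset.card_erase_of_mem hb.1, Nat.card_Icc,
      Nat.add_sub_cancel, ← pow_two, ← pow_mul]
  have e5 : (b.2 : ℂ) ^ 2 = 1 := by rcases hb.2 with h' | h' <;> rw [h'] <;> norm_num
  rw [oddCoeffPart, if_neg hb0, mul_pow, mul_pow, ← hv, e1, div_pow, mul_pow, e5,
    ← Finset.prod_pow, ← Finset.prod_pow, ← Finset.prod_pow, e2, e3, e4,
    pow_add (-1 : ℂ) S.card, pow_add (qDen h) S.card]
  generalize ∏ k ∈ (Finset.Icc 1 r).erase b.1, (qCosh h (2 * y k) - qCosh h (2 * v)) *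
            (qCosh h (2 * y k - 2) - qCosh h (2 * v)) = Dn
  generalize (-1 : ℂ) ^ (r + e) = m1
  generalize qDen h ^ (r + e) = m2
  generalize qDen h ^ S.card = m3
  generalize qDen h ^ (2 * (r - 1)) = m4
  generalize qNum h v ^ 2 * (qNum h (2 * v + 1) * qNum h (2 * v - 1)) = m5
  simp only [div_eq_mul_inv, mul_inv, inv_inv]
  ring

/-- Here the diagonal term is one of the moves summed over, and it supplies the node c(0), giving 2r
+ 1 nodes against 2r roots from the unmoved entries of x and all of z. -/
theorem odd_sum_of_even_move {a : ℕ × ℚ} (ha : IsEvenMove (Finset.Icc 1 p) a)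
    (G' : GTRows e p r w z (rowShift x a) y) :
    ∑ b ∈ insert (0, 0) (Finset.Icc 1 r ×ˢ ({1, -1} : Finset ℚ)),
      pathWeight (qTwo h)
        (evenCoeff s t (Finset.Icc 1 p) (Finset.Icc 1 (p - e)) (Finset.Icc 1 r) w)
        (oddCoeff h s (Finset.Icc 1 r) (Finset.Icc 1 (r + e)) (Finset.Icc 1 p) z)
        x y a b (b.1, -b.2) =
      -evenCoeff s t (Finset.Icc 1 p) (Finset.Icc 1 (p - e)) (Finset.Icc 1 r) w x y a := by
  set J := Finset.Icc 1 p with hJ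
  set K := Finset.Icc 1 r with hK
  set W := Finset.Icc 1 (p - e) with hW
  set Z := Finset.Icc 1 (r + e) with hZ
  have he := G.he
  have hr := G.hr
  have hp := G.hp
  have ha0 := ha.ne_zero
  have hN := hh.qDen_ne
  have hcard : (J.erase a.1).card + (r + e) = 2 * r := by
    rw [Finset.card_erase_of_mem ha.1, hJ, Nat.card_Icc]; omega
  have hy1 : ∀ k ∈ K, 1 ≤ y k := fun k hk =>
    G.one_le_y (Finset.mem_Icc.1 hk).1 (Finset.mem_Icc.1 hk).2
  set ρ : ℕ ⊕ ℕ → ℂ := Sum.elim (fun k => qCosh h (2 * x k)) fun k => qCosh h (2 * z k) with hρ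
  have hterm : ∀ b, IsEvenMove K b → pathWeight (qTwo h)
        (evenCoeff s t J W K w) (oddCoeff h s K Z J z) x y a b (b.1, -b.2) =
        -evenCoeff s t J W K w x y a *
        ((∏ k ∈ (J.erase a.1).disjSum Z, (ρ k - qCosh h (2 * oddBar y b))) /
          ((qCosh h (2 * oddBar y b - 2) - qCosh h (2 * oddBar y b)) *
            ((qCosh h 0 - qCosh h (2 * oddBar y b)) *
          ∏ k ∈ K.erase b.1, (qCosh h (2 * y k) - qCosh h (2 * oddBar y b)) *
            (qCosh h (2 * y k - 2) - qCosh h (2 * oddBar y b))))) := by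
    intro b hb
    have hb0 := hb.ne_zero
    have hbm := Finset.mem_Icc.1 hb.1
    obtain ⟨c0, c1⟩ := prod_rowShift K (fun u => phi s u (evenBar x a)) y b hb.1
    obtain ⟨p0, p1⟩ := prod_rowShift J (fun u => psi s u (oddBar y b)) x a ha.1
    have f0 : phi s (y b.1) (evenBar x a) = phi s (oddBar y b) (evenBar x a) :=
      phi_bar hs _ _ _ hb.2
    have f1 : phi s (y b.1 + b.2) (evenBar x a) = phi s (oddBar y b + 1) (evenBar x a) := by
      rw [phi_bar hs _ _ _ hb.2, ← oddBar_shift_self y hb, oddBar, rowShift_self]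
    have g0 : psi s (x a.1) (oddBar y b) = psi s (evenBar x a) (oddBar y b) :=
      psi_bar hs _ _ _ ha.2
    have g1 : psi s (x a.1 + a.2) (oddBar y b) = psi s (evenBar x a + 1) (oddBar y b) := by
      rw [psi_bar hs _ _ _ ha.2, ← evenBar_shift_self x ha, evenBar, rowShift_self]
    have hbr := bracket_odd hs hh (x := x a.1) (y := y b.1) (σ := interSign e a.1 b.1) hb.2 ha.2
      (by
        rcases G.xy_cases ha.1 hb.1 with ⟨q1, q2⟩ | ⟨q1, q2, q3⟩
        · rcases G'.xy_cases ha.1 hb.1 with ⟨q1', q2'⟩ | ⟨q1', q2', q3'⟩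
          · rw [rowShift_self] at q1'; exact Or.inl ⟨q1, q1', q2⟩
          · rw [q2] at q3'; norm_num at q3'
        · rcases G'.xy_cases ha.1 hb.1 with ⟨q1', q2'⟩ | ⟨q1', q2', q3'⟩
          · rw [q3] at q2'; norm_num at q2'
          · rw [rowShift_self] at q1'; exact Or.inr ⟨q1, q1', q2, q3⟩)
    have hsign : interSign e a.1 b.1 * ((∏ j ∈ J.erase a.1, interSign e j b.1) *
        ∏ j ∈ Z, interSign (1 - e) j b.1) = -1 := by
      have := G.prod_sign_odd (Finset.mem_Icc.1 hb.1).1 (Finset.mem_Icc.1 hb.1).2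
      rwa [← Finset.mul_prod_erase _ _ ha.1, mul_assoc] at this
    rw [Finset.prod_disjSum]
    simp only [hρ, Sum.elim_inl, Sum.elim_inr]
    have e0 : b.2 * y b.1 + (b.2 ^ 2 - b.2) / 2 = oddBar y b := rfl
    have e0' : a.2 * x a.1 = evenBar x a := rfl
    rw [e0, e0'] at hbr
    have m1 : s (evenBar x a - oddBar y b) = s (oddBar y b - evenBar x a) := hs.eq (by ring)
    have m2 : s (evenBar x a + 1 - oddBar y b) = s (oddBar y b - evenBar x a - 1) := hs.eq (by ring)
    have hfin : pathWeight (qTwo h)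
        (evenCoeff s t J W K w) (oddCoeff h s K Z J z) x y a b (b.1, -b.2) =
        -evenCoeff s t J W K w x y a *
        ((oddCoeffPart h s K Z z y b * ∏ j ∈ J.erase a.1, psi s (x j) (oddBar y b)) ^ 2 *
          -(interSign e a.1 b.1 * qNum h (2 * oddBar y b + 1))) := by
      rw [← hbr]
      simp only [pathWeight, oddCoeff_back hs K Z J z _ y b hb, rowShift_back]
      simp only [evenCoeff, oddCoeff, psiM, if_neg hb0]
      rw [c0, c1, p0, p1, f0, f1, g0, g1]
      simp only [phi, psi, m1, m2]
      rw [show oddBar y b + 1 + evenBar x a = oddBar y b + evenBar x a + 1 by ring,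
        show oddBar y b + 1 - evenBar x a - 1 = oddBar y b - evenBar x a by ring,
        show evenBar x a + oddBar y b = oddBar y b + evenBar x a by ring,
        show evenBar x a + 1 + oddBar y b = oddBar y b + evenBar x a + 1 by ring]
      ring
    have hbar : oddBar y b = y b.1 ∨ oddBar y b = 1 - y b.1 := by
      rw [oddBar]
      rcases hb.2 with h' | h' <;> rw [h']
      · left; ring
      · right; ring
    have hone := hy1 _ hb.1
    rw [hfin]
    -- Lowering y = 1: the coefficient contains 1 / s(0)^2 and the interpolation denominator
    -- contains c(0) - c(0), so both sides are 0.
    by_cases hv0 : oddBar y b = 0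
    · rw [hv0, mul_zero, sub_self, zero_mul, mul_zero, div_zero, mul_zero]
      rw [oddCoeffPart, if_neg hb0, hv0, hs.zero]
      simp
    -- Lowering y = 3/2: the path term vanishes with [2v + 1], and the interpolation term vanishes
    -- because an entry ±1/2 of z is a root.
    by_cases hv1 : 2 * oddBar y b + 1 = 0
    · have hy3 : y b.1 = 3 / 2 := by rcases hbar with e' | e' <;> rw [e'] at hv1 <;> linarith
      obtain ⟨q1, q2⟩ := G.y_eq_three_halves hb.1 hy3
      rw [hv1, qNum_zero, mul_zero, neg_zero, mul_zero, mul_zero]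
      rw [Finset.prod_eq_zero (s := Z) q1, mul_zero, zero_div, mul_zero]
      rw [show 2 * oddBar y b = -1 by linarith, qCosh_neg, sub_eq_zero]
      rcases abs_choice (z (b.1 + e)) with e' | e' <;> rw [e'] at q2
      · rw [q2]; norm_num
      · rw [show 2 * z (b.1 + e) = -1 by linarith, qCosh_neg]
    have hbi : ∃ n : ℤ, 2 * oddBar y b = n := by
      obtain ⟨n, hn⟩ := G.two_y_int hbm.1 hbm.2
      rcases hbar with e' | e' <;> rw [e']
      · exact ⟨n, hn⟩
      · exact ⟨2 - n, by push_cast; rw [← hn]; ring⟩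
    have n1 := hh.qNum_ne hbi hv0
    have n2 : qNum h (2 * oddBar y b + 1) ≠ 0 := hh.qNum_ne (by
      obtain ⟨n, hn⟩ := hbi; exact ⟨2 * (n + 1), by push_cast; rw [← hn]⟩) hv1
    have hsq := oddCoeffPart_prod_sq hs hh G hb (Finset.erase_subset a.1 J) rfl hv0 hv1
    rw [hcard, pow_mul, neg_one_sq, one_pow, one_mul] at hsq
    have d1 : qCosh h (2 * oddBar y b - 2) - qCosh h (2 * oddBar y b) =
        -(qDen h * qNum h (2 * oddBar y b - 1)) := by
      rw [← mul_one (qNum h (2 * oddBar y b - 1)), ← hh.qNum_one, qNum_mul_qNum,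
        show 2 * oddBar y b - 1 - 1 = 2 * oddBar y b - 2 by ring, sub_add_cancel]
      field_simp; ring
    have d2 : qCosh h 0 - qCosh h (2 * oddBar y b) = -(qDen h * qNum h (oddBar y b) ^ 2) := by
      rw [pow_two, qNum_mul_eq (u := 2 * oddBar y b) (v := 0) (by ring) (by ring)]
      field_simp; ring
    have hK1 : 1 ≤ r := hbm.1.trans hbm.2
    have hNN : qDen h ^ (2 * (r - 1)) / qDen h ^ (2 * r) = 1 / qDen h ^ 2 := by
      rw [show 2 * r = 2 * (r - 1) + 2 by omega, pow_add]; field_simp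
    rw [hNN] at hsq
    rw [hsq, d1, d2]
    set Dn := ∏ k ∈ K.erase b.1, (qCosh h (2 * y k) - qCosh h (2 * oddBar y b)) *
            (qCosh h (2 * y k - 2) - qCosh h (2 * oddBar y b)) with hDn
    set X1 := ∏ j ∈ J.erase a.1, (qCosh h (2 * x j) - qCosh h (2 * oddBar y b))
    set X2 := ∏ j ∈ Z, (qCosh h (2 * z j) - qCosh h (2 * oddBar y b))
    set s1 := ∏ j ∈ J.erase a.1, interSign e j b.1
    set s2 := ∏ j ∈ Z, interSign (1 - e) j b.1
    have hfrac : s1 * s2 * (X1 * X2) / Dn * (1 / qDen h ^ 2) /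
        (qNum h (oddBar y b) ^ 2 * (qNum h (2 * oddBar y b + 1) * qNum h (2 * oddBar y b - 1))) *
        -(interSign e a.1 b.1 * qNum h (2 * oddBar y b + 1)) =
        -(interSign e a.1 b.1 * (s1 * s2)) * (X1 * X2 / (-(qDen h * qNum h (2 * oddBar y b - 1)) *
          (-(qDen h * qNum h (oddBar y b) ^ 2) * Dn))) := by
      field_simp
    rw [hfrac, hsign]
    ring
  have hdiag : pathWeight (qTwo h)
        (evenCoeff s t J W K w) (oddCoeff h s K Z J z) x y a (0, 0) (0, -0) =
        -evenCoeff s t J W K w x y a *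
        ((∏ k ∈ (J.erase a.1).disjSum Z, (ρ k - qCosh h 0)) /
          ∏ k ∈ K, (qCosh h (2 * y k) - qCosh h 0) * (qCosh h (2 * y k - 2) - qCosh h 0)) := by
    obtain ⟨p0, p1⟩ := prod_rowShift J (fun u => qNum h u) x a ha.1
    -- The three positions of the even move among two diagonal terms leave this quadratic form in
    -- [x] and [x + ε], equal to 1 for either sign of ε.
    have hone : qNum h (x a.1 + a.2) ^ 2 - qTwo h * (qNum h (x a.1) * qNum h (x a.1 + a.2)) +
        qNum h (x a.1) ^ 2 = 1 := by
      have key : ∀ u, qNum h (u + 1) ^ 2 - qTwo h * (qNum h u * qNum h (u + 1)) +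
          qNum h u ^ 2 = 1 := fun u => by
        have i1 := hh.qTwo_mul u
        have i2 := hh.qNum_exchange u u
        rw [sub_self, zero_add, hh.qNum_one] at i2
        linear_combination i2 - qNum h (u + 1) * i1
      rcases ha.2 with h' | h' <;> rw [h']
      · exact key _
      · have := key (x a.1 + -1)
        rw [neg_add_cancel_right] at this
        linear_combination this
    have sq0 : ∀ u, qNum h u ^ 2 = (qCosh h (2 * u) - qCosh h 0) / qDen h := fun u => by
      rw [pow_two, qNum_mul_eq (u := 2 * u) (v := 0) (by ring) (by ring)]
    have hsq : (oddCoeffPart h s K Z z y (0, 0) * ∏ j ∈ J.erase a.1, qNum h (x j)) ^ 2 =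
        -((∏ k ∈ (J.erase a.1).disjSum Z, (ρ k - qCosh h 0)) /
          ∏ k ∈ K, (qCosh h (2 * y k) - qCosh h 0) * (qCosh h (2 * y k - 2) - qCosh h 0)) := by
      rw [Finset.prod_disjSum]
      have hyy : ∀ u, qNum h (u - 1) ^ 2 = (qCosh h (2 * u - 2) - qCosh h 0) / qDen h :=
        fun u => by rw [sq0, mul_sub, mul_one]
      simp only [oddCoeffPart, if_true, mul_pow, inv_pow, ← Finset.prod_pow, hyy, sq0, Complex.I_sq,
        hρ, Sum.elim_inl, Sum.elim_inr, div_mul_div_comm, Finset.prod_div_distrib, mul_pow,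
        Finset.prod_const]
      have hcZ : Z.card = r + e := by rw [hZ, Nat.card_Icc]; omega
      have hcK : K.card = r := by rw [hK, Nat.card_Icc]; omega
      have hpw : qDen h ^ r * qDen h ^ r = qDen h ^ (r + e) * qDen h ^ (J.erase a.1).card := by
        rw [← pow_add, ← pow_add]; congr 1; omega
      rw [hcZ, hcK, hpw]
      generalize ∏ k ∈ K, (qCosh h (2 * y k) - qCosh h 0) * (qCosh h (2 * y k - 2) - qCosh h 0) = Dn
      field_simp
    simp only [pathWeight, neg_zero, rowShift_zero]
    simp only [oddCoeff, psiM, if_true]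
    rw [p0, p1]
    linear_combination (evenCoeff s t J W K w x y a *
      (oddCoeffPart h s K Z z y (0, 0) * ∏ j ∈ J.erase a.1, qNum h (x j)) ^ 2) * hone +
      evenCoeff s t J W K w x y a * hsq
  have hint := odd_interpolation hh K ((J.erase a.1).disjSum Z) ρ y (by
      rw [Finset.card_disjSum, hZ, hK, Nat.card_Icc, Nat.card_Icc]; omega)
    (fun j hj => G.two_y_int (Finset.mem_Icc.1 hj).1 (Finset.mem_Icc.1 hj).2) hy1 G.y_gap_or
    (by
      intro i hi j hj hij
      obtain ⟨⟨k1, k2⟩, l1, l2⟩ := G.y_pinch hi hj hij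
      refine ⟨Sum.inl (j + (1 - e)), ?_, Sum.inr (j + e), Finset.inr_mem_disjSum.2 l1, by simp,
        by simp [hρ, k2], by simp [hρ, l2]⟩
      -- The moved entry of x cannot be pinched both before and after its move, so the root it would
      -- supply is not the omitted one.
      refine Finset.inl_mem_disjSum.2 (Finset.mem_erase.2 ⟨?_, k1⟩)
      intro hk
      have := (G'.y_pinch hi hj hij).1.2
      rw [hk, rowShift_self, ← hk, k2] at this
      exact ha0 (by linarith))
    (by
      intro j hj hj1
      obtain ⟨⟨k1, k2⟩, l1, l2⟩ := G.y_eq_one hj hj1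
      refine ⟨Sum.inl (j + (1 - e)), ?_, Sum.inr (j + e), Finset.inr_mem_disjSum.2 l1, by simp,
        by simp [hρ, k2], by simp [hρ, l2]⟩
      refine Finset.inl_mem_disjSum.2 (Finset.mem_erase.2 ⟨?_, k1⟩)
      intro hk
      have := (G'.y_eq_one hj hj1).1.2
      rw [hk, rowShift_self, ← hk, k2] at this
      exact ha0 (by linarith))
  have hfin := mul_one (-evenCoeff s t J W K w x y a)
  rw [← hint, mul_add, Finset.mul_sum] at hfin
  rw [Finset.sum_insert (by simp), hdiag, Finset.sum_product]
  refine Eq.trans ?_ hfin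
  congr 1
  refine Finset.sum_congr rfl fun j hj => ?_
  rw [Finset.sum_pair (by norm_num), hterm (j, 1) ⟨hj, Or.inl rfl⟩, hterm (j, -1) ⟨hj, Or.inr rfl⟩,
    ← mul_add]
  have b1 : oddBar y (j, 1) = y j := by simp [oddBar]
  have b2 : oddBar y (j, -1) = 1 - y j := by simp only [oddBar]; ring
  have b3 : qCosh h (2 * (1 - y j)) = qCosh h (2 * y j - 2) := by
    rw [← qCosh_neg]; congr 1; ring
  have b4 : qCosh h (2 * (1 - y j) - 2) = qCosh h (2 * y j) := by
    rw [← qCosh_neg]; congr 1; ring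
  simp only [b1, b2, b3, b4]

end

/-! ### Gaps between moves and cancellation for interlacing rows -/

/-- The moves in an even row with `p` entries. -/
def evenMoves (p : ℕ) : Finset (ℕ × ℚ) := Finset.Icc 1 p ×ˢ {1, -1}

/-- The moves in an odd row with `r` entries, including the trivial one. -/
def oddMoves (r : ℕ) : Finset (ℕ × ℚ) := insert (0, 0) (Finset.Icc 1 r ×ˢ {1, -1})

theorem mem_evenMoves {p : ℕ} {a : ℕ × ℚ} : a ∈ evenMoves p ↔ IsEvenMove (Finset.Icc 1 p) a := by
  simp [evenMoves, IsEvenMove]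

theorem mem_oddMoves {r : ℕ} {b : ℕ × ℚ} : b ∈ oddMoves r ↔ IsOddMove (Finset.Icc 1 r) b := by
  simp [oddMoves, IsOddMove, IsEvenMove, or_comm]

theorem IsEvenMove.inv {J : Finset ℕ} {a : ℕ × ℚ} (ha : IsEvenMove J a) :
    IsEvenMove J (a.1, -a.2) := by
  refine ⟨ha.1, ?_⟩
  rcases ha.2 with h | h <;> simp [h]

theorem IsOddMove.inv {J : Finset ℕ} {a : ℕ × ℚ} (ha : IsOddMove J a) :
    IsOddMove J (a.1, -a.2) := by
  rcases ha with ha | rfl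
  · exact Or.inl ha.inv
  · exact Or.inr (by simp)

theorem IsEvenMove.eq_of_fst {J : Finset ℕ} {a b : ℕ × ℚ} (ha : IsEvenMove J a)
    (hb : IsEvenMove J b) (h1 : a.1 = b.1) (h2 : b ≠ (a.1, -a.2)) : b = a := by
  obtain ⟨a1, a2⟩ := a
  obtain ⟨b1, b2⟩ := b
  obtain rfl : a1 = b1 := h1
  rcases ha.2 with h | h <;> rcases hb.2 with h' | h' <;> simp only at h h' <;> subst h <;>
    subst h' <;> simp_all

namespace GTRows
variable {e p r : ℕ} {w z x y : ℕ → ℚ} (G : GTRows e p r w z x y)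
include G

/-- Since 2c is an integer, reflection does not change the class of an entry modulo the integers; so
differences of reflected entries are integral even for half-integral patterns. -/
theorem bar_int : ∃ c : ℚ, (∀ a, IsEvenMove (Finset.Icc 1 p) a → ∃ n : ℤ, evenBar x a = c + n) ∧
    ∀ b, IsEvenMove (Finset.Icc 1 r) b → ∃ n : ℤ, oddBar y b = c + n := by
  obtain ⟨c, ⟨m, hm⟩, h1, h2, -⟩ := G.int
  refine ⟨c, fun a ha => ?_, fun b hb => ?_⟩
  · obtain ⟨n, hn⟩ := h1 a.1 (Finset.mem_Icc.1 ha.1).1 (Finset.mem_Icc.1 ha.1).2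
    rw [evenBar, hn]
    rcases ha.2 with h | h <;> rw [h]
    · exact ⟨n, by ring⟩
    · exact ⟨-m - n, by push_cast; rw [← hm]; ring⟩
  · obtain ⟨n, hn⟩ := h2 b.1 (Finset.mem_Icc.1 hb.1).1 (Finset.mem_Icc.1 hb.1).2
    rw [oddBar, hn]
    rcases hb.2 with h | h <;> rw [h]
    · exact ⟨n, by ring⟩
    · exact ⟨1 - m - n, by push_cast; rw [← hm]; ring⟩

theorem bar_sub_int {a b : ℕ × ℚ} (ha : IsEvenMove (Finset.Icc 1 p) a)
    (hb : IsOddMove (Finset.Icc 1 r) b) :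
    b.2 ≠ 0 → ∃ n : ℤ, oddBar y b - evenBar x a = n := by
  intro hb0
  rcases hb with hb | rfl
  · obtain ⟨c, h1, h2⟩ := G.bar_int
    obtain ⟨n, hn⟩ := h1 a ha
    obtain ⟨m, hm⟩ := h2 b hb
    exact ⟨m - n, by rw [hn, hm]; push_cast; ring⟩
  · exact absurd rfl hb0

/-- The two moves leave the row w fixed, so entries at different positions stay separated even when
one is taken before and the other after the moves. The mixed gaps give the distance 2 that
exchanging the moves requires. -/
theorem evenBar_gap {x' y' : ℕ → ℚ} {a₁ a₂ : ℕ × ℚ} (h₁ : IsEvenMove (Finset.Icc 1 p) a₁)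
    (h₂ : IsEvenMove (Finset.Icc 1 p) a₂) (hne : a₁.1 ≠ a₂.1) (hx1 : x' a₁.1 = x a₁.1 + a₁.2)
    (hx2 : x' a₂.1 = x a₂.1 + a₂.2) (G' : GTRows e p r w z x' y') :
    2 ≤ evenBar x a₂ - evenBar x a₁ ∨ evenBar x a₂ - evenBar x a₁ ≤ -2 := by
  have m1 := Finset.mem_Icc.1 h₁.1
  have m2 := Finset.mem_Icc.1 h₂.1
  simp only [evenBar]
  rcases lt_or_gt_of_ne hne with hlt | hlt
  · have g1 := abs_le.1 (le_sub_iff_add_le.2 (G.x_gap G' m1.1 hlt m2.2))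
    have g2 := abs_le.1 (le_sub_iff_add_le.2 (G'.x_gap G m1.1 hlt m2.2))
    have g3 := abs_le.1 (le_sub_iff_add_le.2 (G'.x_gap G' m1.1 hlt m2.2))
    rw [hx1] at g2 g3
    rw [hx2] at g1 g3
    obtain ⟨⟨_, _⟩, ⟨_, _⟩, _, _⟩ := And.intro g1 (And.intro g2 g3)
    rcases h₁.2 with e1 | e1 <;> rcases h₂.2 with e2 | e2 <;> rw [e1, e2] <;>
      first
      | (left; linarith)
      | (right; linarith)
  · have g1 := abs_le.1 (le_sub_iff_add_le.2 (G.x_gap G' m2.1 hlt m1.2))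
    have g2 := abs_le.1 (le_sub_iff_add_le.2 (G'.x_gap G m2.1 hlt m1.2))
    have g3 := abs_le.1 (le_sub_iff_add_le.2 (G'.x_gap G' m2.1 hlt m1.2))
    rw [hx2] at g2 g3
    rw [hx1] at g1 g3
    obtain ⟨⟨_, _⟩, ⟨_, _⟩, _, _⟩ := And.intro g1 (And.intro g2 g3)
    rcases h₁.2 with e1 | e1 <;> rcases h₂.2 with e2 | e2 <;> rw [e1, e2] <;>
      first
      | (left; linarith)
      | (right; linarith)

/-- As for even rows, with z as the fixed separating row and the lower bound 1 on odd-row entries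
handling opposite reflections. -/
theorem oddBar_gap {x' y' : ℕ → ℚ} {a₁ a₂ : ℕ × ℚ} (h₁ : IsEvenMove (Finset.Icc 1 r) a₁)
    (h₂ : IsEvenMove (Finset.Icc 1 r) a₂) (hne : a₁.1 ≠ a₂.1) (hy1 : y' a₁.1 = y a₁.1 + a₁.2)
    (hy2 : y' a₂.1 = y a₂.1 + a₂.2) (G' : GTRows e p r w z x' y') :
    2 ≤ oddBar y a₂ - oddBar y a₁ ∨ oddBar y a₂ - oddBar y a₁ ≤ -2 := by
  have m1 := Finset.mem_Icc.1 h₁.1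
  have m2 := Finset.mem_Icc.1 h₂.1
  have p1 := G.one_le_y m1.1 m1.2
  have p2 := G.one_le_y m2.1 m2.2
  have p3 := G'.one_le_y m1.1 m1.2
  have p4 := G'.one_le_y m2.1 m2.2
  rw [hy1] at p3
  rw [hy2] at p4
  simp only [oddBar]
  rcases lt_or_gt_of_ne hne with hlt | hlt
  · have g1 := G.y_gap G' m1.1 hlt m2.2
    have g2 := G'.y_gap G m1.1 hlt m2.2
    have g3 := G'.y_gap G' m1.1 hlt m2.2
    have g4 := G.y_gap G m1.1 hlt m2.2
    rw [hy1] at g2 g3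
    rw [hy2] at g1 g3
    rcases h₁.2 with e1 | e1 <;> rcases h₂.2 with e2 | e2 <;> rw [e1, e2] <;>
      first
      | (left; linarith)
      | (right; linarith)
  · have g1 := G.y_gap G' m2.1 hlt m1.2
    have g2 := G'.y_gap G m2.1 hlt m1.2
    have g3 := G'.y_gap G' m2.1 hlt m1.2
    have g4 := G.y_gap G m2.1 hlt m1.2
    rw [hy2] at g2 g3
    rw [hy1] at g1 g3
    rcases h₁.2 with e1 | e1 <;> rcases h₂.2 with e2 | e2 <;> rw [e1, e2] <;>
      first
      | (left; linarith)
      | (right; linarith)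

end GTRows

section
variable {h : ℂ} {s : ℚ → ℂ} (hs : IsEvenRoot h s) (hh : NotRootOfUnity h)
  {e p r : ℕ} {w z x y : ℕ → ℚ} (G : GTRows e p r w z x y)
include hs hh G

/-- Moves at the same position that are not mutually inverse must be equal, and that case is
`pathWeight_even_same`; otherwise the final array provides the gap for the exchange. -/
theorem even_moves_antisymm (t : ℚ → ℂ) {a₁ a₂ b : ℕ × ℚ} (hb : IsOddMove (Finset.Icc 1 r) b)
    (h₁ : IsEvenMove (Finset.Icc 1 p) a₁) (h₂ : IsEvenMove (Finset.Icc 1 p) a₂)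
    (hne : a₂ ≠ (a₁.1, -a₁.2))
    (G' : GTRows e p r w z (rowShift (rowShift x a₁) a₂) (rowShift y b)) :
    pathWeight (qTwo h)
        (fun y x => oddCoeff h s (Finset.Icc 1 r) (Finset.Icc 1 (r + e)) (Finset.Icc 1 p) z x y)
        (fun y x => evenCoeff s t (Finset.Icc 1 p) (Finset.Icc 1 (p - e)) (Finset.Icc 1 r) w x y)
        y x b a₁ a₂ +
      pathWeight (qTwo h)
        (fun y x => oddCoeff h s (Finset.Icc 1 r) (Finset.Icc 1 (r + e)) (Finset.Icc 1 p) z x y)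
        (fun y x => evenCoeff s t (Finset.Icc 1 p) (Finset.Icc 1 (p - e)) (Finset.Icc 1 r) w x y)
        y x b a₂ a₁ = 0 := by
  by_cases h12 : a₁.1 = a₂.1
  · obtain rfl := h₁.eq_of_fst h₂ h12 hne
    rw [pathWeight_even_same hs hh t _ _ _ _ w z x y _ _ h₁ hb (G.bar_sub_int h₁ hb), add_zero]
  · refine pathWeight_even_even hs hh t _ _ _ _ w z x y b a₁ a₂ hb h₁ h₂ h12
      (G.bar_sub_int h₁ hb) (G.bar_sub_int h₂ hb) ?_
    refine evenCoeffPart_exchange hs hh t _ _ w x a₁ a₂ h₁ h₂ h12 ?_ ?_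
    · obtain ⟨c, i1, -⟩ := G.bar_int
      obtain ⟨n, hn⟩ := i1 a₁ h₁
      obtain ⟨m, hm⟩ := i1 a₂ h₂
      exact ⟨m - n, by rw [hn, hm]; push_cast; ring⟩
    · refine G.evenBar_gap h₁ h₂ h12 ?_ ?_ G'
      · rw [rowShift_ne _ h12, rowShift_self]
      · rw [rowShift_self, rowShift_ne _ (Ne.symm h12)]

theorem odd_moves_antisymm (t : ℚ → ℂ) {a b₁ b₂ : ℕ × ℚ} (ha : IsEvenMove (Finset.Icc 1 p) a)
    (h₁ : IsOddMove (Finset.Icc 1 r) b₁) (h₂ : IsOddMove (Finset.Icc 1 r) b₂)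
    (hne : b₂ ≠ (b₁.1, -b₁.2))
    (G' : GTRows e p r w z (rowShift x a) (rowShift (rowShift y b₁) b₂)) :
    pathWeight (qTwo h)
        (evenCoeff s t (Finset.Icc 1 p) (Finset.Icc 1 (p - e)) (Finset.Icc 1 r) w)
        (oddCoeff h s (Finset.Icc 1 r) (Finset.Icc 1 (r + e)) (Finset.Icc 1 p) z)
        x y a b₁ b₂ +
      pathWeight (qTwo h)
        (evenCoeff s t (Finset.Icc 1 p) (Finset.Icc 1 (p - e)) (Finset.Icc 1 r) w)
        (oddCoeff h s (Finset.Icc 1 r) (Finset.Icc 1 (r + e)) (Finset.Icc 1 p) z)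
        x y a b₂ b₁ = 0 := by
  -- For reflected entry ±1 a denominator of the diagonal term vanishes on one side of the move. The
  -- entry of y is then 1 before or after the move and pinches an entry of z to 0, so the product
  -- over z vanishes as well.
  have hdiag : ∀ b, IsEvenMove (Finset.Icc 1 r) b →
      GTRows e p r w z (rowShift x a) (rowShift y b) →
      PartsExchange h (oddCoeffPart h s (Finset.Icc 1 r) (Finset.Icc 1 (r + e)) z) y b (0, 0)
        (-oddBar y b) := by
    intro b hb G''
    have hbm := Finset.mem_Icc.1 hb.1
    refine oddCoeffPart_exchange_diag hh _ _ (by simp) z y b hb (G.two_y_int hbm.1 hbm.2) ?_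
    intro hv
    have p1 := G.one_le_y hbm.1 hbm.2
    have p2 := G''.one_le_y hbm.1 hbm.2
    rw [rowShift_self] at p2
    have key : z (b.1 + e) = 0 ∧ b.1 + e ∈ Finset.Icc 1 (r + e) := by
      have : y b.1 = 1 ∨ rowShift y b b.1 = 1 := by
        rw [rowShift_self]
        rw [oddBar] at hv
        rcases hb.2 with h' | h' <;> rw [h'] at hv p2 ⊢ <;> rcases hv with hv | hv
        · left; linarith
        · left; linarith
        · right; linarith
        · right; linarith
      rcases this with h' | h'
      · exact (G.y_eq_one hb.1 h').2.symm
      · exact (G''.y_eq_one hb.1 h').2.symm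
    exact Finset.prod_eq_zero key.2 (by rw [key.1, qNum_zero])
  by_cases h12 : b₁.1 = b₂.1
  · rcases h₁ with h₁ | rfl
    · rcases h₂ with h₂ | rfl
      · obtain rfl := h₁.eq_of_fst h₂ h12 hne
        rw [pathWeight_odd_same hs hh t _ _ _ _ w z x y _ _ ha h₁
          (G.bar_sub_int ha (Or.inl h₁) h₁.ne_zero), add_zero]
      · have := (Finset.mem_Icc.1 h₁.1).1
        simp only at h12; omega
    · rcases h₂ with h₂ | rfl
      · have := (Finset.mem_Icc.1 h₂.1).1
        simp only at h12; omega
      · simp at hne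
  · refine pathWeight_odd_odd hs hh t _ _ _ _ w z x y a b₁ b₂ ha h₁ h₂ h12
      (G.bar_sub_int ha h₁) (G.bar_sub_int ha h₂) ?_
    rcases h₁ with h₁ | rfl
    · rcases h₂ with h₂ | rfl
      · refine oddCoeffPart_exchange hs hh _ _ z y b₁ b₂ h₁ h₂ h12 ?_ ?_
        · obtain ⟨c, -, i1⟩ := G.bar_int
          obtain ⟨n, hn⟩ := i1 b₁ h₁
          obtain ⟨m, hm⟩ := i1 b₂ h₂
          exact ⟨m - n, by rw [hn, hm]; push_cast; ring⟩
        · refine G.oddBar_gap h₁ h₂ h12 ?_ ?_ G'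
          · rw [rowShift_ne _ h12, rowShift_self]
          · rw [rowShift_self, rowShift_ne _ (Ne.symm h12)]
      · rw [rowShift_zero] at G'
        rw [oddBar_zero, zero_sub]
        exact hdiag b₁ h₁ G'
    · rcases h₂ with h₂ | rfl
      · rw [rowShift_zero] at G'
        have := (hdiag b₂ h₂ G').symm
        rw [neg_neg] at this
        rwa [oddBar_zero, sub_zero]
      · exact absurd rfl h12

end

/-! ## Patterns in terms of interlacing rows -/

/-- Interlacing follows from the inequalities between neighbouring entries. -/
theorem Interlaced.of_chain {e p r : ℕ} {x y : ℕ → ℚ} (he : e ≤ 1) (hr : r + 1 = p + e)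
    (h1 : ∀ j, 1 ≤ j → j + e ≤ r → y (j + e) ≤ x j)
    (h2 : ∀ j k, 1 ≤ j → j ≤ p → 1 ≤ k → k + 1 = j + e → x j + 1 ≤ y k)
    (h3 : 1 ≤ p → 1 ≤ r → -x p + 1 ≤ y r) : Interlaced e p r x y := by
  have hstep : ∀ k, 1 ≤ k → k < r → y (k + 1) ≤ y k := by
    intro k hk hkr
    have a1 := h1 (k + 1 - e) (by omega) (by omega)
    have a2 := h2 (k + 1 - e) k (by omega) (by omega) hk (by omega)
    rw [show k + 1 - e + e = k + 1 by omega] at a1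
    linarith
  have hanti : ∀ k l, 1 ≤ k → k ≤ l → l ≤ r → y l ≤ y k := by
    intro k l hk hkl
    induction l, hkl using Nat.le_induction with
    | base => exact fun _ => le_rfl
    | succ l hl ih => exact fun hlr => (hstep l (by omega) (by omega)).trans (ih (by omega))
  intro j k hj hjp hk hkr
  refine ⟨fun hlt => ?_, fun hle => (hanti (j + e) k (by omega) hle hkr).trans
    (h1 j hj (by omega))⟩
  have a1 := h2 j (j + e - 1) hj hjp (by omega) (by omega)
  have a2 := hanti k (j + e - 1) hk (by omega) (by omega)
  have a3 := hanti k r hk hkr le_rfl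
  have a4 := h3 (by omega) (by omega)
  have a5 := h2 p r (by omega) le_rfl (by omega) (by omega)
  rw [← le_sub_iff_add_le, abs_le]
  refine ⟨?_, by linarith⟩
  rcases lt_or_eq_of_le hjp with hlt | rfl
  · have b1 := h1 j hj (by omega)
    have b2 := hanti (j + e) r (by omega) (by omega) le_rfl
    linarith
  · linarith

theorem ell_even (α : ℕ → ℕ → ℚ) (p j : ℕ) : ell α (2 * p) j = α (2 * p) j + p - j := by
  rw [ell, if_pos (even_two_mul p), Nat.mul_div_cancel_left _ two_pos]

theorem ell_odd (α : ℕ → ℕ → ℚ) (p j : ℕ) :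
    ell α (2 * p + 1) j = α (2 * p + 1) j + p - j + 1 := by
  rw [ell, if_neg (by simp), show (2 * p + 1) / 2 = p by omega]

theorem shiftEntry_self (α : ℕ → ℕ → ℚ) (k j : ℕ) (x : ℚ) :
    shiftEntry α k j x k = rowShift (α k) (j, x) := by
  simp [shiftEntry, rowShift]

theorem shiftEntry_ne (α : ℕ → ℕ → ℚ) {k k' : ℕ} (hk : k' ≠ k) (j : ℕ) (x : ℚ) :
    shiftEntry α k j x k' = α k' := by
  simp [shiftEntry, hk]

theorem ell_eq_add (k : ℕ) : ∃ c : ℕ → ℚ, ∀ (α : ℕ → ℕ → ℚ) j, ell α k j = α k j + c j := by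
  refine ⟨fun j => if Even k then (k / 2 : ℕ) - j else (k / 2 : ℕ) - j + 1, fun α j => ?_⟩
  rw [ell]; split_ifs <;> ring

theorem ell_shiftEntry_self (α : ℕ → ℕ → ℚ) (k : ℕ) (a : ℕ × ℚ) :
    ell (shiftEntry α k a.1 a.2) k = rowShift (ell α k) a := by
  obtain ⟨c, hc⟩ := ell_eq_add k
  funext j
  rw [hc, shiftEntry_self]
  rcases eq_or_ne j a.1 with rfl | hj
  · rw [show rowShift (α k) (a.1, a.2) a.1 = α k a.1 + a.2 from rowShift_self _ _,
      rowShift_self, hc]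
    ring
  · rw [rowShift_ne _ hj, rowShift_ne _ (show j ≠ (a.1, a.2).1 from hj), hc]

theorem ell_shiftEntry_ne (α : ℕ → ℕ → ℚ) {k k' : ℕ} (hk : k' ≠ k) (j : ℕ) (x : ℚ) :
    ell (shiftEntry α k j x) k' = ell α k' := by
  funext i
  rw [ell, ell, shiftEntry_ne α hk]

/-- The coordinates `ell` differ from the entries by constants, so identities between shifted arrays
can be verified on the rows of `ell`. -/
theorem shiftEntry_ext {α β : ℕ → ℕ → ℚ} (h : ∀ k, ell α k = ell β k) : α = β := by
  funext k j
  obtain ⟨c, hc⟩ := ell_eq_add k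
  have := congrFun (h k) j
  rw [hc, hc] at this
  exact add_right_cancel this

theorem shiftEntry_comm (α : ℕ → ℕ → ℚ) (k k' : ℕ) (a b : ℕ × ℚ) :
    shiftEntry (shiftEntry α k a.1 a.2) k' b.1 b.2 =
      shiftEntry (shiftEntry α k' b.1 b.2) k a.1 a.2 := by
  refine shiftEntry_ext fun l => ?_
  by_cases h1 : l = k
  · subst h1
    by_cases h2 : l = k'
    · subst h2
      simp only [ell_shiftEntry_self, rowShift_comm]
    · simp only [ell_shiftEntry_self, ell_shiftEntry_ne _ h2]
  · by_cases h2 : l = k'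
    · subst h2
      simp only [ell_shiftEntry_self, ell_shiftEntry_ne _ h1]
    · simp only [ell_shiftEntry_ne _ h1, ell_shiftEntry_ne _ h2]

theorem shiftEntry_back (α : ℕ → ℕ → ℚ) (k : ℕ) (a : ℕ × ℚ) :
    shiftEntry (shiftEntry α k a.1 a.2) k a.1 (-a.2) = α := by
  refine shiftEntry_ext fun l => ?_
  by_cases h1 : l = k
  · subst h1
    rw [ell_shiftEntry_self _ _ (a.1, -a.2), ell_shiftEntry_self, rowShift_back]
  · simp only [ell_shiftEntry_ne _ h1]

theorem shiftEntry_zero (α : ℕ → ℕ → ℚ) (k j : ℕ) : shiftEntry α k j 0 = α := by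
  simp [shiftEntry]

theorem interlaced_of_odd_row {α : ℕ → ℕ → ℚ} {p : ℕ}
    (h : (∀ j, 1 ≤ j → j ≤ p → α (2 * p) j ≤ α (2 * p + 1) j) ∧
    (∀ j, 1 ≤ j → j < p → α (2 * p + 1) (j + 1) ≤ α (2 * p) j) ∧
    -α (2 * p + 1) p ≤ α (2 * p) p) :
    Interlaced 1 p p (ell α (2 * p)) (ell α (2 * p + 1)) := by
  refine Interlaced.of_chain le_rfl rfl (fun j hj hjp => ?_) (fun j k hj hjp hk hkj => ?_)
    fun _ _ => ?_
  · have := h.2.1 j hj (by omega)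
    rw [ell_even, ell_odd]; push_cast; linarith
  · obtain rfl : k = j := by omega
    have := h.1 k hj hjp
    rw [ell_even, ell_odd]; linarith
  · have := h.2.2
    rw [ell_even, ell_odd]; linarith

theorem interlaced_of_even_row {α : ℕ → ℕ → ℚ} {p : ℕ} (hp : 1 ≤ p)
    (h : (∀ j, 1 ≤ j → j ≤ p → α (2 * p + 1) j ≤ α (2 * p + 2) j) ∧
    (∀ j, 1 ≤ j → j < p → α (2 * p + 2) (j + 1) ≤ α (2 * p + 1) j) ∧
    |α (2 * p + 2) (p + 1)| ≤ α (2 * p + 1) p) :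
    Interlaced 0 (p + 1) p (ell α (2 * p + 2)) (ell α (2 * p + 1)) := by
  have h3 := abs_le.1 h.2.2
  rw [show 2 * p + 2 = 2 * (p + 1) by ring] at *
  refine Interlaced.of_chain (by omega) rfl (fun j hj hjp => ?_) (fun j k hj hjp hk hkj => ?_)
    fun _ _ => ?_
  · have := h.1 j hj (by omega)
    rw [ell_even, ell_odd, add_zero]; push_cast; linarith
  · obtain rfl : j = k + 1 := by omega
    rw [ell_even, ell_odd]; push_cast
    rcases lt_or_eq_of_le (show k ≤ p by omega) with hlt | rfl
    · have := h.2.1 k hk hlt; linarith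
    · linarith
  · rw [ell_even, ell_odd]; push_cast; linarith

theorem odd_row_of_interlaced {α : ℕ → ℕ → ℚ} {p : ℕ} (hp : 1 ≤ p)
    (h : Interlaced 1 p p (ell α (2 * p)) (ell α (2 * p + 1))) :
    (∀ j, 1 ≤ j → j ≤ p → α (2 * p) j ≤ α (2 * p + 1) j) ∧
    (∀ j, 1 ≤ j → j < p → α (2 * p + 1) (j + 1) ≤ α (2 * p) j) ∧
    -α (2 * p + 1) p ≤ α (2 * p) p := by
  refine ⟨fun j hj hjp => ?_, fun j hj hjp => ?_, ?_⟩
  · have := abs_le.1 (le_sub_iff_add_le.2 ((h j j hj hjp hj hjp).1 (by omega)))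
    rw [ell_even, ell_odd] at this; linarith
  · have := (h j (j + 1) hj (by omega) (by omega) (by omega)).2 le_rfl
    rw [ell_even, ell_odd] at this; push_cast at this; linarith
  · have := abs_le.1 (le_sub_iff_add_le.2 ((h p p hp le_rfl hp le_rfl).1 (by omega)))
    rw [ell_even, ell_odd] at this; linarith

theorem even_row_of_interlaced {α : ℕ → ℕ → ℚ} {p : ℕ} (hp : 1 ≤ p)
    (h : Interlaced 0 (p + 1) p (ell α (2 * p + 2)) (ell α (2 * p + 1))) :
    (∀ j, 1 ≤ j → j ≤ p → α (2 * p + 1) j ≤ α (2 * p + 2) j) ∧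
    (∀ j, 1 ≤ j → j < p → α (2 * p + 2) (j + 1) ≤ α (2 * p + 1) j) ∧
    |α (2 * p + 2) (p + 1)| ≤ α (2 * p + 1) p := by
  rw [show 2 * p + 2 = 2 * (p + 1) by ring] at *
  refine ⟨fun j hj hjp => ?_, fun j hj hjp => ?_, ?_⟩
  · have := (h j j hj (by omega) hj hjp).2 le_rfl
    rw [ell_even, ell_odd] at this; push_cast at this; linarith
  · have := abs_le.1 (le_sub_iff_add_le.2 ((h (j + 1) j (by omega) (by omega) hj (by omega)).1
      (by omega)))
    rw [ell_even, ell_odd] at this; push_cast at this; linarith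
  · have := abs_le.1 (le_sub_iff_add_le.2 ((h (p + 1) p (by omega) (by omega) hp (by omega)).1
      (by omega)))
    rw [ell_even, ell_odd] at this; push_cast at this
    rw [abs_le]; constructor <;> linarith

namespace IsGTPattern
variable {n : ℕ} {m : ℕ → ℚ} {α : ℕ → ℕ → ℚ} (hα : IsGTPattern n m α)
include hα

theorem interlaced_up {p : ℕ} (hpn : 2 * p + 1 ≤ n) :
    Interlaced 1 p p (ell α (2 * p)) (ell α (2 * p + 1)) := by
  rcases Nat.eq_zero_or_pos p with rfl | hp
  · intro j k hj hj'; omega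
  · exact interlaced_of_odd_row (hα.odd_row p hp hpn)

theorem interlaced_down {p : ℕ} (hpn : 2 * p + 2 ≤ n) :
    Interlaced 0 (p + 1) p (ell α (2 * p + 2)) (ell α (2 * p + 1)) := by
  rcases Nat.eq_zero_or_pos p with rfl | hp
  · intro j k hj hj' hk hk'; omega
  · exact interlaced_of_even_row hp (hα.even_row p hp hpn)

theorem ell_int {k j : ℕ} (h2 : 2 ≤ k) (hkn : k ≤ n) (hj : 1 ≤ j) (hjk : j ≤ k / 2) :
    ∃ z : ℤ, ell α k j = m 1 + z := by
  obtain ⟨z, hz⟩ := hα.integral k j h2 hkn hj hjk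
  rw [ell]
  generalize k / 2 = q
  split_ifs
  · exact ⟨z + q - j, by push_cast; linarith⟩
  · exact ⟨z + q - j + 1, by push_cast; linarith⟩

theorem rows_up (hm : ∃ z : ℤ, 2 * m 1 = z) {p : ℕ} (hp : 1 ≤ p) (hpn : 2 * p + 2 ≤ n) :
    GTRows 1 p p (ell α (2 * p - 1)) (ell α (2 * p + 2)) (ell α (2 * p)) (ell α (2 * p + 1)) where
  he := le_rfl
  hp := hp
  hr := rfl
  xy := hα.interlaced_up (by omega)
  xw := by
    obtain ⟨q, rfl⟩ : ∃ q, p = q + 1 := ⟨p - 1, by omega⟩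
    exact hα.interlaced_down (by omega)
  zy := hα.interlaced_down hpn
  int := ⟨m 1, hm, fun j h1 h2 => hα.ell_int (by omega) (by omega) h1 (by omega),
    fun j h1 h2 => hα.ell_int (by omega) (by omega) h1 (by omega),
    fun j h1 h2 => hα.ell_int (by omega) (by omega) h1 (by omega),
    fun j h1 h2 => hα.ell_int (by omega) (by omega) h1 (by omega)⟩

theorem rows_down (hm : ∃ z : ℤ, 2 * m 1 = z) {p : ℕ} (hpn : 2 * p + 3 ≤ n) :
    GTRows 0 (p + 1) p (ell α (2 * p + 3)) (ell α (2 * p)) (ell α (2 * p + 2))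
      (ell α (2 * p + 1)) where
  he := by omega
  hp := by omega
  hr := rfl
  xy := hα.interlaced_down (by omega)
  xw := hα.interlaced_up (p := p + 1) (by omega)
  zy := hα.interlaced_up (by omega)
  int := ⟨m 1, hm, fun j h1 h2 => hα.ell_int (by omega) (by omega) h1 (by omega),
    fun j h1 h2 => hα.ell_int (by omega) (by omega) h1 (by omega),
    fun j h1 h2 => hα.ell_int (by omega) (by omega) h1 (by omega),
    fun j h1 h2 => hα.ell_int (by omega) (by omega) h1 (by omega)⟩

/-- A shift in row k only affects the interlacing with rows k - 1 and k + 1, so these two conditions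
suffice. The condition k < n keeps the top row fixed. -/
theorem shiftEntry_of_interlaced {k : ℕ} (hkn : k < n) {a : ℕ × ℚ} (ha : 1 ≤ a.1)
    (hak : a.1 ≤ k / 2) (hint : ∃ z : ℤ, a.2 = z)
    (hup : ∀ p, 1 ≤ p → 2 * p + 1 ≤ n → k = 2 * p ∨ k = 2 * p + 1 →
      Interlaced 1 p p (ell (shiftEntry α k a.1 a.2) (2 * p))
        (ell (shiftEntry α k a.1 a.2) (2 * p + 1)))
    (hdown : ∀ p, 1 ≤ p → 2 * p + 2 ≤ n → k = 2 * p + 2 ∨ k = 2 * p + 1 →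
      Interlaced 0 (p + 1) p (ell (shiftEntry α k a.1 a.2) (2 * p + 2))
        (ell (shiftEntry α k a.1 a.2) (2 * p + 1))) :
    IsGTPattern n m (shiftEntry α k a.1 a.2) where
  support i j hij := by
    rcases eq_or_ne i k with rfl | hik
    · rw [shiftEntry_self, rowShift_ne, hα.support i j hij]
      rintro rfl
      apply hij
      dsimp only at *
      omega
    · rw [shiftEntry_ne _ hik, hα.support i j hij]
  top j h1 h2 := by rw [shiftEntry_ne _ (by omega), hα.top j h1 h2]
  integral i j h2 hin h1 hj := by
    obtain ⟨z, hz⟩ := hα.integral i j h2 hin h1 hj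
    rcases eq_or_ne i k with rfl | hik
    · rw [shiftEntry_self]
      rcases eq_or_ne j a.1 with rfl | hja
      · obtain ⟨z', hz'⟩ := hint
        have := rowShift_self (α i) (a.1, a.2)
        dsimp only at this
        exact ⟨z + z', by rw [this, hz']; push_cast; linarith⟩
      · exact ⟨z, by rw [rowShift_ne _ hja, hz]⟩
    · rw [shiftEntry_ne _ hik]; exact ⟨z, hz⟩
  odd_row p hp hpn := by
    by_cases hk : k = 2 * p ∨ k = 2 * p + 1
    · exact odd_row_of_interlaced hp (hup p hp hpn hk)
    · push Not at hk
      rw [shiftEntry_ne _ hk.1.symm, shiftEntry_ne _ hk.2.symm]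
      exact hα.odd_row p hp hpn
  even_row p hp hpn := by
    by_cases hk : k = 2 * p + 2 ∨ k = 2 * p + 1
    · exact even_row_of_interlaced hp (hdown p hp hpn hk)
    · push Not at hk
      rw [shiftEntry_ne _ hk.1.symm, shiftEntry_ne _ hk.2.symm]
      exact hα.even_row p hp hpn

end IsGTPattern

theorem IsHighestWeight.two_mul_int {n : ℕ} {m : ℕ → ℚ} (hn : 2 ≤ n) (hm : IsHighestWeight n m) :
    ∃ z : ℤ, 2 * m 1 = z := by
  rcases hm.1 with h | h
  · obtain ⟨z, hz⟩ := h 1 le_rfl (by omega)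
    exact ⟨2 * z, by rw [hz]; push_cast; ring⟩
  · obtain ⟨z, hz⟩ := h 1 le_rfl (by omega)
    exact ⟨2 * z + 1, by rw [hz]; push_cast; ring⟩

/-! ### Moves that leave the set of patterns -/

/-- A move that breaks the interlacing has a vanishing factor. -/
theorem exists_phi_eq_zero {h : ℂ} {s : ℚ → ℂ} (hs : IsEvenRoot h s) {e p r : ℕ} {x y : ℕ → ℚ}
    (hxy : Interlaced e p r x y) {c : ℚ} (hc : ∃ n : ℤ, 2 * c = n)
    (hx : ∀ j, 1 ≤ j → j ≤ p → ∃ n : ℤ, x j = c + n)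
    (hy : ∀ j, 1 ≤ j → j ≤ r → ∃ n : ℤ, y j = c + n) {a : ℕ × ℚ}
    (ha : IsEvenMove (Finset.Icc 1 p) a) (hn : ¬Interlaced e p r (rowShift x a) y) :
    ∃ k ∈ Finset.Icc 1 r, phi s (y k) (evenBar x a) = 0 := by
  by_contra! hne
  refine hn fun j k hj hjp hk hkr => ?_
  rcases eq_or_ne j a.1 with rfl | hja
  · have hk0 := hne k (Finset.mem_Icc.2 ⟨hk, hkr⟩)
    obtain ⟨l, hl⟩ := hc
    obtain ⟨n1, hn1⟩ := hx _ hj hjp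
    obtain ⟨n2, hn2⟩ := hy k hk hkr
    -- The zeros of `phi` are the walls of the interlacing region. The distances to the walls are
    -- integers, so a distance that is nonnegative and nonzero is at least 1, leaving room for a
    -- unit step.
    have k1 : y k + evenBar x a ≠ 0 := fun h0 => hk0 (by rw [phi, h0, hs.zero, zero_mul])
    have k2 : y k - evenBar x a - 1 ≠ 0 := fun h0 => hk0 (by rw [phi, h0, hs.zero, mul_zero])
    rw [rowShift_self]
    rw [evenBar] at k1 k2
    refine ⟨fun hlt => ?_, fun hle => ?_⟩
    · have h1 := abs_le.1 (le_sub_iff_add_le.2 ((hxy a.1 k hj hjp hk hkr).1 hlt))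
      rw [← le_sub_iff_add_le, abs_le]
      rcases ha.2 with e1 | e1 <;> rw [e1] at k2 ⊢
      · have : (0 : ℤ) < n2 - n1 - 1 := by
          refine lt_of_le_of_ne ?_ fun h0 => k2 ?_
          · have : (0 : ℚ) ≤ ((n2 - n1 - 1 : ℤ) : ℚ) := by push_cast; linarith
            exact_mod_cast this
          · have : (0 : ℚ) = ((n2 - n1 - 1 : ℤ) : ℚ) := by rw [← h0]; simp
            push_cast at this; linarith
        have : (1 : ℚ) ≤ ((n2 - n1 - 1 : ℤ) : ℚ) := by exact_mod_cast this
        push_cast at this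
        constructor <;> linarith
      · have : (0 : ℤ) < n2 + n1 + l - 1 := by
          refine lt_of_le_of_ne ?_ fun h0 => k2 ?_
          · have : (0 : ℚ) ≤ ((n2 + n1 + l - 1 : ℤ) : ℚ) := by push_cast; linarith
            exact_mod_cast this
          · have : (0 : ℚ) = ((n2 + n1 + l - 1 : ℤ) : ℚ) := by rw [← h0]; simp
            push_cast at this; linarith
        have : (1 : ℚ) ≤ ((n2 + n1 + l - 1 : ℤ) : ℚ) := by exact_mod_cast this
        push_cast at this
        constructor <;> linarith
    · have h1 := (hxy a.1 k hj hjp hk hkr).2 hle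
      rcases ha.2 with e1 | e1 <;> rw [e1] at k1 ⊢
      · linarith
      · have : (0 : ℤ) < n1 - n2 := by
          refine lt_of_le_of_ne ?_ fun h0 => k1 ?_
          · have : (0 : ℚ) ≤ ((n1 - n2 : ℤ) : ℚ) := by push_cast; linarith
            exact_mod_cast this
          · have : (0 : ℚ) = ((n1 - n2 : ℤ) : ℚ) := by rw [← h0]; simp
            push_cast at this; linarith
        have : (1 : ℚ) ≤ ((n1 - n2 : ℤ) : ℚ) := by exact_mod_cast this
        push_cast at this
        linarith
  · rw [rowShift_ne _ hja]
    exact hxy j k hj hjp hk hkr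

/-- Again a unit step crosses a wall only if the entry stands on it, by integrality, and the walls
are the zeros of `psi`. Lowering can meet both x_j and -x_j. -/
theorem exists_psi_eq_zero {h : ℂ} {s : ℚ → ℂ} (hs : IsEvenRoot h s) {e p r : ℕ} {x y : ℕ → ℚ}
    (hxy : Interlaced e p r x y) {c : ℚ} (hc : ∃ n : ℤ, 2 * c = n)
    (hx : ∀ j, 1 ≤ j → j ≤ p → ∃ n : ℤ, x j = c + n)
    (hy : ∀ j, 1 ≤ j → j ≤ r → ∃ n : ℤ, y j = c + n) {b : ℕ × ℚ}
    (hb : IsEvenMove (Finset.Icc 1 r) b) (hn : ¬Interlaced e p r x (rowShift y b)) :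
    ∃ j ∈ Finset.Icc 1 p, psi s (x j) (oddBar y b) = 0 := by
  by_contra! hne
  refine hn fun j k hj hjp hk hkr => ?_
  rcases eq_or_ne k b.1 with rfl | hkb
  · have hj0 := hne j (Finset.mem_Icc.2 ⟨hj, hjp⟩)
    obtain ⟨l, hl⟩ := hc
    obtain ⟨n1, hn1⟩ := hx _ hj hjp
    obtain ⟨n2, hn2⟩ := hy _ hk hkr
    have k1 : x j + oddBar y b ≠ 0 := fun h0 => hj0 (by rw [psi, h0, hs.zero, zero_mul])
    have k2 : x j - oddBar y b ≠ 0 := fun h0 => hj0 (by rw [psi, h0, hs.zero, mul_zero])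
    rw [rowShift_self]
    rw [oddBar] at k1 k2
    refine ⟨fun hlt => ?_, fun hle => ?_⟩
    · have h1 := abs_le.1 (le_sub_iff_add_le.2 ((hxy j b.1 hj hjp hk hkr).1 hlt))
      rw [← le_sub_iff_add_le, abs_le]
      rcases hb.2 with e1 | e1 <;> rw [e1] at k1 k2 ⊢
      · constructor <;> linarith
      · have t1 : (0 : ℤ) < n2 - n1 - 1 := by
          refine lt_of_le_of_ne ?_ fun h0 => k1 ?_
          · have : (0 : ℚ) ≤ ((n2 - n1 - 1 : ℤ) : ℚ) := by push_cast; linarith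
            exact_mod_cast this
          · have : (0 : ℚ) = ((n2 - n1 - 1 : ℤ) : ℚ) := by rw [← h0]; simp
            push_cast at this; linarith
        have t2 : (0 : ℤ) < n2 + n1 + l - 1 := by
          refine lt_of_le_of_ne ?_ fun h0 => k2 ?_
          · have : (0 : ℚ) ≤ ((n2 + n1 + l - 1 : ℤ) : ℚ) := by push_cast; linarith
            exact_mod_cast this
          · have : (0 : ℚ) = ((n2 + n1 + l - 1 : ℤ) : ℚ) := by rw [← h0]; simp
            push_cast at this; linarith
        have t1' : (1 : ℚ) ≤ ((n2 - n1 - 1 : ℤ) : ℚ) := by exact_mod_cast t1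
        have t2' : (1 : ℚ) ≤ ((n2 + n1 + l - 1 : ℤ) : ℚ) := by exact_mod_cast t2
        push_cast at t1' t2'
        constructor <;> linarith
    · have h1 := (hxy j b.1 hj hjp hk hkr).2 hle
      rcases hb.2 with e1 | e1 <;> rw [e1] at k2 ⊢
      · have : (0 : ℤ) < n1 - n2 := by
          refine lt_of_le_of_ne ?_ fun h0 => k2 ?_
          · have : (0 : ℚ) ≤ ((n1 - n2 : ℤ) : ℚ) := by push_cast; linarith
            exact_mod_cast this
          · have : (0 : ℚ) = ((n1 - n2 : ℤ) : ℚ) := by rw [← h0]; simp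
            push_cast at this; linarith
        have : (1 : ℚ) ≤ ((n1 - n2 : ℤ) : ℚ) := by exact_mod_cast this
        push_cast at this
        linarith
      · linarith
  · rw [rowShift_ne _ hkb]
    exact hxy j k hj hjp hk hkr

/-! ## The relations on patterns -/

section pair
variable {h : ℂ} {s t : ℚ → ℂ} (hs : IsEvenRoot h s) (hh : NotRootOfUnity h)
  (ht : ∀ b, t b ^ 2 = qHalf h b) {n : ℕ} {m : ℕ → ℚ} {e p r kx ky kw kz : ℕ}
  (hxy : kx ≠ ky) (hwx : kw ≠ kx) (hwy : kw ≠ ky) (hzx : kz ≠ kx) (hzy : kz ≠ ky)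
  (hG : ∀ γ, IsGTPattern n m γ → GTRows e p r (ell γ kw) (ell γ kz) (ell γ kx) (ell γ ky))
  (U V : GTSpace n m →ₗ[ℂ] GTSpace n m)
  (hU : ∀ γ, IsGTPattern n m γ → U (ket n m γ) = ∑ u ∈ evenMoves p,
    evenCoeff s t (Finset.Icc 1 p) (Finset.Icc 1 (p - e)) (Finset.Icc 1 r) (ell γ kw) (ell γ kx)
      (ell γ ky) u • ket n m (shiftEntry γ kx u.1 u.2))
  (hV : ∀ γ, IsGTPattern n m γ → V (ket n m γ) = ∑ v ∈ oddMoves r,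
    oddCoeff h s (Finset.Icc 1 r) (Finset.Icc 1 (r + e)) (Finset.Icc 1 p) (ell γ kz) (ell γ kx)
      (ell γ ky) v • ket n m (shiftEntry γ ky v.1 v.2))
  (hU0 : ∀ γ, IsGTPattern n m γ → ∀ u ∈ evenMoves p, ¬IsGTPattern n m (shiftEntry γ kx u.1 u.2) →
    evenCoeff s t (Finset.Icc 1 p) (Finset.Icc 1 (p - e)) (Finset.Icc 1 r) (ell γ kw) (ell γ kx)
      (ell γ ky) u = 0)
  (hV0 : ∀ γ, IsGTPattern n m γ → ∀ v ∈ oddMoves r, ¬IsGTPattern n m (shiftEntry γ ky v.1 v.2) →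
    oddCoeff h s (Finset.Icc 1 r) (Finset.Icc 1 (r + e)) (Finset.Icc 1 p) (ell γ kz) (ell γ kx)
      (ell γ ky) v = 0)
include hs hh ht hxy hwx hwy hzx hzy hG hU hV hU0 hV0

/-- The indices `kw`, `kx`, `ky`, `kz` and the position e are left free, so that the even row may
lie below or above the odd one. Antisymmetry and the return sums are transported from rows to
arrays. -/
theorem even_even_odd_relation (γ : ℕ → ℕ → ℚ) (hγ : IsGTPattern n m γ) :
    U (U (V (ket n m γ))) - qTwo h • U (V (U (ket n m γ))) + V (U (U (ket n m γ))) =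
      -V (ket n m γ) := by
  have hyx := hxy.symm
  refine cubic_relation_of_moves (IsGTPattern n m) (ket n m) (fun γ hγ => dif_neg hγ) (qTwo h) U V
    (evenMoves p) (oddMoves r) (fun u γ => shiftEntry γ kx u.1 u.2)
    (fun v γ => shiftEntry γ ky v.1 v.2)
    (fun u γ => evenCoeff s t (Finset.Icc 1 p) (Finset.Icc 1 (p - e)) (Finset.Icc 1 r) (ell γ kw)
      (ell γ kx) (ell γ ky) u)
    (fun v γ => oddCoeff h s (Finset.Icc 1 r) (Finset.Icc 1 (r + e)) (Finset.Icc 1 p) (ell γ kz)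
      (ell γ kx) (ell γ ky) v)
    (fun u => (u.1, -u.2)) (fun u hu => mem_evenMoves.2 (mem_evenMoves.1 hu).inv) (fun u => by simp)
    hU hV hU0 hV0 (fun u v γ => shiftEntry_comm γ _ _ _ _) (fun u v γ => shiftEntry_comm γ _ _ _ _)
    (fun u γ => shiftEntry_back γ kx u) ?_ ?_ γ hγ
  · intro γ hγ v hv u hu u' hu' hne hP
    have G' := hG _ hP
    simp only [ell_shiftEntry_self, ell_shiftEntry_ne _ hxy, ell_shiftEntry_ne _ hyx,
      ell_shiftEntry_ne _ hwx, ell_shiftEntry_ne _ hwy, ell_shiftEntry_ne _ hzx,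
      ell_shiftEntry_ne _ hzy] at G' ⊢
    exact even_moves_antisymm hs hh (hG γ hγ) t (mem_oddMoves.1 hv) (mem_evenMoves.1 hu)
      (mem_evenMoves.1 hu') hne G'
  · intro γ hγ v hv hP
    have G' := hG _ hP
    have hback := fun u : ℕ × ℚ => rowShift_back (ell γ kx) u
    simp only [ell_shiftEntry_self, ell_shiftEntry_ne _ hxy, ell_shiftEntry_ne _ hyx,
      ell_shiftEntry_ne _ hwx, ell_shiftEntry_ne _ hwy, ell_shiftEntry_ne _ hzx,
      ell_shiftEntry_ne _ hzy] at G' ⊢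
    rcases mem_oddMoves.1 hv with hv' | rfl
    · rw [← even_sum_of_odd_move hs hh ht (hG γ hγ) hv' G']
      simp only [pathWeight, rowShift_back]
      rfl
    · rw [← even_sum_of_diag hs hh ht (hG γ hγ)]
      simp only [pathWeight, rowShift_back]
      rfl

omit ht in
theorem odd_odd_even_relation (γ : ℕ → ℕ → ℚ) (hγ : IsGTPattern n m γ) :
    V (V (U (ket n m γ))) - qTwo h • V (U (V (ket n m γ))) + U (V (V (ket n m γ))) =
      -U (ket n m γ) := by
  have hyx := hxy.symm
  refine cubic_relation_of_moves (IsGTPattern n m) (ket n m) (fun γ hγ => dif_neg hγ) (qTwo h) V U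
    (oddMoves r) (evenMoves p)
    (fun v γ => shiftEntry γ ky v.1 v.2) (fun u γ => shiftEntry γ kx u.1 u.2)
    (fun v γ => oddCoeff h s (Finset.Icc 1 r) (Finset.Icc 1 (r + e)) (Finset.Icc 1 p) (ell γ kz)
      (ell γ kx) (ell γ ky) v)
    (fun u γ => evenCoeff s t (Finset.Icc 1 p) (Finset.Icc 1 (p - e)) (Finset.Icc 1 r) (ell γ kw)
      (ell γ kx) (ell γ ky) u)
    (fun u => (u.1, -u.2)) (fun u hu => mem_oddMoves.2 (mem_oddMoves.1 hu).inv) (fun u => by simp)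
    hV hU hV0 hU0 (fun u v γ => shiftEntry_comm γ _ _ _ _) (fun u v γ => shiftEntry_comm γ _ _ _ _)
    (fun u γ => shiftEntry_back γ ky u) ?_ ?_ γ hγ
  · intro γ hγ v hv u hu u' hu' hne hP
    have G' := hG _ hP
    simp only [ell_shiftEntry_self, ell_shiftEntry_ne _ hxy, ell_shiftEntry_ne _ hyx,
      ell_shiftEntry_ne _ hwx, ell_shiftEntry_ne _ hwy, ell_shiftEntry_ne _ hzx,
      ell_shiftEntry_ne _ hzy] at G' ⊢
    exact odd_moves_antisymm hs hh (hG γ hγ) t (mem_evenMoves.1 hv) (mem_oddMoves.1 hu)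
      (mem_oddMoves.1 hu') hne G'
  · intro γ hγ v hv hP
    have G' := hG _ hP
    simp only [ell_shiftEntry_self, ell_shiftEntry_ne _ hxy, ell_shiftEntry_ne _ hyx,
      ell_shiftEntry_ne _ hwx, ell_shiftEntry_ne _ hwy, ell_shiftEntry_ne _ hzx,
      ell_shiftEntry_ne _ hzy] at G' ⊢
    rw [← odd_sum_of_even_move (t := t) hs hh (hG γ hγ) (mem_evenMoves.1 hv) G']
    simp only [pathWeight, rowShift_back]
    rfl

end pair

/-! ## The coefficients -/

/-- The coefficient treats the rows above and below alike, so either may play the part of the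
interacting neighbour. -/
theorem evenCoeff_swap (s t : ℚ → ℂ) (J W K : Finset ℕ) (w x y : ℕ → ℚ) (a : ℕ × ℚ) :
    evenCoeff s t J W K w x y a = evenCoeff s t J K W y x w a := by
  simp only [evenCoeff, evenCoeffPart]; ring

theorem oddCoeff_swap (h : ℂ) (s : ℚ → ℂ) (K Z J : Finset ℕ) (z x y : ℕ → ℚ) (b : ℕ × ℚ) :
    oddCoeff h s K Z J z x y b = oddCoeff h s K J Z x z y b := by
  simp only [oddCoeff, oddCoeffPart, psiM]
  split_ifs <;> ring

/-- The coefficient of a move in row `2p`, between the rows `2p - 1` and `2p + 1`. -/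
def evenMoveCoeff (s t : ℚ → ℂ) (p : ℕ) (α : ℕ → ℕ → ℚ) (a : ℕ × ℚ) : ℂ :=
  evenCoeff s t (Finset.Icc 1 p) (Finset.Icc 1 (p - 1)) (Finset.Icc 1 p) (ell α (2 * p - 1))
    (ell α (2 * p)) (ell α (2 * p + 1)) a

/-- The coefficient of a move in row `2p + 1`, between the rows `2p` and `2p + 2`. -/
def oddMoveCoeff (h : ℂ) (s : ℚ → ℂ) (p : ℕ) (α : ℕ → ℕ → ℚ) (b : ℕ × ℚ) : ℂ :=
  oddCoeff h s (Finset.Icc 1 p) (Finset.Icc 1 (p + 1)) (Finset.Icc 1 p) (ell α (2 * p + 2))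
    (ell α (2 * p)) (ell α (2 * p + 1)) b

section
variable {h : ℂ} {s : ℚ → ℂ} (hs : IsEvenRoot h s)
include hs

theorem IsEvenRoot.abs_arg (b : ℚ) : s |b| = s b := by
  rcases abs_choice b with e | e <;> rw [e]
  exact hs.neg b

theorem gtA_eq_evenMoveCoeff (t : ℚ → ℂ) (p j : ℕ) (α : ℕ → ℕ → ℚ) :
    gtA s t p j α = evenMoveCoeff s t p α (j, 1) := by
  simp only [gtA, evenMoveCoeff, evenCoeff, evenCoeffPart, phi, chiEven, evenBar, hs.abs_arg,
    one_mul]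
  push_cast
  ring

/-- The lowering coefficient is minus the raising coefficient at the lowered array, which is the
antisymmetry in `evenCoeff_back`. -/
theorem neg_gtA_eq_evenMoveCoeff (t : ℚ → ℂ) {p j : ℕ} (hj : j ∈ Finset.Icc 1 p)
    (α : ℕ → ℕ → ℚ) :
    -gtA s t p j (shiftEntry α (2 * p) j (-1)) = evenMoveCoeff s t p α (j, -1) := by
  have hp := Finset.mem_Icc.1 hj
  have h1 := ell_shiftEntry_self α (2 * p) (j, -1)
  dsimp only at h1
  rw [gtA_eq_evenMoveCoeff hs, evenMoveCoeff, evenMoveCoeff, h1,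
    ell_shiftEntry_ne α (show 2 * p - 1 ≠ 2 * p by omega),
    ell_shiftEntry_ne α (show 2 * p + 1 ≠ 2 * p by omega),
    ← evenCoeff_back t _ _ _ _ _ _ (j, 1) ⟨hj, Or.inl rfl⟩]
  have h2 := rowShift_back (ell α (2 * p)) (j, -1)
  rw [neg_neg] at h2
  rw [h2]

theorem gtB_eq_oddMoveCoeff (p j : ℕ) (α : ℕ → ℕ → ℚ) :
    gtB s p j α = oddMoveCoeff h s p α (j, 1) := by
  have h1 : oddBar (ell α (2 * p + 1)) (j, 1) = ell α (2 * p + 1) j := by simp [oddBar]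
  simp only [gtB, oddMoveCoeff, oddCoeff, oddCoeffPart, psiM, psi, chiOdd, h1, hs.abs_arg,
    if_neg one_ne_zero]
  push_cast
  ring

theorem neg_gtB_eq_oddMoveCoeff {p j : ℕ} (hj : j ∈ Finset.Icc 1 p) (α : ℕ → ℕ → ℚ) :
    -gtB s p j (shiftEntry α (2 * p + 1) j (-1)) = oddMoveCoeff h s p α (j, -1) := by
  have h1 := ell_shiftEntry_self α (2 * p + 1) (j, -1)
  dsimp only at h1
  rw [gtB_eq_oddMoveCoeff hs, oddMoveCoeff, oddMoveCoeff, h1,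
    ell_shiftEntry_ne α (show 2 * p + 2 ≠ 2 * p + 1 by omega),
    ell_shiftEntry_ne α (show 2 * p ≠ 2 * p + 1 by omega),
    ← oddCoeff_back hs _ _ _ _ _ _ (j, 1) ⟨hj, Or.inl rfl⟩]
  have h2 := rowShift_back (ell α (2 * p + 1)) (j, -1)
  rw [neg_neg] at h2
  rw [h2]

omit hs in
theorem gtDiag_eq_oddMoveCoeff (s : ℚ → ℂ) (p : ℕ) (α : ℕ → ℕ → ℚ) :
    Complex.I * gtDiag h p α = oddMoveCoeff h s p α (0, 0) := by
  simp only [gtDiag, oddMoveCoeff, oddCoeff, oddCoeffPart, psiM, if_true]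
  ring

/-- If the shifted array is not a pattern, then its interlacing fails with the row above or the row
below; either way a `phi` factor over that row is zero. -/
theorem evenMoveCoeff_eq_zero {n : ℕ} {m : ℕ → ℚ} (hm : ∃ z : ℤ, 2 * m 1 = z) (t : ℚ → ℂ) {p : ℕ}
    (hpn : 2 * p + 1 ≤ n) {γ : ℕ → ℕ → ℚ} (hγ : IsGTPattern n m γ) {u : ℕ × ℚ}
    (hu : u ∈ evenMoves p) (hP : ¬IsGTPattern n m (shiftEntry γ (2 * p) u.1 u.2)) :
    evenMoveCoeff s t p γ u = 0 := by
  rw [mem_evenMoves] at hu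
  have hup := Finset.mem_Icc.1 hu.1
  obtain ⟨q, rfl⟩ : ∃ q, p = q + 1 := ⟨p - 1, by omega⟩
  rw [evenMoveCoeff, evenCoeff, evenCoeffPart]
  have i1 : ∀ j, 1 ≤ j → j ≤ q + 1 → ∃ z : ℤ, ell γ (2 * (q + 1)) j = m 1 + z :=
    fun j h1 h2 => hγ.ell_int (by omega) (by omega) h1 (by omega)
  by_cases h1 : Interlaced 1 (q + 1) (q + 1) (rowShift (ell γ (2 * (q + 1))) u)
      (ell γ (2 * (q + 1) + 1))
  · by_cases h2 : Interlaced 0 (q + 1) q (rowShift (ell γ (2 * (q + 1))) u) (ell γ (2 * q + 1))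
    · refine absurd (hγ.shiftEntry_of_interlaced (by omega) hup.1 (by omega) ?_ ?_ ?_) hP
      · rcases hu.2 with e | e
        · exact ⟨1, by simpa using e⟩
        · exact ⟨-1, by simpa using e⟩
      · intro p' hp' hpn' hk
        obtain rfl : p' = q + 1 := by omega
        rw [ell_shiftEntry_self, ell_shiftEntry_ne _ (by omega)]
        exact h1
      · intro p' hp' hpn' hk
        obtain rfl : p' = q := by omega
        rw [show 2 * p' + 2 = 2 * (p' + 1) by ring, ell_shiftEntry_self,
          ell_shiftEntry_ne _ (by omega)]
        exact h2
    · obtain ⟨k, hk, hk0⟩ := exists_phi_eq_zero hs (hγ.interlaced_down (by omega)) hm i1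
        (fun j h1 h2 => hγ.ell_int (by omega) (by omega) h1 (by omega)) hu h2
      rw [Finset.prod_eq_zero (s := Finset.Icc 1 (q + 1 - 1)) hk hk0]
      simp
  · obtain ⟨k, hk, hk0⟩ := exists_phi_eq_zero hs (hγ.interlaced_up hpn) hm i1
      (fun j h1 h2 => hγ.ell_int (by omega) (by omega) h1 (by omega)) hu h1
    rw [Finset.prod_eq_zero (s := Finset.Icc 1 (q + 1)) hk hk0, mul_zero]

theorem oddMoveCoeff_eq_zero {n : ℕ} {m : ℕ → ℚ} (hm : ∃ z : ℤ, 2 * m 1 = z) {p : ℕ}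
    (hpn : 2 * p + 2 ≤ n) {γ : ℕ → ℕ → ℚ} (hγ : IsGTPattern n m γ) {u : ℕ × ℚ}
    (hu : u ∈ oddMoves p) (hP : ¬IsGTPattern n m (shiftEntry γ (2 * p + 1) u.1 u.2)) :
    oddMoveCoeff h s p γ u = 0 := by
  rw [mem_oddMoves] at hu
  rcases hu with hu | rfl
  · have hup := Finset.mem_Icc.1 hu.1
    rw [oddMoveCoeff, oddCoeff, oddCoeffPart, if_neg hu.ne_zero]
    simp only [psiM, if_neg hu.ne_zero]
    have i1 : ∀ j, 1 ≤ j → j ≤ p → ∃ z : ℤ, ell γ (2 * p + 1) j = m 1 + z :=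
      fun j h1 h2 => hγ.ell_int (by omega) (by omega) h1 (by omega)
    by_cases h1 : Interlaced 1 p p (ell γ (2 * p)) (rowShift (ell γ (2 * p + 1)) u)
    · by_cases h2 : Interlaced 0 (p + 1) p (ell γ (2 * p + 2)) (rowShift (ell γ (2 * p + 1)) u)
      · refine absurd (hγ.shiftEntry_of_interlaced (by omega) hup.1 (by omega) ?_ ?_ ?_) hP
        · rcases hu.2 with e | e
          · exact ⟨1, by simpa using e⟩
          · exact ⟨-1, by simpa using e⟩
        · intro p' hp' hpn' hk
          obtain rfl : p' = p := by omega
          rw [ell_shiftEntry_self, ell_shiftEntry_ne _ (by omega)]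
          exact h1
        · intro p' hp' hpn' hk
          obtain rfl : p' = p := by omega
          rw [ell_shiftEntry_self, ell_shiftEntry_ne _ (by omega)]
          exact h2
      · obtain ⟨k, hk, hk0⟩ := exists_psi_eq_zero hs (hγ.interlaced_down (by omega)) hm
          (fun j h1 h2 => hγ.ell_int (by omega) (by omega) h1 (by omega)) i1 hu h2
        rw [Finset.prod_eq_zero (s := Finset.Icc 1 (p + 1)) hk hk0]
        simp
    · obtain ⟨k, hk, hk0⟩ := exists_psi_eq_zero hs (hγ.interlaced_up (by omega)) hm
        (fun j h1 h2 => hγ.ell_int (by omega) (by omega) h1 (by omega)) i1 hu h1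
      rw [Finset.prod_eq_zero (s := Finset.Icc 1 p) hk hk0, mul_zero]
  · rw [shiftEntry_zero] at hP
    exact absurd hγ hP

end

/-! ### The operators on basis vectors and their relations -/

open Classical in
theorem toBasis_eq_single {n : ℕ} {m : ℕ → ℚ} (g : GTPattern n m) :
    (EuclideanSpace.basisFun (GTPattern n m) ℂ).toBasis g = EuclideanSpace.single g 1 := by
  rw [OrthonormalBasis.coe_toBasis, EuclideanSpace.basisFun_apply]

theorem ket_eq_toBasis {n : ℕ} {m : ℕ → ℚ} (g : GTPattern n m) :
    ket n m g.1 = (EuclideanSpace.basisFun (GTPattern n m) ℂ).toBasis g :=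
  (dif_pos g.2).trans (toBasis_eq_single g).symm

theorem gtOp_ket {h : ℂ} {n : ℕ} {m : ℕ → ℚ} (A B : ℕ → ℕ → (ℕ → ℕ → ℚ) → ℂ) (i : ℕ)
    {γ : ℕ → ℕ → ℚ} (hγ : IsGTPattern n m γ) :
    gtOp h n m A B i (ket n m γ) = if Odd i then gtMove n m (A (i / 2)) (i - 1) γ
      else gtMove n m (B (i / 2 - 1)) (i - 1) γ +
        (Complex.I * gtDiag h (i / 2 - 1) γ) • ket n m γ := by
  have hk := ket_eq_toBasis (⟨γ, hγ⟩ : GTPattern n m)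
  exact (congrArg (gtOp h n m A B i) hk).trans (Module.Basis.constr_basis _ ℂ _ _)

section
variable {h : ℂ} {s : ℚ → ℂ} (hs : IsEvenRoot h s)
include hs

theorem gtOp_odd_ket {n : ℕ} {m : ℕ → ℚ} (t : ℚ → ℂ) (p : ℕ) {γ : ℕ → ℕ → ℚ}
    (hγ : IsGTPattern n m γ) :
    gtOp h n m (gtA s t) (gtB s) (2 * p + 1) (ket n m γ) =
      ∑ u ∈ evenMoves p, evenMoveCoeff s t p γ u • ket n m (shiftEntry γ (2 * p) u.1 u.2) := by
  rw [gtOp_ket _ _ _ hγ, if_pos (odd_two_mul_add_one p), gtMove, evenMoves, Finset.sum_product,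
    show (2 * p + 1) / 2 = p by omega, Nat.add_sub_cancel, Nat.mul_div_cancel_left _ two_pos,
    ← Finset.sum_sub_distrib]
  refine Finset.sum_congr rfl fun j hj => ?_
  rw [Finset.sum_pair (by norm_num), ← gtA_eq_evenMoveCoeff hs, ← neg_gtA_eq_evenMoveCoeff hs t hj,
    neg_smul, ← sub_eq_add_neg]

theorem gtOp_even_ket {n : ℕ} {m : ℕ → ℚ} (t : ℚ → ℂ) (p : ℕ) {γ : ℕ → ℕ → ℚ}
    (hγ : IsGTPattern n m γ) :
    gtOp h n m (gtA s t) (gtB s) (2 * p + 2) (ket n m γ) =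
      ∑ u ∈ oddMoves p, oddMoveCoeff h s p γ u • ket n m (shiftEntry γ (2 * p + 1) u.1 u.2) := by
  rw [gtOp_ket _ _ _ hγ, if_neg (by simp [parity_simps]), gtMove, oddMoves,
    Finset.sum_insert (by simp), Finset.sum_product,
    show (2 * p + 2) / 2 - 1 = p by omega, show 2 * p + 2 - 1 = 2 * p + 1 by omega,
    show (2 * p + 1) / 2 = p by omega, ← Finset.sum_sub_distrib, shiftEntry_zero,
    ← gtDiag_eq_oddMoveCoeff, add_comm]
  congr 1
  refine Finset.sum_congr rfl fun j hj => ?_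
  rw [Finset.sum_pair (by norm_num), ← gtB_eq_oddMoveCoeff hs, ← neg_gtB_eq_oddMoveCoeff hs hj,
    neg_smul, ← sub_eq_add_neg]

end

theorem gtOp_ext {n : ℕ} {m : ℕ → ℚ} {f g : GTSpace n m →ₗ[ℂ] GTSpace n m}
    (hfg : ∀ γ, IsGTPattern n m γ → f (ket n m γ) = g (ket n m γ)) : f = g := by
  refine (EuclideanSpace.basisFun (GTPattern n m) ℂ).toBasis.ext fun g' => ?_
  rw [← ket_eq_toBasis]
  exact hfg _ g'.2

/-- Operators with coefficients that agree on neighbouring patterns are equal. -/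
theorem gtOp_congr {h : ℂ} {n : ℕ} {m : ℕ → ℚ} {A B A' B' : ℕ → ℕ → (ℕ → ℕ → ℚ) → ℂ}
    (hA : ∀ p j α, j ∈ Finset.Icc 1 p → 2 * p + 1 ≤ n → IsGTPattern n m α →
      IsGTPattern n m (shiftEntry α (2 * p) j 1) → A p j α = A' p j α)
    (hB : ∀ p j α, j ∈ Finset.Icc 1 p → 2 * p + 2 ≤ n → IsGTPattern n m α →
      IsGTPattern n m (shiftEntry α (2 * p + 1) j 1) → B p j α = B' p j α)
    {i : ℕ} (h2 : 2 ≤ i) (hin : i ≤ n) : gtOp h n m A B i = gtOp h n m A' B' i := by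
  have hmove : ∀ (C C' : ℕ → (ℕ → ℕ → ℚ) → ℂ) (k : ℕ),
      (∀ j α, j ∈ Finset.Icc 1 (k / 2) → IsGTPattern n m α →
        IsGTPattern n m (shiftEntry α k j 1) → C j α = C' j α) →
      ∀ γ, IsGTPattern n m γ → gtMove n m C k γ = gtMove n m C' k γ := by
    intro C C' k hC γ hγ
    rw [gtMove, gtMove]
    congr 1
    · refine Finset.sum_congr rfl fun j hj => ?_
      by_cases hP : IsGTPattern n m (shiftEntry γ k j 1)
      · rw [hC j γ hj hγ hP]
      · rw [ket, dif_neg hP, smul_zero, smul_zero]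
    · refine Finset.sum_congr rfl fun j hj => ?_
      by_cases hP : IsGTPattern n m (shiftEntry γ k j (-1))
      -- The lowering coefficient is evaluated at the lowered array, from which raising leads back
      -- to γ; so agreement on raising moves is enough.
      · have := shiftEntry_back γ k (j, -1)
        rw [neg_neg] at this
        rw [hC j _ hj hP (by rw [this]; exact hγ)]
      · rw [ket, dif_neg hP, smul_zero, smul_zero]
  refine ContinuousLinearMap.coe_injective (gtOp_ext fun γ hγ => ?_)
  simp only [ContinuousLinearMap.coe_coe]
  rw [gtOp_ket _ _ _ hγ, gtOp_ket _ _ _ hγ]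
  obtain ⟨p, rfl | rfl⟩ : ∃ p, i = 2 * p + 1 ∨ i = 2 * p + 2 := ⟨(i - 1) / 2, by omega⟩
  · rw [if_pos (odd_two_mul_add_one p), if_pos (odd_two_mul_add_one p)]
    refine hmove _ _ _ (fun j α hj => ?_) γ hγ
    rw [show 2 * p + 1 - 1 = 2 * p by omega, show (2 * p + 1) / 2 = p by omega]
    rw [show (2 * p + 1 - 1) / 2 = p by omega] at hj
    exact hA p j α hj hin
  · rw [if_neg (by simp [parity_simps]), if_neg (by simp [parity_simps])]
    congr 1
    refine hmove _ _ _ (fun j α hj => ?_) γ hγ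
    rw [show 2 * p + 2 - 1 = 2 * p + 1 by omega, show (2 * p + 2) / 2 - 1 = p by omega]
    rw [show (2 * p + 2 - 1) / 2 = p by omega] at hj
    exact hB p j α hj hin

/-- The moves of the generator with label `i`. -/
def genMoves (i : ℕ) : Finset (ℕ × ℚ) := if Odd i then evenMoves (i / 2) else oddMoves (i / 2 - 1)

/-- The coefficients of the moves of the generator with label `i`. -/
def genCoeff (h : ℂ) (s t : ℚ → ℂ) (i : ℕ) (α : ℕ → ℕ → ℚ) (u : ℕ × ℚ) : ℂ :=
  if Odd i then evenMoveCoeff s t (i / 2) α u else oddMoveCoeff h s (i / 2 - 1) α u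

theorem genMoves_odd (p : ℕ) : genMoves (2 * p + 1) = evenMoves p := by
  rw [genMoves, if_pos (odd_two_mul_add_one p), show (2 * p + 1) / 2 = p by omega]

theorem genMoves_even (p : ℕ) : genMoves (2 * p + 2) = oddMoves p := by
  rw [genMoves, if_neg (by simp [parity_simps]), show (2 * p + 2) / 2 - 1 = p by omega]

theorem genCoeff_odd (h : ℂ) (s t : ℚ → ℂ) (p : ℕ) :
    genCoeff h s t (2 * p + 1) = evenMoveCoeff s t p := by
  funext α u
  rw [genCoeff, if_pos (odd_two_mul_add_one p), show (2 * p + 1) / 2 = p by omega]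

theorem genCoeff_even (h : ℂ) (s t : ℚ → ℂ) (p : ℕ) :
    genCoeff h s t (2 * p + 2) = oddMoveCoeff h s p := by
  funext α u
  rw [genCoeff, if_neg (by simp [parity_simps]), show (2 * p + 2) / 2 - 1 = p by omega]

/-- The coefficients of the generator with label i involve only the rows i - 2, i - 1 and i. -/
theorem genCoeff_shiftEntry {h : ℂ} {s t : ℚ → ℂ} {i k : ℕ} (hi : 2 ≤ i) (hk : k + 2 < i ∨ i < k)
    (α : ℕ → ℕ → ℚ) (u v : ℕ × ℚ) :
    genCoeff h s t i (shiftEntry α k v.1 v.2) u = genCoeff h s t i α u := by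
  obtain ⟨p, rfl | rfl⟩ : ∃ p, i = 2 * p + 1 ∨ i = 2 * p + 2 := ⟨(i - 1) / 2, by omega⟩
  · rw [genCoeff_odd, evenMoveCoeff, evenMoveCoeff, ell_shiftEntry_ne _ (by omega),
      ell_shiftEntry_ne _ (by omega), ell_shiftEntry_ne _ (by omega)]
  · rw [genCoeff_even, oddMoveCoeff, oddMoveCoeff, ell_shiftEntry_ne _ (by omega),
      ell_shiftEntry_ne _ (by omega), ell_shiftEntry_ne _ (by omega)]

section
variable {h : ℂ} {s : ℚ → ℂ} (hs : IsEvenRoot h s) {n : ℕ} {m : ℕ → ℚ}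
  (hm : ∃ z : ℤ, 2 * m 1 = z)
include hs

theorem gtOp_gen_ket (t : ℚ → ℂ) {i : ℕ} (h2 : 2 ≤ i) {γ : ℕ → ℕ → ℚ} (hγ : IsGTPattern n m γ) :
    gtOp h n m (gtA s t) (gtB s) i (ket n m γ) =
      ∑ u ∈ genMoves i, genCoeff h s t i γ u • ket n m (shiftEntry γ (i - 1) u.1 u.2) := by
  obtain ⟨p, rfl | rfl⟩ : ∃ p, i = 2 * p + 1 ∨ i = 2 * p + 2 := ⟨(i - 1) / 2, by omega⟩
  · rw [gtOp_odd_ket hs t p hγ, genMoves_odd, genCoeff_odd, Nat.add_sub_cancel]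
  · rw [gtOp_even_ket hs t p hγ, genMoves_even, genCoeff_even]; rfl

include hm

theorem genCoeff_eq_zero (t : ℚ → ℂ) {i : ℕ} (h2 : 2 ≤ i) (hin : i ≤ n) {γ : ℕ → ℕ → ℚ}
    (hγ : IsGTPattern n m γ) {u : ℕ × ℚ} (hu : u ∈ genMoves i)
    (hP : ¬IsGTPattern n m (shiftEntry γ (i - 1) u.1 u.2)) : genCoeff h s t i γ u = 0 := by
  obtain ⟨p, rfl | rfl⟩ : ∃ p, i = 2 * p + 1 ∨ i = 2 * p + 2 := ⟨(i - 1) / 2, by omega⟩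
  · rw [genMoves_odd] at hu
    rw [genCoeff_odd]
    exact evenMoveCoeff_eq_zero hs hm t hin hγ hu hP
  · rw [genMoves_even] at hu
    rw [genCoeff_even]
    exact oddMoveCoeff_eq_zero hs hm hin hγ hu hP

theorem gtOp_commute (t : ℚ → ℂ) {i j : ℕ} (hi : 2 ≤ i) (hin : i ≤ n) (hj : 2 ≤ j) (hjn : j ≤ n)
    (hij : i + 1 < j ∨ j + 1 < i) :
    gtOp h n m (gtA s t) (gtB s) i * gtOp h n m (gtA s t) (gtB s) j =
      gtOp h n m (gtA s t) (gtB s) j * gtOp h n m (gtA s t) (gtB s) i := by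
  refine ContinuousLinearMap.coe_injective (gtOp_ext fun γ hγ => ?_)
  exact commute_of_moves (IsGTPattern n m) (ket n m)
    (gtOp h n m (gtA s t) (gtB s) i : GTSpace n m →ₗ[ℂ] GTSpace n m)
    (gtOp h n m (gtA s t) (gtB s) j : GTSpace n m →ₗ[ℂ] GTSpace n m)
    (genMoves i) (genMoves j) (fun u γ => shiftEntry γ (i - 1) u.1 u.2)
    (fun u γ => shiftEntry γ (j - 1) u.1 u.2) (fun u γ => genCoeff h s t i γ u)
    (fun u γ => genCoeff h s t j γ u) (fun γ hγ => gtOp_gen_ket hs t hi hγ)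
    (fun γ hγ => gtOp_gen_ket hs t hj hγ)
    (fun γ hγ u hu hP => genCoeff_eq_zero hs hm t hi hin hγ hu hP)
    (fun γ hγ u hu hP => genCoeff_eq_zero hs hm t hj hjn hγ hu hP)
    (fun u v γ => shiftEntry_comm γ _ _ _ _)
    (fun u v γ => genCoeff_shiftEntry hi (by omega) γ u v)
    (fun u v γ => genCoeff_shiftEntry hj (by omega) γ v u) γ hγ

theorem gtOp_cubic (hh : NotRootOfUnity h) {t : ℚ → ℂ} (ht : ∀ b, t b ^ 2 = qHalf h b) {i : ℕ}
    (hi : 2 ≤ i) (hin : i + 1 ≤ n) {γ : ℕ → ℕ → ℚ} (hγ : IsGTPattern n m γ)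
    {U V : GTSpace n m →ₗ[ℂ] GTSpace n m}
    (hU : U = (gtOp h n m (gtA s t) (gtB s) i : GTSpace n m →ₗ[ℂ] GTSpace n m))
    (hV : V = (gtOp h n m (gtA s t) (gtB s) (i + 1) : GTSpace n m →ₗ[ℂ] GTSpace n m)) :
    U (U (V (ket n m γ))) - qTwo h • U (V (U (ket n m γ))) + V (U (U (ket n m γ))) =
        -V (ket n m γ) ∧
      V (V (U (ket n m γ))) - qTwo h • V (U (V (ket n m γ))) + U (V (V (ket n m γ))) =
        -U (ket n m γ) := by
  obtain ⟨p, rfl | rfl⟩ : ∃ p, i = 2 * p + 1 ∨ i = 2 * p + 2 := ⟨(i - 1) / 2, by omega⟩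
  · have hU' : ∀ γ, IsGTPattern n m γ → U (ket n m γ) = ∑ u ∈ evenMoves p,
        evenMoveCoeff s t p γ u • ket n m (shiftEntry γ (2 * p) u.1 u.2) := fun γ hγ => by
      rw [hU]; exact gtOp_odd_ket hs t p hγ
    have hV' : ∀ γ, IsGTPattern n m γ → V (ket n m γ) = ∑ u ∈ oddMoves p,
        oddMoveCoeff h s p γ u • ket n m (shiftEntry γ (2 * p + 1) u.1 u.2) := fun γ hγ => by
      rw [hV]; exact gtOp_even_ket hs t p hγ
    have hG : ∀ γ, IsGTPattern n m γ → GTRows 1 p p (ell γ (2 * p - 1)) (ell γ (2 * p + 2))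
        (ell γ (2 * p)) (ell γ (2 * p + 1)) := fun γ hγ => hγ.rows_up hm (by omega) (by omega)
    have hU0 := fun γ (hγ : IsGTPattern n m γ) u (hu : u ∈ evenMoves p) hP =>
      evenMoveCoeff_eq_zero hs hm t (by omega) hγ hu hP
    have hV0 := fun γ (hγ : IsGTPattern n m γ) u (hu : u ∈ oddMoves p) hP =>
      oddMoveCoeff_eq_zero hs hm (by omega) hγ hu hP
    exact ⟨even_even_odd_relation hs hh ht (by omega) (by omega) (by omega) (by omega) (by omega)
        hG U V hU' hV' hU0 hV0 γ hγ,
      odd_odd_even_relation hs hh (by omega) (by omega) (by omega) (by omega) (by omega)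
        hG U V hU' hV' hU0 hV0 γ hγ⟩
  -- Here the even row 2p + 2 lies above the odd row 2p + 1, so each row's interacting neighbour is
  -- on the other side; the swap lemmas bring the coefficients to the form e = 0.
  · have hc : ∀ γ u, evenCoeff s t (Finset.Icc 1 (p + 1)) (Finset.Icc 1 (p + 1 - 0))
        (Finset.Icc 1 p) (ell γ (2 * p + 3)) (ell γ (2 * p + 2)) (ell γ (2 * p + 1)) u =
        evenMoveCoeff s t (p + 1) γ u := fun γ u => evenCoeff_swap _ _ _ _ _ _ _ _ _
    have hd : ∀ γ u, oddCoeff h s (Finset.Icc 1 p) (Finset.Icc 1 (p + 0))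
        (Finset.Icc 1 (p + 1)) (ell γ (2 * p)) (ell γ (2 * p + 2)) (ell γ (2 * p + 1)) u =
        oddMoveCoeff h s p γ u := fun γ u => oddCoeff_swap _ _ _ _ _ _ _ _ _
    have hU' : ∀ γ, IsGTPattern n m γ → U (ket n m γ) = ∑ u ∈ oddMoves p,
        oddMoveCoeff h s p γ u • ket n m (shiftEntry γ (2 * p + 1) u.1 u.2) := fun γ hγ => by
      rw [hU]; exact gtOp_even_ket hs t p hγ
    have hV' : ∀ γ, IsGTPattern n m γ → V (ket n m γ) = ∑ u ∈ evenMoves (p + 1),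
        evenMoveCoeff s t (p + 1) γ u • ket n m (shiftEntry γ (2 * p + 2) u.1 u.2) :=
      fun γ hγ => by
        rw [hV]; exact gtOp_odd_ket hs t (p + 1) hγ
    have hG : ∀ γ, IsGTPattern n m γ → GTRows 0 (p + 1) p (ell γ (2 * p + 3)) (ell γ (2 * p))
        (ell γ (2 * p + 2)) (ell γ (2 * p + 1)) := fun γ hγ => hγ.rows_down hm (by omega)
    have hV0 := fun γ (hγ : IsGTPattern n m γ) u (hu : u ∈ evenMoves (p + 1)) hP =>
      evenMoveCoeff_eq_zero hs hm t (by omega) hγ hu hP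
    have hU0 := fun γ (hγ : IsGTPattern n m γ) u (hu : u ∈ oddMoves p) hP =>
      oddMoveCoeff_eq_zero hs hm (by omega) hγ hu hP
    simp only [← hc] at hV' hV0
    simp only [← hd] at hU' hU0
    exact ⟨odd_odd_even_relation hs hh (by omega) (by omega) (by omega) (by omega) (by omega)
        hG V U hV' hU' hV0 hU0 γ hγ,
      even_even_odd_relation hs hh ht (by omega) (by omega) (by omega) (by omega) (by omega)
        hG V U hV' hU' hV0 hU0 γ hγ⟩

theorem gtOp_relations_of_even (hh : NotRootOfUnity h) {t : ℚ → ℂ}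
    (ht : ∀ b, t b ^ 2 = qHalf h b) :
    SatisfiesSoRelations h n (fun i : SoIndex n => gtOp h n m (gtA s t) (gtB s) i.1) := by
  refine ⟨fun i j hij => ?_, fun i j hij => ?_, fun i j hij => ?_⟩
  · rw [sub_eq_zero]
    exact gtOp_commute hs hm t i.2.1 i.2.2 j.2.1 j.2.2 hij
  · refine ContinuousLinearMap.coe_injective (gtOp_ext fun γ hγ => ?_)
    have := (gtOp_cubic hs hm hh ht i.2.1 (hij ▸ j.2.2) hγ rfl rfl).2
    rw [← hij] at this
    rw [pow_two, mul_assoc, mul_assoc]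
    exact this
  · refine ContinuousLinearMap.coe_injective (gtOp_ext fun γ hγ => ?_)
    have := (gtOp_cubic hs hm hh ht i.2.1 (hij ▸ j.2.2) hγ rfl rfl).1
    rw [← hij] at this
    have hrev : ∀ a b c : GTSpace n m, a - b + c = c - b + a := by intros; abel
    rw [pow_two, mul_assoc, mul_assoc]
    exact (hrev _ _ _).trans this

end

/-! ## Signs of the arguments -/

theorem Interlaced.abs_cases {e p r : ℕ} {x y : ℕ → ℚ} (hxy : Interlaced e p r x y) {j k : ℕ}
    (hj : j ∈ Finset.Icc 1 p) (hk : k ∈ Finset.Icc 1 r) : |x j| + 1 ≤ y k ∨ y k ≤ x j := by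
  rw [Finset.mem_Icc] at hj hk
  have := hxy j k hj.1 hj.2 hk.1 hk.2
  by_cases hlt : k < j + e
  · exact Or.inl (this.1 hlt)
  · exact Or.inr (this.2 (by omega))

theorem Interlaced.one_le {e p r : ℕ} {x y : ℕ → ℚ} (hxy : Interlaced e p r x y) (he : e ≤ 1)
    (hr : r + 1 = p + e) {k : ℕ} (hk : k ∈ Finset.Icc 1 r) : 1 ≤ y k := by
  rw [Finset.mem_Icc] at hk
  have := (hxy (k + (1 - e)) k (by omega) (by omega) hk.1 hk.2).1 (by omega)
  linarith [abs_nonneg (x (k + (1 - e)))]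

theorem Interlaced.one_le_add {e p r : ℕ} {x y : ℕ → ℚ} (hxy : Interlaced e p r x y) (he : e ≤ 1)
    (hr : r + 1 = p + e) {j k : ℕ} (hj : j ∈ Finset.Icc 1 p) (hk : k ∈ Finset.Icc 1 r) :
    1 ≤ y k + x j := by
  have h1 := hxy.one_le he hr hk
  rcases hxy.abs_cases hj hk with h | h
  · have := abs_le.1 (le_sub_iff_add_le.2 h)
    linarith
  · linarith

theorem Interlaced.x_gap {p : ℕ} {x x' y : ℕ → ℚ} (hxy : Interlaced 1 p p x y)
    (hxy' : Interlaced 1 p p x' y) {i j : ℕ} (hi : 1 ≤ i) (hij : i < j) (hj : j ≤ p) :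
    |x' j| + 1 ≤ x i := by
  have h1 := (hxy i (i + 1) hi (by omega) (by omega) (by omega)).2 le_rfl
  have h2 := (hxy' j (i + 1) (by omega) hj (by omega) (by omega)).1 (by omega)
  linarith

theorem Interlaced.y_gap {p : ℕ} {x y y' : ℕ → ℚ} (hxy : Interlaced 1 p p x y)
    (hxy' : Interlaced 1 p p x y') {i j : ℕ} (hi : 1 ≤ i) (hij : i < j) (hj : j ≤ p) :
    y' j + 1 ≤ y i := by
  have h1 := (hxy i i hi (by omega) (by omega) (by omega)).1 (by omega)
  have h2 := (hxy' i j (by omega) (by omega) (by omega) hj).2 (by omega)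
  linarith [le_abs_self (x i)]

/-- Interlacing makes every argument not already inside an absolute value nonnegative. So values of
the chosen root at negative arguments never matter on patterns. -/
theorem gtA_abs {n : ℕ} {m : ℕ → ℚ} (s t : ℚ → ℂ) {p j : ℕ} (hj : j ∈ Finset.Icc 1 p)
    (hpn : 2 * p + 1 ≤ n) {α : ℕ → ℕ → ℚ} (hα : IsGTPattern n m α) :
    gtA s t p j α = gtA (fun b => s |b|) t p j α := by
  have hp := Finset.mem_Icc.1 hj
  obtain ⟨q, rfl⟩ : ∃ q, p = q + 1 := ⟨p - 1, by omega⟩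
  have h1 := hα.interlaced_up hpn
  have h2 := hα.interlaced_down (p := q) (by omega)
  have e1 : ∀ r ∈ Finset.Icc 1 (q + 1),
      0 ≤ ell α (2 * (q + 1) + 1) r + ell α (2 * (q + 1)) j := fun r hr => by
    linarith [h1.one_le_add le_rfl rfl hj hr]
  have e2 : ∀ r ∈ Finset.Icc 1 q,
      0 ≤ ell α (2 * (q + 1) - 1) r + ell α (2 * (q + 1)) j := fun r hr => by
    have := h2.one_le_add zero_le_one rfl hj hr
    change 0 ≤ ell α (2 * q + 1) r + ell α (2 * q + 2) j
    linarith
  have e3 : ∀ r ∈ (Finset.Icc 1 (q + 1)).erase j,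
      0 ≤ ell α (2 * (q + 1)) r + ell α (2 * (q + 1)) j := fun r hr => by
    obtain ⟨hrj, hr⟩ := Finset.mem_erase.1 hr
    rw [Finset.mem_Icc] at hr
    rcases lt_or_gt_of_ne hrj with hlt | hlt
    · have := abs_le.1 (le_sub_iff_add_le.2 (h1.x_gap h1 hr.1 hlt hp.2)); linarith
    · have := abs_le.1 (le_sub_iff_add_le.2 (h1.x_gap h1 hp.1 hlt hr.2)); linarith
  simp only [gtA, abs_abs]
  congr 2
  · congr 1
    · exact Finset.prod_congr rfl fun r hr => by rw [abs_of_nonneg (e1 r hr)]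
    · exact Finset.prod_congr rfl fun r hr => by rw [abs_of_nonneg (e2 r hr)]
  · exact Finset.prod_congr rfl fun r hr => by
      have := e3 r hr
      rw [abs_of_nonneg this, abs_of_nonneg (by linarith : (0 : ℚ) ≤
        ell α (2 * (q + 1)) r + ell α (2 * (q + 1)) j + 1)]

theorem gtB_abs {n : ℕ} {m : ℕ → ℚ} (s : ℚ → ℂ) {p j : ℕ} (hj : j ∈ Finset.Icc 1 p)
    (hpn : 2 * p + 2 ≤ n) {α : ℕ → ℕ → ℚ} (hα : IsGTPattern n m α) :
    gtB s p j α = gtB (fun b => s |b|) p j α := by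
  have hp := Finset.mem_Icc.1 hj
  have h1 := hα.interlaced_up (p := p) (by omega)
  have h2 := hα.interlaced_down hpn
  have e1 : ∀ r ∈ Finset.Icc 1 (p + 1),
      0 ≤ ell α (2 * p + 2) r + ell α (2 * p + 1) j := fun r hr => by
    linarith [h2.one_le_add zero_le_one rfl hr hj]
  have e2 : ∀ r ∈ Finset.Icc 1 p,
      0 ≤ ell α (2 * p) r + ell α (2 * p + 1) j := fun r hr => by
    linarith [h1.one_le_add le_rfl rfl hr hj]
  have e3 : ∀ r ∈ Finset.Icc 1 p, 1 ≤ ell α (2 * p + 1) r := fun r hr => h1.one_le le_rfl rfl hr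
  have e4 := e3 j hj
  have hz : ∏ r ∈ Finset.Icc 1 (p + 1), s |ell α (2 * p + 2) r + ell α (2 * p + 1) j| *
        s |ell α (2 * p + 2) r - ell α (2 * p + 1) j| =
      ∏ r ∈ Finset.Icc 1 (p + 1), s (ell α (2 * p + 2) r + ell α (2 * p + 1) j) *
        s |ell α (2 * p + 2) r - ell α (2 * p + 1) j| :=
    Finset.prod_congr rfl fun r hr => by rw [abs_of_nonneg (e1 r hr)]
  have hx : ∏ r ∈ Finset.Icc 1 p, s |ell α (2 * p) r + ell α (2 * p + 1) j| *
        s |ell α (2 * p) r - ell α (2 * p + 1) j| =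
      ∏ r ∈ Finset.Icc 1 p, s (ell α (2 * p) r + ell α (2 * p + 1) j) *
        s |ell α (2 * p) r - ell α (2 * p + 1) j| :=
    Finset.prod_congr rfl fun r hr => by rw [abs_of_nonneg (e2 r hr)]
  have hy : ∏ r ∈ (Finset.Icc 1 p).erase j, s |ell α (2 * p + 1) r + ell α (2 * p + 1) j| *
        s |ell α (2 * p + 1) r - ell α (2 * p + 1) j| *
        s |ell α (2 * p + 1) r + ell α (2 * p + 1) j - 1| *
        s |ell α (2 * p + 1) r - ell α (2 * p + 1) j - 1| =
      ∏ r ∈ (Finset.Icc 1 p).erase j, s (ell α (2 * p + 1) r + ell α (2 * p + 1) j) *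
        s |ell α (2 * p + 1) r - ell α (2 * p + 1) j| *
        s (ell α (2 * p + 1) r + ell α (2 * p + 1) j - 1) *
        s |ell α (2 * p + 1) r - ell α (2 * p + 1) j - 1| :=
    Finset.prod_congr rfl fun r hr => by
      have := e3 r (Finset.mem_of_mem_erase hr)
      rw [abs_of_nonneg (by linarith : (0 : ℚ) ≤ ell α (2 * p + 1) r + ell α (2 * p + 1) j),
        abs_of_nonneg (by linarith : (0 : ℚ) ≤ ell α (2 * p + 1) r + ell α (2 * p + 1) j - 1)]
  simp only [gtB, abs_abs]
  rw [hz, hx, hy, abs_of_nonneg (by linarith : (0 : ℚ) ≤ ell α (2 * p + 1) j),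
    abs_of_nonneg (by linarith : (0 : ℚ) ≤ 2 * ell α (2 * p + 1) j + 1),
    abs_of_nonneg (by linarith : (0 : ℚ) ≤ 2 * ell α (2 * p + 1) j - 1)]

/-- Arbitrary choices of roots need not be even, but s(|b|) is, and it defines the same operators.
-/
theorem gtOp_relations {h : ℂ} (hh : NotRootOfUnity h) {n : ℕ} {m : ℕ → ℚ}
    (hm : ∃ z : ℤ, 2 * m 1 = z) {s t : ℚ → ℂ} (hs : ∀ b, s b ^ 2 = qNum h b)
    (ht : ∀ b, t b ^ 2 = qHalf h b) :
    SatisfiesSoRelations h n (fun i : SoIndex n => gtOp h n m (gtA s t) (gtB s) i.1) := by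
  have hs' : IsEvenRoot h fun b => s |b| :=
    ⟨fun b => by simp only [abs_neg], fun b hb => by simp only [abs_of_nonneg hb, hs]⟩
  have := gtOp_relations_of_even hs' hm (n := n) hh ht
  have hop : (fun i : SoIndex n => gtOp h n m (gtA s t) (gtB s) i.1) =
      fun i : SoIndex n => gtOp h n m (gtA (fun b => s |b|) t) (gtB fun b => s |b|) i.1 := by
    funext i
    exact gtOp_congr (fun p j α hj hpn hα _ => gtA_abs s t hj hpn hα)
      (fun p j α hj hpn hα _ => gtB_abs s hj hpn hα) i.2.1 i.2.2
  rw [hop]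
  exact this

/-! ## Positivity of the squared coefficients -/

/-- If y_k lies above |x_j|, admissibility of the raised array gives the extra unit; if it lies
below x_j, the original interlacing already does. -/
theorem Interlaced.one_le_abs_sub_of_raise_left {e p r : ℕ} {x y : ℕ → ℚ} {j : ℕ}
    (hxy : Interlaced e p r x y) (hxy' : Interlaced e p r (rowShift x (j, 1)) y)
    (hj : j ∈ Finset.Icc 1 p) {k : ℕ} (hk : k ∈ Finset.Icc 1 r) : 1 ≤ |y k - x j - 1| := by
  rw [Finset.mem_Icc] at hj hk
  have h1 := hxy j k hj.1 hj.2 hk.1 hk.2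
  have h2 := hxy' j k hj.1 hj.2 hk.1 hk.2
  have h3 : rowShift x (j, 1) j = x j + 1 := rowShift_self x (j, 1)
  rw [h3] at h2
  rw [le_abs]
  by_cases hlt : k < j + e
  · left; linarith [h2.1 hlt, le_abs_self (x j + 1)]
  · right; linarith [h1.2 (by omega)]

theorem Interlaced.one_le_abs_sub_of_raise_right {e p r : ℕ} {x y : ℕ → ℚ} {k : ℕ}
    (hxy : Interlaced e p r x y) (hxy' : Interlaced e p r x (rowShift y (k, 1)))
    {j : ℕ} (hj : j ∈ Finset.Icc 1 p) (hk : k ∈ Finset.Icc 1 r) : 1 ≤ |x j - y k| := by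
  rw [Finset.mem_Icc] at hj hk
  have h1 := hxy j k hj.1 hj.2 hk.1 hk.2
  have h2 := hxy' j k hj.1 hj.2 hk.1 hk.2
  have h3 : rowShift y (k, 1) k = y k + 1 := rowShift_self y (k, 1)
  rw [h3] at h2
  rw [le_abs]
  by_cases hlt : k < j + e
  · right; linarith [h1.1 hlt, le_abs_self (x j)]
  · left; linarith [h2.2 (by omega)]

section
open scoped ComplexOrder

/-- All arguments are strictly positive once both arrays are patterns; the raised array is what
keeps the factors with a shift by 1 away from [0]. The statement allows any positive s and t, so it
applies to the q-numbers and to their roots. -/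
theorem gtA_pos {n : ℕ} {m : ℕ → ℚ} {s t : ℚ → ℂ} (hs : ∀ b, 0 < b → 0 < s b)
    (ht : ∀ b, 0 < t b) {p j : ℕ} (hj : j ∈ Finset.Icc 1 p) (hpn : 2 * p + 1 ≤ n)
    {α : ℕ → ℕ → ℚ} (hα : IsGTPattern n m α)
    (hα' : IsGTPattern n m (shiftEntry α (2 * p) j 1)) : 0 < gtA s t p j α := by
  have hp := Finset.mem_Icc.1 hj
  obtain ⟨q, rfl⟩ : ∃ q, p = q + 1 := ⟨p - 1, by omega⟩
  have h1 := hα.interlaced_up hpn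
  have h2 := hα.interlaced_down (p := q) (by omega)
  have h1' := hα'.interlaced_up hpn
  have h2' := hα'.interlaced_down (p := q) (by omega)
  have hx := ell_shiftEntry_self α (2 * (q + 1)) (j, 1)
  dsimp only at hx
  rw [ell_shiftEntry_ne _ (show 2 * (q + 1) + 1 ≠ 2 * (q + 1) by omega), hx] at h1'
  rw [ell_shiftEntry_ne _ (show 2 * q + 1 ≠ 2 * (q + 1) by omega),
    show 2 * q + 2 = 2 * (q + 1) by ring, hx] at h2'
  have hself : rowShift (ell α (2 * (q + 1))) (j, 1) j = ell α (2 * (q + 1)) j + 1 :=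
    rowShift_self _ (j, 1)
  refine mul_pos (mul_pos (ht _) (ht _)) (div_pos (mul_pos ?_ ?_) ?_)
  · refine Finset.prod_pos fun r hr => mul_pos (hs _ ?_) (hs _ ?_)
    · linarith [h1.one_le_add le_rfl rfl hj hr]
    · linarith [h1.one_le_abs_sub_of_raise_left h1' hj hr]
  · refine Finset.prod_pos fun r hr => mul_pos (hs _ ?_) (hs _ ?_)
    · exact lt_of_lt_of_le one_pos (h2.one_le_add zero_le_one rfl hj hr)
    · exact lt_of_lt_of_le one_pos (h2.one_le_abs_sub_of_raise_left h2' hj hr)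
  · refine Finset.prod_pos fun r hr => ?_
    obtain ⟨hrj, hr⟩ := Finset.mem_erase.1 hr
    rw [Finset.mem_Icc] at hr
    have e1 : 1 ≤ ell α (2 * (q + 1)) r + ell α (2 * (q + 1)) j := by
      rcases lt_or_gt_of_ne hrj with hlt | hlt
      · have := abs_le.1 (le_sub_iff_add_le.2 (h1.x_gap h1 hr.1 hlt hp.2)); linarith
      · have := abs_le.1 (le_sub_iff_add_le.2 (h1.x_gap h1 hp.1 hlt hr.2)); linarith
    have e2 : 2 ≤ ell α (2 * (q + 1)) r - ell α (2 * (q + 1)) j ∨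
        1 ≤ ell α (2 * (q + 1)) j - ell α (2 * (q + 1)) r := by
      rcases lt_or_gt_of_ne hrj with hlt | hlt
      · have := abs_le.1 (le_sub_iff_add_le.2 (h1.x_gap h1' hr.1 hlt hp.2))
        rw [hself] at this; left; linarith
      · have := abs_le.1 (le_sub_iff_add_le.2 (h1.x_gap h1 hp.1 hlt hr.2)); right; linarith
    refine mul_pos (mul_pos (mul_pos (hs _ ?_) (hs _ ?_)) (hs _ ?_)) (hs _ ?_)
    · linarith
    · rw [lt_abs]; rcases e2 with e | e
      · left; linarith
      · right; linarith
    · linarith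
    · rw [lt_abs]; rcases e2 with e | e
      · left; linarith
      · right; linarith

theorem gtB_pos {n : ℕ} {m : ℕ → ℚ} {s : ℚ → ℂ} (hs : ∀ b, 0 < b → 0 < s b) {p j : ℕ}
    (hj : j ∈ Finset.Icc 1 p) (hpn : 2 * p + 2 ≤ n) {α : ℕ → ℕ → ℚ} (hα : IsGTPattern n m α)
    (hα' : IsGTPattern n m (shiftEntry α (2 * p + 1) j 1)) : 0 < gtB s p j α := by
  have hp := Finset.mem_Icc.1 hj
  have h1 := hα.interlaced_up (p := p) (by omega)
  have h2 := hα.interlaced_down hpn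
  have h1' := hα'.interlaced_up (p := p) (by omega)
  have h2' := hα'.interlaced_down hpn
  have hy := ell_shiftEntry_self α (2 * p + 1) (j, 1)
  dsimp only at hy
  rw [ell_shiftEntry_ne _ (show 2 * p ≠ 2 * p + 1 by omega), hy] at h1'
  rw [ell_shiftEntry_ne _ (show 2 * p + 2 ≠ 2 * p + 1 by omega), hy] at h2'
  have hself : rowShift (ell α (2 * p + 1)) (j, 1) j = ell α (2 * p + 1) j + 1 :=
    rowShift_self _ (j, 1)
  have hone : ∀ r ∈ Finset.Icc 1 p, 1 ≤ ell α (2 * p + 1) r := fun r hr => h1.one_le le_rfl rfl hr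
  have hj1 := hone j hj
  refine mul_pos (div_pos (mul_pos ?_ ?_) ?_) (one_div_pos.2 (mul_pos (mul_pos (pow_pos
    (hs _ ?_) 2) (hs _ ?_)) (hs _ ?_)))
  · refine Finset.prod_pos fun r hr => mul_pos (hs _ ?_) (hs _ ?_)
    · linarith [h2.one_le_add zero_le_one rfl hr hj]
    · linarith [h2.one_le_abs_sub_of_raise_right h2' hr hj]
  · refine Finset.prod_pos fun r hr => mul_pos (hs _ ?_) (hs _ ?_)
    · linarith [h1.one_le_add le_rfl rfl hr hj]
    · linarith [h1.one_le_abs_sub_of_raise_right h1' hr hj]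
  · refine Finset.prod_pos fun r hr => ?_
    obtain ⟨hrj, hr'⟩ := Finset.mem_erase.1 hr
    have hr1 := hone r hr'
    rw [Finset.mem_Icc] at hr'
    have e2 : 2 ≤ ell α (2 * p + 1) r - ell α (2 * p + 1) j ∨
        1 ≤ ell α (2 * p + 1) j - ell α (2 * p + 1) r := by
      rcases lt_or_gt_of_ne hrj with hlt | hlt
      · have := h1.y_gap h1' hr'.1 hlt hp.2
        rw [hself] at this; left; linarith
      · have := h1.y_gap h1 hp.1 hlt hr'.2; right; linarith
    refine mul_pos (mul_pos (mul_pos (hs _ ?_) (hs _ ?_)) (hs _ ?_)) (hs _ ?_)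
    · linarith
    · rw [lt_abs]; rcases e2 with e | e
      · left; linarith
      · right; linarith
    · linarith
    · rw [lt_abs]; rcases e2 with e | e
      · left; linarith
      · right; linarith
  · linarith
  · linarith
  · linarith

theorem qNum_ofReal (h : ℝ) (b : ℚ) :
    qNum h b = ((Real.sinh (h * b / 2) / Real.sinh (h / 2) : ℝ) : ℂ) := by
  rw [qNum, Real.sinh_eq, Real.sinh_eq, div_div_div_cancel_right₀ two_ne_zero]
  push_cast
  rfl

theorem qHalf_ofReal (h : ℝ) (b : ℚ) :
    qHalf h b = ((1 / (Real.exp (h * b / 2) + Real.exp (-(h * b / 2))) : ℝ) : ℂ) := by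
  rw [qHalf]
  push_cast
  rfl

theorem qNum_pos {h : ℝ} (hh : h ≠ 0) {b : ℚ} (hb : 0 < b) : 0 < qNum h b := by
  rw [qNum_ofReal, Complex.zero_lt_real]
  have hb' : (0 : ℝ) < b := by exact_mod_cast hb
  rcases lt_or_gt_of_ne hh with hlt | hlt
  · exact div_pos_of_neg_of_neg (Real.sinh_neg_iff.2 (by nlinarith)) (Real.sinh_neg_iff.2 (by linarith))
  · exact div_pos (Real.sinh_pos_iff.2 (by positivity)) (Real.sinh_pos_iff.2 (by positivity))

theorem qHalf_pos (h : ℝ) (b : ℚ) : 0 < qHalf h b := by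
  rw [qHalf_ofReal, Complex.zero_lt_real]
  positivity

/-- The positive square root of a positive complex number. -/
def posRoot (z : ℂ) : ℂ := (Real.sqrt z.re : ℂ)

theorem posRoot_sq {z : ℂ} (hz : 0 ≤ z) : posRoot z ^ 2 = z := by
  obtain ⟨h1, h2⟩ := Complex.nonneg_iff.1 hz
  rw [posRoot, ← Complex.ofReal_pow, Real.sq_sqrt h1]
  exact Complex.ext rfl h2

theorem posRoot_pos {z : ℂ} (hz : 0 < z) : 0 < posRoot z := by
  rw [posRoot, Complex.zero_lt_real, Real.sqrt_pos]
  exact (Complex.pos_iff.1 hz).1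

/-- Positivity puts z on the principal branch, so the principal root of z^2 is z and not -z. -/
theorem sq_cpow_half {z : ℂ} (hz : 0 < z) : (z ^ 2) ^ (1 / 2 : ℂ) = z := by
  have := Complex.sq_cpow_two_inv (Complex.pos_iff.1 hz).1
  rw [one_div]
  exact_mod_cast this

theorem conj_eq_of_pos {z : ℂ} (hz : 0 < z) : conj z = z :=
  Complex.conj_eq_iff_im.2 (Complex.pos_iff.1 hz).2.symm

/-- The positive roots of the `q`-numbers of absolute values. -/
def qNumRoot (h : ℝ) (b : ℚ) : ℂ := posRoot (qNum h |b|)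

/-- The positive roots of `[b] / [2b]`. -/
def qHalfRoot (h : ℝ) (b : ℚ) : ℂ := posRoot (qHalf h b)

theorem qNumRoot_sq {h : ℝ} (hh : h ≠ 0) (b : ℚ) : qNumRoot h b ^ 2 = qNum h |b| := by
  refine posRoot_sq ?_
  rcases eq_or_ne b 0 with rfl | hb
  · rw [abs_zero, qNum_zero]
  · exact (qNum_pos hh (abs_pos.2 hb)).le

theorem qHalfRoot_sq (h : ℝ) (b : ℚ) : qHalfRoot h b ^ 2 = qHalf h b :=
  posRoot_sq (qHalf_pos h b).le

theorem isEvenRoot_qNumRoot {h : ℝ} (hh : h ≠ 0) : IsEvenRoot h (qNumRoot h) :=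
  ⟨fun b => by rw [qNumRoot, qNumRoot, abs_neg],
    fun b hb => by rw [qNumRoot_sq hh, abs_of_nonneg hb]⟩

theorem qNumRoot_pos {h : ℝ} (hh : h ≠ 0) (b : ℚ) (hb : 0 < b) : 0 < qNumRoot h b :=
  posRoot_pos (qNum_pos hh (abs_pos.2 hb.ne'))

/-- The product of the positive roots of the factors is a positive square root of the whole
expression, hence its principal root. -/
theorem gtCoeffA_eq {n : ℕ} {m : ℕ → ℚ} {h : ℝ} (hh : h ≠ 0) {p j : ℕ} (hj : j ∈ Finset.Icc 1 p)
    (hpn : 2 * p + 1 ≤ n) {α : ℕ → ℕ → ℚ} (hα : IsGTPattern n m α)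
    (hα' : IsGTPattern n m (shiftEntry α (2 * p) j 1)) :
    gtCoeffA h p j α = gtA (qNumRoot h) (qHalfRoot h) p j α := by
  rw [gtCoeffA, gtA_abs _ _ hj hpn hα, ← gtA_sq (qNumRoot_sq hh) (qHalfRoot_sq h)]
  exact sq_cpow_half (gtA_pos (qNumRoot_pos hh) (fun b => posRoot_pos (qHalf_pos h b)) hj hpn hα hα')

theorem gtCoeffB_eq {n : ℕ} {m : ℕ → ℚ} {h : ℝ} (hh : h ≠ 0) {p j : ℕ} (hj : j ∈ Finset.Icc 1 p)
    (hpn : 2 * p + 2 ≤ n) {α : ℕ → ℕ → ℚ} (hα : IsGTPattern n m α)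
    (hα' : IsGTPattern n m (shiftEntry α (2 * p + 1) j 1)) :
    gtCoeffB h p j α = gtB (qNumRoot h) p j α := by
  rw [gtCoeffB, gtB_abs _ hj hpn hα, ← gtB_sq (qNumRoot_sq hh)]
  exact sq_cpow_half (gtB_pos (qNumRoot_pos hh) hj hpn hα hα')

theorem conj_gtCoeffA {n : ℕ} {m : ℕ → ℚ} {h : ℝ} (hh : h ≠ 0) {p j : ℕ}
    (hj : j ∈ Finset.Icc 1 p) (hpn : 2 * p + 1 ≤ n) {α : ℕ → ℕ → ℚ} (hα : IsGTPattern n m α)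
    (hα' : IsGTPattern n m (shiftEntry α (2 * p) j 1)) :
    conj (gtCoeffA h p j α) = gtCoeffA h p j α := by
  rw [gtCoeffA_eq hh hj hpn hα hα']
  exact conj_eq_of_pos (gtA_pos (qNumRoot_pos hh) (fun b => posRoot_pos (qHalf_pos h b)) hj hpn hα hα')

theorem conj_gtCoeffB {n : ℕ} {m : ℕ → ℚ} {h : ℝ} (hh : h ≠ 0) {p j : ℕ}
    (hj : j ∈ Finset.Icc 1 p) (hpn : 2 * p + 2 ≤ n) {α : ℕ → ℕ → ℚ} (hα : IsGTPattern n m α)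
    (hα' : IsGTPattern n m (shiftEntry α (2 * p + 1) j 1)) :
    conj (gtCoeffB h p j α) = gtCoeffB h p j α := by
  rw [gtCoeffB_eq hh hj hpn hα hα']
  exact conj_eq_of_pos (gtB_pos (qNumRoot_pos hh) hj hpn hα hα')

end

theorem notRootOfUnity_ofReal {h : ℝ} (hh : h ≠ 0) : NotRootOfUnity h := by
  intro k hk h1
  rw [← Complex.exp_nat_mul] at h1
  have h2 : Real.exp (k * h) = 1 := by exact_mod_cast h1
  rw [Real.exp_eq_one_iff, mul_eq_zero] at h2
  rcases h2 with h2 | h2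
  · exact hk.ne' (by exact_mod_cast h2)
  · exact hh h2

theorem gtOp_principal_relations {h : ℝ} (hh : h ≠ 0) {n : ℕ} {m : ℕ → ℚ}
    (hm : ∃ z : ℤ, 2 * m 1 = z) :
    SatisfiesSoRelations (h : ℂ) n
      (fun i : SoIndex n => gtOp h n m (gtCoeffA h) (gtCoeffB h) i.1) := by
  have hop : (fun i : SoIndex n => gtOp h n m (gtCoeffA h) (gtCoeffB h) i.1) =
      fun i : SoIndex n => gtOp h n m (gtA (qNumRoot h) (qHalfRoot h)) (gtB (qNumRoot h)) i.1 := by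
    funext i
    exact gtOp_congr (fun p j α hj hpn hα hα' => gtCoeffA_eq hh hj hpn hα hα')
      (fun p j α hj hpn hα hα' => gtCoeffB_eq hh hj hpn hα hα') i.2.1 i.2.2
  rw [hop]
  exact gtOp_relations_of_even (isEvenRoot_qNumRoot hh) hm (notRootOfUnity_ofReal hh)
    (qHalfRoot_sq h)

/-! ## The adjoint -/

open Classical in
theorem inner_ket {n : ℕ} {m : ℕ → ℚ} {α γ : ℕ → ℕ → ℚ} (hγ : IsGTPattern n m γ) :
    inner ℂ (ket n m α) (ket n m γ) = if α = γ then 1 else 0 := by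
  by_cases hα : IsGTPattern n m α
  · obtain ⟨a, rfl⟩ : ∃ a : GTPattern n m, a.1 = α := ⟨⟨α, hα⟩, rfl⟩
    obtain ⟨c, rfl⟩ : ∃ c : GTPattern n m, c.1 = γ := ⟨⟨γ, hγ⟩, rfl⟩
    rw [ket_eq_toBasis, ket_eq_toBasis, OrthonormalBasis.coe_toBasis,
      orthonormal_iff_ite.1 (EuclideanSpace.basisFun (GTPattern n m) ℂ).orthonormal]
    exact if_congr Subtype.ext_iff rfl rfl
  · rw [ket, dif_neg hα, inner_zero_left, if_neg]
    rintro rfl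
    exact hα hγ

/-- Lowering from γ to β and raising from β to γ use the same coefficient, real by hypothesis and
with opposite signs; the inner product matches the two sums term by term. -/
theorem inner_gtMove {n : ℕ} {m : ℕ → ℚ} {C : ℕ → (ℕ → ℕ → ℚ) → ℂ} {k : ℕ}
    (hC : ∀ j α, j ∈ Finset.Icc 1 (k / 2) → IsGTPattern n m α →
      IsGTPattern n m (shiftEntry α k j 1) → conj (C j α) = C j α)
    {β γ : ℕ → ℕ → ℚ} (hβ : IsGTPattern n m β) (hγ : IsGTPattern n m γ) :
    inner ℂ (gtMove n m C k β) (ket n m γ) = -inner ℂ (ket n m β) (gtMove n m C k γ) := by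
  classical
  have key : ∀ {β γ : ℕ → ℕ → ℚ}, IsGTPattern n m β → IsGTPattern n m γ →
      ∀ j ∈ Finset.Icc 1 (k / 2),
      inner ℂ (C j β • ket n m (shiftEntry β k j 1)) (ket n m γ) =
        inner ℂ (ket n m β) (C j (shiftEntry γ k j (-1)) • ket n m (shiftEntry γ k j (-1))) := by
    intro β γ hβ hγ j hj
    rw [inner_smul_left, inner_smul_right, inner_ket hγ, ← inner_conj_symm, inner_ket hβ]
    have b1 := shiftEntry_back β k (j, 1)
    have b2 := shiftEntry_back γ k (j, -1)
    dsimp only at b1 b2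
    rw [neg_neg] at b2
    by_cases e : shiftEntry β k j 1 = γ
    · subst e
      rw [b1, if_pos rfl, if_pos rfl, hC j β hj hβ hγ, map_one]
    · rw [if_neg e, if_neg, map_zero, mul_zero, mul_zero]
      rintro rfl
      exact e b2
  have key' : ∀ j ∈ Finset.Icc 1 (k / 2),
      inner ℂ (C j (shiftEntry β k j (-1)) • ket n m (shiftEntry β k j (-1))) (ket n m γ) =
        inner ℂ (ket n m β) (C j γ • ket n m (shiftEntry γ k j 1)) := by
    intro j hj
    rw [← inner_conj_symm, ← key hγ hβ j hj, inner_conj_symm]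
  rw [gtMove, gtMove, inner_sub_left, inner_sub_right, neg_sub, sum_inner, sum_inner, inner_sum,
    inner_sum, Finset.sum_congr rfl (key hβ hγ), Finset.sum_congr rfl key']

theorem conj_gtDiag (h : ℝ) (p : ℕ) (α : ℕ → ℕ → ℚ) : conj (gtDiag h p α) = gtDiag h p α := by
  simp only [gtDiag, qNum_ofReal, map_mul, map_prod, map_inv₀, Complex.conj_ofReal]

/-- The moving part is skew by `inner_gtMove`. The diagonal part is i times a real number, since for
real h all q-numbers are real. -/
theorem adjoint_gtOp {h : ℝ} {n : ℕ} {m : ℕ → ℚ} {A B : ℕ → ℕ → (ℕ → ℕ → ℚ) → ℂ}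
    (hA : ∀ p j α, j ∈ Finset.Icc 1 p → 2 * p + 1 ≤ n → IsGTPattern n m α →
      IsGTPattern n m (shiftEntry α (2 * p) j 1) → conj (A p j α) = A p j α)
    (hB : ∀ p j α, j ∈ Finset.Icc 1 p → 2 * p + 2 ≤ n → IsGTPattern n m α →
      IsGTPattern n m (shiftEntry α (2 * p + 1) j 1) → conj (B p j α) = B p j α)
    {i : ℕ} (h2 : 2 ≤ i) (hin : i ≤ n) :
    ContinuousLinearMap.adjoint (gtOp h n m A B i) = -gtOp h n m A B i := by
  refine ContinuousLinearMap.coe_injective (gtOp_ext fun γ hγ => ?_)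
  refine InnerProductSpace.ext_inner_left_basis
    (EuclideanSpace.basisFun (GTPattern n m) ℂ).toBasis fun β => ?_
  rw [← ket_eq_toBasis]
  change inner ℂ (ket n m β.1) (ContinuousLinearMap.adjoint (gtOp h n m A B i) (ket n m γ)) =
    inner ℂ (ket n m β.1) (-gtOp h n m A B i (ket n m γ))
  rw [ContinuousLinearMap.adjoint_inner_right, inner_neg_right, gtOp_ket _ _ _ β.2,
    gtOp_ket _ _ _ hγ]
  obtain ⟨p, rfl | rfl⟩ : ∃ p, i = 2 * p + 1 ∨ i = 2 * p + 2 := ⟨(i - 1) / 2, by omega⟩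
  · rw [if_pos (odd_two_mul_add_one p), if_pos (odd_two_mul_add_one p)]
    refine inner_gtMove (fun j α hj => ?_) β.2 hγ
    rw [show (2 * p + 1 - 1) / 2 = p by omega] at hj
    rw [show 2 * p + 1 - 1 = 2 * p by omega, show (2 * p + 1) / 2 = p by omega]
    exact hA p j α hj hin
  · rw [if_neg (by simp [parity_simps]), if_neg (by simp [parity_simps]), inner_add_left,
      inner_add_right, inner_gtMove _ β.2 hγ, inner_smul_left, inner_smul_right, neg_add]
    · congr 1
      rw [inner_ket hγ]
      split_ifs with e
      · rw [e, map_mul, conj_gtDiag, Complex.conj_I]; ring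
      · ring
    · intro j α hj
      rw [show (2 * p + 2 - 1) / 2 = p by omega] at hj
      rw [show 2 * p + 2 - 1 = 2 * p + 1 by omega, show (2 * p + 2) / 2 - 1 = p by omega]
      exact hB p j α hj hin

/-! ## The representations -/

namespace UqSo

theorem existsUnique_algHom {R : Type*} [Ring R] [Algebra ℂ R] {h : ℂ} {n : ℕ}
    {X : SoIndex n → R} (hX : SatisfiesSoRelations h n X) :
    ∃! T : UqSo h n →ₐ[ℂ] R, ∀ i, T (gen h n i) = X i :=
  ⟨lift X hX, lift_gen X hX, fun T hT => algHom_ext fun i => by rw [hT, lift_gen]⟩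

/-- A homomorphism that intertwines the stars of the generators is a star homomorphism. -/
theorem map_star_of_gen {R : Type*} [Ring R] [StarRing R] [Algebra ℂ R] [StarModule ℂ R] {h : ℝ}
    {n : ℕ} (T : UqSo (h : ℂ) n →ₐ[ℂ] R)
    (hT : ∀ i, star (T (gen (h : ℂ) n i)) = -T (gen (h : ℂ) n i)) (a : UqSo (h : ℂ) n) :
    T (star a) = star (T a) := by
  -- The map a ↦ (T(a*))* conjugates twice and reverses products twice, so it is again an algebra
  -- homomorphism, and on generators the two minus signs cancel.
  let F : UqSo (h : ℂ) n →ₐ[ℂ] R :=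
    { toFun := fun a => star (T (star a))
      map_one' := by rw [star_one, map_one, star_one]
      map_mul' := fun a b => by rw [star_mul, map_mul, star_mul]
      map_zero' := by rw [star_zero, map_zero, star_zero]
      map_add' := fun a b => by rw [star_add, map_add, star_add]
      commutes' := fun z => by
        rw [← algebraMap_star_comm, AlgHom.commutes, ← algebraMap_star_comm, star_star] }
  have hF : F = T := algHom_ext fun i => by
    change star (T (star (gen (h : ℂ) n i))) = T (gen (h : ℂ) n i)
    rw [star_gen, map_neg, star_neg, hT, neg_neg]
  have := congrArg star (DFunLike.congr_fun hF a)
  change star (star (T (star a))) = star (T a) at this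
  rwa [star_star] at this

theorem existsUnique_starAlgHom {R : Type*} [Ring R] [StarRing R] [Algebra ℂ R] [StarModule ℂ R]
    {h : ℝ} {n : ℕ} {X : SoIndex n → R} (hX : SatisfiesSoRelations (h : ℂ) n X)
    (hstar : ∀ i, star (X i) = -X i) :
    ∃! T : UqSo (h : ℂ) n →⋆ₐ[ℂ] R, ∀ i, T (gen (h : ℂ) n i) = X i := by
  refine ⟨{ lift X hX with
      map_star' := map_star_of_gen (lift X hX) fun i => by rw [lift_gen, hstar] },
    lift_gen X hX, fun T hT => StarAlgHom.ext fun a => ?_⟩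
  have : T.toAlgHom = lift X hX := algHom_ext fun i => (hT i).trans (lift_gen X hX i).symm
  exact DFunLike.congr_fun this a

end UqSo

end

theorem mainTheorem3 (n : ℕ) (hn : 3 ≤ n) (m : ℕ → ℚ) (hm : IsHighestWeight n m) :
    -- every complex `q = e^h` that is not a root of unity, with the square roots taken factorwise
    (∀ h : ℂ, (∀ k : ℕ, 0 < k → Complex.exp h ^ k ≠ 1) →
      ∀ s t : ℚ → ℂ, (∀ b, s b ^ 2 = qNum h b) → (∀ b, t b ^ 2 = qHalf h b) →
        SatisfiesSoRelations h n
          (fun i : SoIndex n => gtOp h n m (gtA s t) (gtB s) i.1) ∧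
        ∃! T : UqSo h n →ₐ[ℂ] (GTSpace n m →L[ℂ] GTSpace n m),
          ∀ i : SoIndex n, T (UqSo.gen h n i) = gtOp h n m (gtA s t) (gtB s) i.1) ∧
    -- positive `q = e^h ≠ 1`, with nonnegative square roots
    (∀ h : ℝ, h ≠ 0 →
      (∀ α : GTPattern n m, ∀ p j : ℕ, 1 ≤ p → 1 ≤ j → j ≤ p →
        (2 * p + 1 ≤ n → IsGTPattern n m (shiftEntry α.1 (2 * p) j 1) →
          0 < (gtA (qNum h) (qHalf h) p j α.1).re ∧ (gtA (qNum h) (qHalf h) p j α.1).im = 0) ∧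
        (2 * p + 2 ≤ n → IsGTPattern n m (shiftEntry α.1 (2 * p + 1) j 1) →
          0 < (gtB (qNum h) p j α.1).re ∧ (gtB (qNum h) p j α.1).im = 0)) ∧
      SatisfiesSoRelations (h : ℂ) n
        (fun i : SoIndex n => gtOp h n m (gtCoeffA h) (gtCoeffB h) i.1) ∧
      (∀ i : SoIndex n,
        ContinuousLinearMap.adjoint (gtOp h n m (gtCoeffA h) (gtCoeffB h) i.1) =
          -gtOp h n m (gtCoeffA h) (gtCoeffB h) i.1) ∧
      ∃! T : UqSo (h : ℂ) n →⋆ₐ[ℂ] (GTSpace n m →L[ℂ] GTSpace n m),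
        ∀ i : SoIndex n, T (UqSo.gen (h : ℂ) n i) =
          gtOp h n m (gtCoeffA h) (gtCoeffB h) i.1) := by
  have hm' := hm.two_mul_int (by omega)
  refine ⟨fun h hh s t hs ht => ?_, fun h hh => ⟨fun α p j hp hj hjp => ?_, ?_, ?_, ?_⟩⟩
  · have hrel := gtOp_relations (n := n) hh hm' hs ht
    exact ⟨hrel, UqSo.existsUnique_algHom hrel⟩
  · have hj' := Finset.mem_Icc.2 ⟨hj, hjp⟩
    refine ⟨fun hpn hα' => ?_, fun hpn hα' => ?_⟩
    · have := Complex.pos_iff.1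
        (gtA_pos (fun b hb => qNum_pos hh hb) (qHalf_pos h) hj' hpn α.2 hα')
      exact ⟨this.1, this.2.symm⟩
    · have := Complex.pos_iff.1 (gtB_pos (fun b hb => qNum_pos hh hb) hj' hpn α.2 hα')
      exact ⟨this.1, this.2.symm⟩
  · exact gtOp_principal_relations hh hm'
  · exact fun i => adjoint_gtOp (fun p j α hj hpn hα hα' => conj_gtCoeffA hh hj hpn hα hα')
      (fun p j α hj hpn hα hα' => conj_gtCoeffB hh hj hpn hα hα') i.2.1 i.2.2
  · exact UqSo.existsUnique_starAlgHom (gtOp_principal_relations hh hm') fun i =>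
      adjoint_gtOp (fun p j α hj hpn hα hα' => conj_gtCoeffA hh hj hpn hα hα')
        (fun p j α hj hpn hα hα' => conj_gtCoeffB hh hj hpn hα hα') i.2.1 i.2.2
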